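/- **Theorem.** For every integer $k \ge 1$ there is a polyhedron $P$ in $\mathbb{R}^3$ with triangular faces such that: 1. $P$ is obtained from a regular tetrahedron by subdividing each face into $k^2$ congruent equilateral triangles and replacing each of these $4k^2$ triangles by an outward-pointing hat. Here a *hat* over a triangle $abc$ consists of nine triangles: with three inner vertices $x,y,z$ and a center $o$, all lying in the right prism erected outward over $abc$, it has the three triangles $bcx,\ cay,\ abz$, the three triangles $ayz,\ bzx,\ cxy$, and the three triangles $oxy,\ oyz,\ ozx$. 2. $P$ is topologically convex: its surface is homeomorphic to the sphere $S^2$ and its graph is a $3$-vertex-connected planar graph. 3. Every face of $P$ is an acute isosceles triangle. 4. Every nonoverlapping multipiece edge unfolding of $P$ has at least $2k^2$ pieces. Here a *polyhedron with triangular faces* is a finite set of nondegenerate triangles in $\mathbb{R}^3$, any two of which meet exactly in the convex hull of their common vertices, such that every edge lies in exactly two triangles and triangles sharing an edge are not coplanar. A *nonoverlapping multipiece edge unfolding* of $P$ consists of a set $C$ of cut edges and, for each face, an isometric placement in the plane, such that the placements of two faces agree along every uncut edge that they share, and distinct faces in the same piece have disjoint interiors in the plane. The *pieces* are the classes of faces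 connected by chains in which consecutive faces share an edge not in $C$. -/

import Mathlib

/-- Euclidean three-space. -/
abbrev E3 : Type := EuclideanSpace ℝ (Fin 3)

/-- The Euclidean plane. -/
abbrev E2 : Type := EuclideanSpace ℝ (Fin 2)

/-- A polyhedron in `ℝ³` all of whose faces are triangles, given by the vertex triples of its faces.
The faces are nondegenerate, any two of them meet exactly in the convex hull of their common
vertices (so the surface does not cross or touch itself), every edge lies on exactly two faces, and
two faces sharing an edge are not coplanar (so that the triangles are the actual facets). -/
structure TriPolyhedron where
  faces : Finset (Finset E3)
  card_eq_three : ∀ t ∈ faces, t.card = 3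
  affineIndependent : ∀ t ∈ faces, AffineIndependent ℝ (fun v : t => (v : E3))
  inter_eq : ∀ s ∈ faces, ∀ t ∈ faces,
    convexHull ℝ (s : Set E3) ∩ convexHull ℝ (t : Set E3) = convexHull ℝ ((s : Set E3) ∩ t)
  two_faces : ∀ e : Finset E3, e.card = 2 → (∃ t ∈ faces, e ⊆ t) →
    {t : Finset E3 | t ∈ faces ∧ e ⊆ t}.ncard = 2
  not_coplanar : ∀ s ∈ faces, ∀ t ∈ faces, s ≠ t →
    (∃ e : Finset E3, e.card = 2 ∧ e ⊆ s ∧ e ⊆ t) → ¬ Coplanar ℝ ((s : Set E3) ∪ t)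

/-- A graph is `n`-vertex-connected if it has more than `n` vertices and deleting fewer than `n`
vertices never disconnects it. -/
def SimpleGraph.IsVertexConn {V : Type*} (G : SimpleGraph V) (n : ℕ) : Prop :=
  n < Nat.card V ∧ ∀ S : Set V, S.Finite → S.ncard < n → (G.induce Sᶜ).Connected

namespace TriPolyhedron

variable (P : TriPolyhedron)

/-- The edges, as sets of two vertices. -/
def edges : Set (Finset E3) := {e | e.card = 2 ∧ ∃ t ∈ P.faces, e ⊆ t}

/-- The surface: the union of the (closed, filled) faces. -/
def surface : Set E3 := ⋃ t ∈ P.faces, convexHull ℝ (t : Set E3)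

/-- The vertices. -/
def vertices : Set E3 := {v | ∃ t ∈ P.faces, v ∈ t}

/-- The graph of the polyhedron. -/
def graph : SimpleGraph P.vertices where
  Adj v w := v ≠ w ∧ ∃ t ∈ P.faces, (v : E3) ∈ t ∧ (w : E3) ∈ t
  symm := ⟨fun _ _ h => ⟨h.1.symm, h.2.imp fun _ ht => ⟨ht.1, ht.2.2, ht.2.1⟩⟩⟩
  loopless := ⟨fun _ h => h.1 rfl⟩

/-- The union of the edges, drawn as straight segments: the geometric realization of the graph. -/
def skeleton : Set E3 := ⋃ e ∈ P.edges, convexHull ℝ (e : Set E3)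

/-- The graph of the polyhedron is planar: its geometric realization embeds in the plane. -/
def GraphIsPlanar : Prop := ∃ f : P.skeleton → E2, Topology.IsEmbedding f

/-- Topologically convex: the surface is a topological sphere and the graph is a
3-vertex-connected planar graph. -/
def TopologicallyConvex : Prop :=
  Nonempty (P.surface ≃ₜ Metric.sphere (0 : E3) 1) ∧ P.graph.IsVertexConn 3 ∧ P.GraphIsPlanar

/-- The dual graph left after cutting: two faces are adjacent if they share an uncut edge. -/
def dualGraph (cut : Set (Finset E3)) : SimpleGraph P.faces where
  Adj s t := s ≠ t ∧ ∃ e ∈ P.edges, e ∉ cut ∧ e ⊆ s.1 ∧ e ⊆ t.1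
  symm := ⟨fun _ _ h => ⟨h.1.symm, h.2.imp fun _ he => ⟨he.1, he.2.1, he.2.2.2, he.2.2.1⟩⟩⟩
  loopless := ⟨fun _ h => h.1 rfl⟩

/-- An edge unfolding of the surface into possibly several planar pieces, none of which overlaps
itself. A set of edges is cut; the pieces are the connected components of the remaining dual graph;
every face is moved into the plane by an affine map that is isometric on the face; two faces sharing
an uncut edge stay attached along that edge; and distinct faces belonging to the same piece have
disjoint interiors in the plane. (So two attached faces lie on opposite sides of their common
edge.) -/
structure EdgeUnfolding where
  cut : Set (Finset E3)
  cut_subset : cut ⊆ P.edges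
  place : P.faces → (E3 →ᵃ[ℝ] E2)
  isometric : ∀ t : P.faces, ∀ x ∈ convexHull ℝ (t.1 : Set E3), ∀ y ∈ convexHull ℝ (t.1 : Set E3),
    dist (place t x) (place t y) = dist x y
  attached : ∀ s t : P.faces, ∀ e ∈ P.edges, e ∉ cut → e ⊆ s.1 → e ⊆ t.1 →
    ∀ x ∈ convexHull ℝ (e : Set E3), place s x = place t x
  nonoverlapping : ∀ s t : P.faces, s ≠ t → (P.dualGraph cut).Reachable s t →
    Disjoint (interior (place s '' convexHull ℝ (s.1 : Set E3)))
      (interior (place t '' convexHull ℝ (t.1 : Set E3)))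

variable {P}

/-- The number of pieces of an unfolding. -/
noncomputable def EdgeUnfolding.numPieces (U : P.EdgeUnfolding) : ℕ :=
  Nat.card (P.dualGraph U.cut).ConnectedComponent

end TriPolyhedron

/-- All angles of the triangle are less than a right angle. -/
def IsAcuteTriangle (t : Finset E3) : Prop :=
  ∀ a ∈ t, ∀ b ∈ t, ∀ c ∈ t, a ≠ b → b ≠ c → a ≠ c →
    EuclideanGeometry.angle a b c < Real.pi / 2

/-- Two sides of the triangle are equal. -/
def IsIsoscelesTriangle (t : Finset E3) : Prop :=
  ∃ a ∈ t, ∃ b ∈ t, ∃ c ∈ t, a ≠ b ∧ b ≠ c ∧ a ≠ c ∧ dist a b = dist a c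

/-- The four points are the vertices of a regular tetrahedron. -/
def IsRegularTetrahedron (T : Fin 4 → E3) : Prop :=
  ∃ l : ℝ, 0 < l ∧ ∀ i j : Fin 4, i ≠ j → dist (T i) (T j) = l

/-- The point with barycentric coordinates `a / k` with respect to `T`. -/
noncomputable def gridPoint (T : Fin 4 → E3) (k : ℕ) (a : Fin 4 → ℕ) : E3 :=
  ∑ i, ((a i : ℝ) / k) • T i

/-- The `k²` small triangles into which the face opposite to `T i` is subdivided, each given by its
vertex set. The first alternative lists those with the orientation of the face (vertices `b + eⱼ`),
the second those with the opposite orientation (vertices `c - eⱼ`). -/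
def smallTriangles (T : Fin 4 → E3) (k : ℕ) (i : Fin 4) : Set (Finset E3) :=
  {t | (∃ b : Fin 4 → ℕ, b i = 0 ∧ (∑ j, b j) + 1 = k ∧
        (t : Set E3) = {p | ∃ j, j ≠ i ∧ p = gridPoint T k (b + Pi.single j 1)}) ∨
      (∃ c : Fin 4 → ℕ, c i = 0 ∧ (∀ j, j ≠ i → 1 ≤ c j) ∧ (∑ j, c j) = k + 1 ∧
        (t : Set E3) = {p | ∃ j, j ≠ i ∧ p = gridPoint T k (c - Pi.single j 1)})}

/-- `n` is normal to the face opposite to `T i` and points out of the tetrahedron. -/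
def IsOutwardNormal (T : Fin 4 → E3) (i : Fin 4) (n : E3) : Prop :=
  (∀ j l : Fin 4, j ≠ i → l ≠ i → inner ℝ n (T j - T l) = 0) ∧
    ∀ j : Fin 4, j ≠ i → 0 < inner ℝ n (T j - T i)

open scoped Classical in
/-- `H` is (the list of faces of) a hat over the triangle `t`, pointing in the direction `n`: with
`a, b, c` the vertices of `t`, there are interior vertices `x, y, z` and a central vertex `o`, all in
the prism over `t` in the direction `n`, and the faces are the three brim triangles, each with an
edge of `t`, the three band triangles, each with a vertex of `t`, and the three crown triangles
around `o`. -/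
def IsHat (t : Finset E3) (n : E3) (H : Finset (Finset E3)) : Prop :=
  ∃ a b c x y z o : E3, t = {a, b, c} ∧
    (∀ v ∈ ({x, y, z, o} : Finset E3),
      ∃ q ∈ convexHull ℝ (t : Set E3), ∃ h : ℝ, 0 < h ∧ v = q + h • n) ∧
    H = {{b, c, x}, {c, a, y}, {a, b, z},
         {a, y, z}, {b, z, x}, {c, x, y},
         {o, x, y}, {o, y, z}, {o, z, x}}

/-- `P` arises from a regular tetrahedron by subdividing each face into `k²` equilateral triangles
and replacing each of these by an outward-pointing hat. -/
def TriPolyhedron.IsHattedTetrahedron (P : TriPolyhedron) (k : ℕ) : Prop :=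
  ∃ (T : Fin 4 → E3) (n : Fin 4 → E3) (hat : Fin 4 → Finset E3 → Finset (Finset E3)),
    IsRegularTetrahedron T ∧ (∀ i, IsOutwardNormal T i (n i)) ∧
    (∀ i, ∀ t ∈ smallTriangles T k i, IsHat t (n i) (hat i t)) ∧
    ∀ f : Finset E3, f ∈ P.faces ↔ ∃ i, ∃ t ∈ smallTriangles T k i, f ∈ hat i t

/-! All hats are similar copies of one rigid model, whose shape is chosen so that the turns needed
in the proof are multiplications by complex numbers with rational coordinates. The bound on the
number of pieces comes from showing that every hat must break, and then counting.

Why a hat breaks. At each inner vertex `x j` the five face angles add up to about 405.7°. With at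
most one of its five edges cut, the faces around it would turn past a full circle and the last would
overlap the first, so at least two edges are cut (`fan_inner`). At `o` the angles add up to about
84.2°, so at least one edge is cut (`fan_center`). Suppose that the nine faces are nevertheless
connected through uncut edges of the hat. Then the cut interior edges, with the three corners of the
base identified to one node, form a forest. By the degree conditions its only possible leaves are
`o` and the corner node, so it is a path from `o` through all three inner vertices to a corner. Such
a path leaves a chain of six faces attached whose first and last members overlap (`chain_overlap`).
In the formal proof the forest argument is replaced by a check of all 2^12 cut patterns
(`isSeparation_componentMask`).

Counting. If the nine faces of a hat lie in one piece, possibly joined through other hats, they do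
not overlap, and the above applies; if not, membership in a piece already separates them. Either way
the faces of each hat split into two classes with no uncut edge between them. With n hats this gives
2n classes, connected only through the at most 3n/2 grid edges, hence at least n/2 components; and n
is at least 4k².

The polyhedron. Each hat is a graph over its small triangle, inside the outward prism. The
continuous map `pushDown` collapses all prisms to the boundary of the tetrahedron at once, and the
convex weights of a surface point can be recovered from its image by piecewise linear nodal
functions (`weights_unique`). From this follow the intersection property, the nondegeneracy of the
faces, and, by radial projection, the homeomorphism with the sphere. Stereographic projection from a
point off the skeleton gives planarity. For 3-connectedness, deleting two vertices blocks at most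
one grid edge, and a parity argument shows that one blocked edge cannot separate the small
triangles. -/

/-! ### Triangles in the complex plane -/

section PlaneTriangles

open Complex Filter Topology
open scoped ComplexConjugate

/-- A point with positive barycentric coordinates lies in the interior of a triangle. -/
theorem mem_interior_triangle {X p w : ℂ} (hp : p ≠ X) (hw : 0 < w.im) {ζ : ℂ}
    (h0 : 0 < ζ.im) (h1 : w.re * ζ.im < ζ.re * w.im)
    (h2 : ζ.re * w.im + (1 - w.re) * ζ.im < w.im) :
    X + (p - X) * ζ ∈ interior (convexHull ℝ {X, p, X + (p - X) * w}) := by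
  have hd : p - X ≠ 0 := sub_ne_zero.2 hp
  let g : ℂ → ℂ := fun z => (z - X) / (p - X)
  have hg : Continuous g := by fun_prop
  let U : Set ℂ := {z | 0 < (g z).im ∧ w.re * (g z).im < (g z).re * w.im ∧
    (g z).re * w.im + (1 - w.re) * (g z).im < w.im}
  have hU : IsOpen U := by
    have a := continuous_re.comp hg
    have b := continuous_im.comp hg
    exact (isOpen_lt continuous_const b).and ((isOpen_lt (continuous_const.mul b)
      (a.mul continuous_const)).and
      (isOpen_lt ((a.mul continuous_const).add (continuous_const.mul b)) continuous_const))
  -- After normalising `X` to 0 and `p` to 1, write ξ = a + b w. The strict inequalities defining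
  -- `U` say that b, a and 1 - a - b are positive.
  have hsub : U ⊆ convexHull ℝ {X, p, X + (p - X) * w} := by
    rintro z ⟨hz0, hz1, hz2⟩
    set ξ := g z with hξ
    have hz : z = X + (p - X) * ξ := by
      simp only [hξ, g]; field_simp; ring
    set b := ξ.im / w.im with hb
    set a := ξ.re - w.re * b with ha
    have hbim : b * w.im = ξ.im := by rw [hb]; field_simp
    have hb0 : 0 < b := by positivity
    have ha0 : 0 < a := by
      have : 0 < a * w.im := by
        rw [ha, sub_mul, mul_assoc, hbim]; linarith
      exact pos_of_mul_pos_left this hw.le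
    have hab : 0 < 1 - a - b := by
      have : 0 < (1 - a - b) * w.im := by
        rw [show (1 - a - b) * w.im = w.im - ξ.re * w.im + w.re * (b * w.im) - b * w.im by
          rw [ha]; ring, hbim]
        linarith
      exact pos_of_mul_pos_left this hw.le
    have hξe : ξ = a + b * w := by
      apply Complex.ext
      · simp [ha]; ring
      · simp [hbim]
    have hz' : z = (1 - a - b) • X + a • p + b • (X + (p - X) * w) := by
      rw [hz, hξe]; simp only [real_smul]; push_cast; ring
    rw [hz']
    have hc := convex_convexHull ℝ ({X, p, X + (p - X) * w} : Set ℂ)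
    have m1 : X ∈ convexHull ℝ ({X, p, X + (p - X) * w} : Set ℂ) :=
      subset_convexHull _ _ (by simp)
    have m2 : p ∈ convexHull ℝ ({X, p, X + (p - X) * w} : Set ℂ) :=
      subset_convexHull _ _ (by simp)
    have m3 : X + (p - X) * w ∈ convexHull ℝ ({X, p, X + (p - X) * w} : Set ℂ) :=
      subset_convexHull _ _ (by simp)
    have := hc.sum_mem (t := (Finset.univ : Finset (Fin 3)))
      (w := ![1 - a - b, a, b]) (z := ![X, p, X + (p - X) * w])
      (by intro i _; fin_cases i <;> simp <;> linarith)
      (by simp only [Fin.sum_univ_three]; simp; ring)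
      (by intro i _; fin_cases i <;> simpa)
    simp only [Fin.sum_univ_three] at this
    exact this
  refine interior_maximal hsub hU ?_
  have : g (X + (p - X) * ζ) = ζ := by simp only [g]; field_simp; ring
  simp only [U, Set.mem_ofPred_eq, this]
  exact ⟨h0, h1, h2⟩

/-- A triangle meeting the interior of another set does so in an interior point. -/
theorem not_disjoint_interior_of_mem {A B : Set ℂ} {m : ℂ} (hB : Convex ℝ B)
    (hne : (interior B).Nonempty) (hA : m ∈ interior A) (hm : m ∈ B) :
    ¬ Disjoint (interior A) (interior B) := by
  have : m ∈ closure (interior B) := by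
    rw [hB.closure_interior_eq_closure_of_nonempty_interior hne]; exact subset_closure hm
  obtain ⟨y, hy, hy'⟩ := mem_closure_iff.1 this _ isOpen_interior hA
  exact Set.not_disjoint_iff.2 ⟨y, hy, hy'⟩

theorem interior_triangle_nonempty {X p w : ℂ} (hp : p ≠ X) (hw : 0 < w.im) :
    (interior (convexHull ℝ {X, p, X + (p - X) * w})).Nonempty := by
  refine ⟨_, mem_interior_triangle hp hw (ζ := ⟨(1 + w.re) / 3, w.im / 3⟩) ?_ ?_ ?_⟩ <;>
    simp only <;> nlinarith

/-- Two triangles on the same side of a common edge overlap. -/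
theorem not_disjoint_of_same_side {X p w w' : ℂ} (hp : p ≠ X) (hw : 0 < w.im) (hw' : 0 < w'.im) :
    ¬ Disjoint (interior (convexHull ℝ {X, p, X + (p - X) * w}))
      (interior (convexHull ℝ {X, p, X + (p - X) * w'})) := by
  -- Points just above the midpoint of the common edge lie inside every triangle erected on the
  -- positive side of that edge.
  have key : ∀ v : ℂ, 0 < v.im → ∀ᶠ δ : ℝ in 𝓝[>] 0, X + (p - X) * (⟨1 / 2, δ⟩ : ℂ) ∈
      interior (convexHull ℝ {X, p, X + (p - X) * v}) := by
    intro v hv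
    have e0 : ∀ᶠ δ : ℝ in 𝓝[>] 0, 0 < δ := self_mem_nhdsWithin
    have e1 : ∀ᶠ δ : ℝ in 𝓝[>] 0, v.re * δ < 1 / 2 * v.im := by
      refine (Tendsto.eventually_lt_const (u := 1 / 2 * v.im) (v := v.re * 0) (by simpa) ?_)
      exact ((continuous_const.mul continuous_id).tendsto 0).mono_left nhdsWithin_le_nhds
    have e2 : ∀ᶠ δ : ℝ in 𝓝[>] 0, 1 / 2 * v.im + (1 - v.re) * δ < v.im := by
      refine (Tendsto.eventually_lt_const (u := v.im) (v := 1 / 2 * v.im + (1 - v.re) * 0)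
        (by linarith) ?_)
      exact ((continuous_const.add (continuous_const.mul continuous_id)).tendsto 0).mono_left
        nhdsWithin_le_nhds
    filter_upwards [e0, e1, e2] with δ h0 h1 h2
    exact mem_interior_triangle hp hv h0 h1 h2
  obtain ⟨δ, h1, h2⟩ := ((key w hw).and (key w' hw')).exists
  exact Set.not_disjoint_iff.2 ⟨_, h1, h2⟩

/-- A triangle with prescribed side lengths is determined up to reflection. -/
theorem eq_or_eq_conj_of_normSq {X q r w : ℂ} (hq : q ≠ X)
    (d1 : normSq (r - X) = normSq (q - X) * normSq w)
    (d2 : normSq (r - q) = normSq (q - X) * normSq (w - 1)) :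
    r - X = (q - X) * w ∨ r - X = (q - X) * conj w := by
  have hd : q - X ≠ 0 := sub_ne_zero.2 hq
  obtain ⟨ξ, hξ⟩ : ∃ ξ, r - X = (q - X) * ξ := ⟨(r - X) / (q - X), by field_simp⟩
  have hr : r - q = (q - X) * (ξ - 1) := by linear_combination hξ
  have hn : normSq (q - X) ≠ 0 := by simpa [normSq_eq_zero] using hd
  rw [hξ, normSq_mul] at d1
  rw [hr, normSq_mul] at d2
  have d1 := mul_left_cancel₀ hn d1
  have d2 := mul_left_cancel₀ hn d2
  simp only [normSq_apply, sub_re, sub_im, one_re, one_im] at d1 d2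
  have hre : ξ.re = w.re := by nlinarith
  have him : (ξ.im - w.im) * (ξ.im + w.im) = 0 := by rw [hre] at d1; linarith
  rcases mul_eq_zero.1 him with h | h
  · left; rw [hξ]; congr 1; exact Complex.ext hre (by linarith)
  · right; rw [hξ]; congr 1; exact Complex.ext (by simpa using hre) (by simp; linarith)

/-- Two attached triangles that do not overlap lie on opposite sides of their common edge. -/
theorem opposite_side {X p q r w w' : ℂ} (hw : 0 < w.im) (hw' : 0 < w'.im) (hp : p ≠ X)
    (hq : q - X = (p - X) * w)
    (d1 : normSq (r - X) = normSq (q - X) * normSq w')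
    (d2 : normSq (r - q) = normSq (q - X) * normSq (w' - 1))
    (hdisj : Disjoint (interior (convexHull ℝ {X, p, q})) (interior (convexHull ℝ {X, q, r}))) :
    r - X = (q - X) * w' := by
  have hw0 : w ≠ 0 := by rintro rfl; simp at hw
  have hd : p - X ≠ 0 := sub_ne_zero.2 hp
  have hqX : q ≠ X := by
    rw [← sub_ne_zero, hq]; exact mul_ne_zero hd hw0
  refine (eq_or_eq_conj_of_normSq hqX d1 d2).resolve_right fun hr => ?_
  have hpq : p - X = (q - X) * w⁻¹ := by rw [hq]; field_simp
  -- In the excluded case both triangles lie on the negative side of the edge from `X` to `q`.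
  -- Conjugation moves both to the positive side, where `not_disjoint_of_same_side` applies.
  let φ : ℂ ≃ₗᵢ[ℝ] ℂ := conjLIE
  have him : ∀ S : Set ℂ, φ '' interior (convexHull ℝ S) = interior (convexHull ℝ (φ '' S)) := by
    intro S
    rw [← (show (φ : ℂ → ℂ) '' convexHull ℝ S = convexHull ℝ (φ '' S) from
      φ.toLinearEquiv.toLinearMap.image_convexHull S)]
    exact φ.toHomeomorph.image_interior _
  have h3 := (Set.disjoint_image_iff φ.injective).2 hdisj
  rw [him, him] at h3
  simp only [Set.image_insert_eq, Set.image_singleton] at h3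
  have hc : ∀ z, φ z = conj z := fun z => rfl
  simp only [hc] at h3
  have e1 : conj p = conj X + (conj q - conj X) * conj w⁻¹ := by
    rw [← map_sub, ← map_mul, ← hpq, map_sub]; ring
  have e2 : conj r = conj X + (conj q - conj X) * w' := by
    have := congrArg conj hr
    simp only [map_sub, map_mul, conj_conj] at this
    linear_combination this
  have hq' : conj q ≠ conj X := fun h => hqX ((starRingEnd ℂ).injective h)
  have hwi : 0 < (conj w⁻¹).im := by
    rw [conj_im, inv_im]
    have : 0 < normSq w := normSq_pos.2 hw0
    rw [neg_div, neg_neg]; positivity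
  refine not_disjoint_of_same_side hq' hwi hw' ?_
  rw [← e1, ← e2]
  rwa [Set.pair_comm (conj p)] at h3

/-- If turning about `X` from `p` by more than a full turn leads to `p'` and `p'` lies in direction
of the interior of the first triangle, then the first and the last triangle overlap. -/
theorem not_disjoint_of_overturn {X p p' r w u v : ℂ} (hp : p ≠ X) (hp' : p' - X = (p - X) * u)
    (hw : 0 < w.im) (hu : 0 < u.im) (hwu : w.re * u.im < u.re * w.im)
    (hv : 0 < v.im) (hr : p' - X = (r - X) * v) :
    ¬ Disjoint (interior (convexHull ℝ {X, p, X + (p - X) * w}))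
      (interior (convexHull ℝ {X, r, p'})) := by
  have hd : p - X ≠ 0 := sub_ne_zero.2 hp
  have hu0 : u ≠ 0 := by rintro rfl; simp at hu
  have hrX : r ≠ X := by
    rintro rfl
    rw [sub_self, zero_mul, hp'] at hr
    exact mul_ne_zero hd hu0 hr
  -- Near `X` only the two sides through `X` constrain the first triangle, so the point of the
  -- segment from `X` to `p'` at a small ratio `δ` is interior to it.
  obtain ⟨δ, hδ0, hδ1, hδ⟩ : ∃ δ : ℝ, 0 < δ ∧ δ < 1 ∧
      δ * (u.re * w.im + (1 - w.re) * u.im) < w.im := by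
    set M := u.re * w.im + (1 - w.re) * u.im
    refine ⟨w.im / (w.im + |M| + 1), by positivity, ?_, ?_⟩
    · rw [div_lt_one (by positivity)]; linarith [abs_nonneg M]
    · rw [div_mul_eq_mul_div, div_lt_iff₀ (by positivity)]
      nlinarith [le_abs_self M, abs_nonneg M]
  have hm := mem_interior_triangle (ζ := δ * u) hp hw (by simp; positivity)
    (by simp; nlinarith) (by simp; nlinarith)
  have e : p' = X + (r - X) * v := by linear_combination hr
  refine not_disjoint_interior_of_mem (convex_convexHull ℝ _) ?_ hm ?_
  · rw [e]; exact interior_triangle_nonempty hrX hv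
  · have : X + (p - X) * (δ * u) = (1 - δ) • X + δ • p' := by
      rw [show p' = X + (p - X) * u by linear_combination hp']
      simp only [real_smul]; push_cast; ring
    rw [this]
    exact (convex_convexHull ℝ _) (subset_convexHull _ _ (by simp)) (subset_convexHull _ _ (by simp))
      (by linarith) hδ0.le (by ring)

end PlaneTriangles

/-! ### The combinatorics of a hat -/

/-- The vertices of a hat: the corners of the base, the inner vertices, and the centre. -/
inductive HatVertex
  | c (j : Fin 3)
  | x (j : Fin 3)
  | o
  deriving DecidableEq, Fintype

/-- The faces of a hat. -/
inductive HatFace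
  | brim (j : Fin 3)
  | band (j : Fin 3)
  | crown (j : Fin 3)
  deriving DecidableEq, Fintype

open HatVertex HatFace

/-- The vertices of a face of a hat. -/
def HatFace.verts : HatFace → Finset HatVertex
  | brim j => {c (j + 1), c (j + 2), x j}
  | band j => {c j, x (j + 1), x (j + 2)}
  | crown j => {o, x (j + 1), x (j + 2)}

/-- Squared lengths of the edges of the model hat, over a triangle with squared side `2`. -/
noncomputable def HatVertex.sqLen : HatVertex → HatVertex → ℝ
  | c i, c j => if i = j then 0 else 2
  | c i, x j => if i = j then 0 else 841 / 800
  | x i, c j => if i = j then 0 else 841 / 800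
  | x i, x j => if i = j then 0 else 289 / 5000
  | x _, o => 4913 / 20000
  | o, x _ => 4913 / 20000
  | o, o => 0
  | c _, o => 0
  | o, c _ => 0

/-- Planar positions of the faces of a hat, scaled by `√ρ`, in which faces sharing an uncut edge are
attached and no two faces overlap. -/
structure IsHatLayout (Q : HatFace → HatVertex → ℂ) (cut : HatVertex → HatVertex → Prop) (ρ : ℝ) :
    Prop where
  pos : 0 < ρ
  shape : ∀ f, ∀ u ∈ f.verts, ∀ v ∈ f.verts, Complex.normSq (Q f u - Q f v) = ρ * u.sqLen v
  attached : ∀ f g u v, u ≠ v → u ∈ f.verts → v ∈ f.verts → u ∈ g.verts → v ∈ g.verts →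
    ¬ cut u v → Q f u = Q g u ∧ Q f v = Q g v
  disjoint : ∀ f g, f ≠ g → Disjoint (interior (convexHull ℝ (Q f '' f.verts)))
    (interior (convexHull ℝ (Q g '' g.verts)))

/-! ### Cut patterns of a hat that force an overlap. -/

namespace IsHatLayout

open Complex
open scoped ComplexConjugate

variable {Q : HatFace → HatVertex → ℂ} {cut : HatVertex → HatVertex → Prop} {ρ : ℝ}

/-- The mirror image of a layout is a layout. -/
theorem mirror (h : IsHatLayout Q cut ρ) : IsHatLayout (fun f v => conj (Q f v)) cut ρ where
  pos := h.pos
  shape f u hu v hv := by rw [← map_sub, normSq_conj]; exact h.shape f u hu v hv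
  attached f g u v huv a b a' b' hc := by
    obtain ⟨h1, h2⟩ := h.attached f g u v huv a b a' b' hc
    exact ⟨congrArg _ h1, congrArg _ h2⟩
  disjoint f g hfg := by
    let φ : ℂ ≃ₗᵢ[ℝ] ℂ := conjLIE
    have him : ∀ f : HatFace, interior (convexHull ℝ ((fun v => (starRingEnd ℂ) (Q f v)) '' f.verts))
        = φ '' interior (convexHull ℝ (Q f '' f.verts)) := by
      intro f
      have e1 : φ '' interior (convexHull ℝ (Q f '' f.verts)) =
        interior (φ '' (convexHull ℝ (Q f '' f.verts))) := φ.toHomeomorph.image_interior _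
      have e2 : φ '' (convexHull ℝ (Q f '' f.verts)) = convexHull ℝ (φ '' (Q f '' f.verts)) :=
        φ.toLinearEquiv.toLinearMap.image_convexHull _
      rw [e1, e2, Set.image_image]; rfl
    rw [him, him, Set.disjoint_image_iff φ.injective]
    exact h.disjoint f g hfg

theorem ne (h : IsHatLayout Q cut ρ) {f : HatFace} {u v : HatVertex} (hu : u ∈ f.verts)
    (hv : v ∈ f.verts) (hne : 0 < u.sqLen v) : Q f u ≠ Q f v := by
  intro he
  have := h.shape f u hu v hv
  rw [he, sub_self, map_zero] at this
  have := mul_pos h.pos hne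
  linarith

/-- Turning about `X` from one face to the next one through an uncut edge. -/
theorem turn (h : IsHatLayout Q cut ρ) {f g : HatFace} (hfg : f ≠ g) {X p q r : HatVertex}
    {w w' : ℂ} (hf : f.verts = {X, p, q}) (hg : g.verts = {X, q, r}) (hXq : ¬ cut X q)
    (hne : X ≠ q) (hw : 0 < w.im) (hw' : 0 < w'.im) (hp : 0 < p.sqLen X)
    (hq : Q f q - Q f X = (Q f p - Q f X) * w)
    (d1 : r.sqLen X = q.sqLen X * normSq w') (d2 : r.sqLen q = q.sqLen X * normSq (w' - 1)) :
    Q g X = Q f X ∧ Q g q = Q f q ∧ Q g r - Q g X = (Q g q - Q g X) * w' := by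
  obtain ⟨e1, e2⟩ := h.attached f g X q hne (by simp [hf]) (by simp [hf]) (by simp [hg])
    (by simp [hg]) hXq
  refine ⟨e1.symm, e2.symm, ?_⟩
  have hdis := h.disjoint f g hfg
  rw [hf, hg] at hdis
  simp only [Finset.coe_insert, Finset.coe_singleton, Set.image_insert_eq,
    Set.image_singleton] at hdis
  rw [← e1, ← e2] at hdis
  rw [← e1, ← e2]
  have s1 := h.shape g r (by simp [hg]) X (by simp [hg])
  have s2 := h.shape g r (by simp [hg]) q (by simp [hg])
  have s3 := h.shape g q (by simp [hg]) X (by simp [hg])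
  rw [← e1] at s1
  rw [← e2] at s2
  rw [← e1, ← e2] at s3
  refine opposite_side hw hw' (h.ne (by simp [hf]) (by simp [hf]) hp) hq ?_ ?_ hdis
  · rw [s1, s3, d1]; ring
  · rw [s2, s3, d2]; ring

/-- The side lengths fix a face up to reflection, and the whole layout may be mirrored. So one
starting face can be taken positively oriented; `turn` then passes the orientation on from face to
face. -/
theorem exists_orientation (h : IsHatLayout Q cut ρ) {f : HatFace} {X p q : HatVertex} {w : ℂ}
    (hf : f.verts = {X, p, q}) (hp : 0 < p.sqLen X)
    (d1 : q.sqLen X = p.sqLen X * normSq w) (d2 : q.sqLen p = p.sqLen X * normSq (w - 1)) :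
    ∃ Q', IsHatLayout Q' cut ρ ∧ Q' f q - Q' f X = (Q' f p - Q' f X) * w := by
  have s1 := h.shape f q (by simp [hf]) X (by simp [hf])
  have s2 := h.shape f q (by simp [hf]) p (by simp [hf])
  have s3 := h.shape f p (by simp [hf]) X (by simp [hf])
  have hne := h.ne (f := f) (by simp [hf]) (by simp [hf]) hp
  rcases eq_or_eq_conj_of_normSq (w := w) hne (by rw [s1, s3, d1]; ring)
    (by rw [s2, s3, d2]; ring) with h1 | h1
  · exact ⟨Q, h, h1⟩
  · refine ⟨_, h.mirror, ?_⟩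
    have := congrArg (starRingEnd ℂ) h1
    simpa using this

/-- Five faces around a vertex with total angle exceeding a full turn cannot remain attached along
all but one of their edges. -/
theorem fan (h : IsHatLayout Q cut ρ) {X : HatVertex} {P : Fin 5 → HatVertex} {F : Fin 5 → HatFace}
    {w : Fin 5 → ℂ} (hF : ∀ i, (F i).verts = {X, P i, P (i + 1)}) (hFi : Function.Injective F)
    (hP : ∀ i, P i ≠ X) (hPX : ∀ i, 0 < (P i).sqLen X) (hw : ∀ i, 0 < (w i).im)
    (d1 : ∀ i, (P (i + 1)).sqLen X = (P i).sqLen X * normSq (w i))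
    (d2 : ∀ i, (P (i + 1)).sqLen (P i) = (P i).sqLen X * normSq (w i - 1))
    {u : ℂ} (hu : 0 < u.im) (hprod : w 0 * w 1 * w 2 * w 3 * w 4 = u)
    (hwu : ∀ i, (w i).re * u.im < u.re * (w i).im) (i : Fin 5)
    (hcut : ∀ j, j ≠ i → ¬ cut X (P j)) : False := by
  -- The walk starts just after the edge to `P i`, the only one that may be cut, and crosses the
  -- four other edges. It returns to `P i` multiplied by the total turn `u`.
  obtain ⟨Q', h', e0⟩ := h.exists_orientation (hF i) (hPX i) (d1 i) (d2 i)
  have step : ∀ j, j + 1 ≠ i → Q' (F j) (P (j + 1)) - Q' (F j) X =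
      (Q' (F j) (P j) - Q' (F j) X) * w j →
      Q' (F (j + 1)) X = Q' (F j) X ∧ Q' (F (j + 1)) (P (j + 1)) = Q' (F j) (P (j + 1)) ∧
      Q' (F (j + 1)) (P (j + 1 + 1)) - Q' (F (j + 1)) X =
      (Q' (F (j + 1)) (P (j + 1)) - Q' (F (j + 1)) X) * w (j + 1) := by
    intro j hj hq
    refine h'.turn (fun hh => ?_) (hF j) (hF (j + 1)) (hcut _ hj) (hP _).symm (hw j) (hw (j + 1))
      (hPX j) hq (d1 _) (d2 _)
    have := hFi hh
    revert this; clear * -; revert j; decide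
  obtain ⟨a1, b1, e1⟩ := step i (by clear * -; revert i; decide) e0
  obtain ⟨a2, b2, e2⟩ := step (i + 1) (by clear * -; revert i; decide) e1
  obtain ⟨a3, b3, e3⟩ := step (i + 1 + 1) (by clear * -; revert i; decide) e2
  obtain ⟨a4, b4, e4⟩ := step (i + 1 + 1 + 1) (by clear * -; revert i; decide) e3
  have hi5 : i + 1 + 1 + 1 + 1 + 1 = i := by clear * -; revert i; decide
  set f4 := F (i + 1 + 1 + 1 + 1) with hf4
  have hX : Q' f4 X = Q' (F i) X := by rw [a4, a3, a2, a1]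
  have hpr : w i * w (i + 1) * w (i + 1 + 1) * w (i + 1 + 1 + 1) * w (i + 1 + 1 + 1 + 1) = u := by
    rw [← hprod]
    fin_cases i <;> simp <;> ring
  have hend : Q' f4 (P i) - Q' (F i) X = (Q' (F i) (P i) - Q' (F i) X) * u := by
    rw [hi5] at e4
    rw [← hX, e4, b4, hX, ← a1, ← a2, ← a3, e3, b3, a3, e2, b2, a2, e1, b1, a1, e0, ← hpr]
    ring
  have hne4 : F i ≠ f4 := fun hh => by
    have := hFi hh
    revert this; clear * -; revert i; decide
  have hdis := h'.disjoint _ _ hne4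
  have hv4 : f4.verts = {X, P (i + 1 + 1 + 1 + 1), P i} := by rw [hf4, hF, hi5]
  rw [hF i, hv4] at hdis
  simp only [Finset.coe_insert, Finset.coe_singleton, Set.image_insert_eq,
    Set.image_singleton] at hdis
  have hne0 : Q' (F i) (P i) ≠ Q' (F i) X :=
    h'.ne (f := F i) (by simp [hF]) (by simp [hF]) (hPX i)
  -- By `hwu` the argument of `u` is smaller than the angle of the first face at `X`, so the final
  -- position of `P i` lies in the sector of that face.
  refine not_disjoint_of_overturn hne0 hend (hw i) hu (hwu i) (hw (i + 1 + 1 + 1 + 1))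
    (r := Q' f4 (P (i + 1 + 1 + 1 + 1))) ?_ ?_
  · rw [hi5] at e4; rw [← hX, e4]
  · rw [hX] at hdis
    rwa [show Q' (F i) X + (Q' (F i) (P i) - Q' (F i) X) * w i = Q' (F i) (P (i + 1)) by
      rw [← e0]; ring]

/-- At least two edges at every inner vertex are cut. -/
theorem fan_inner (h : IsHatLayout Q cut ρ) (j : Fin 3) (i : Fin 5)
    (hcut : ∀ t, t ≠ i → ¬ cut (x j)
      ((![c (j + 1), c (j + 2), x (j + 1), o, x (j + 2)] : Fin 5 → HatVertex) t)) : False := by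
  -- Each entry of `w` is the ratio of consecutive edge vectors at `x j`. The angles are about 87.2°
  -- (brim), 83.3° (bands) and 76.0° (crowns). Their product `u` has modulus 1 and argument about
  -- 45.7°, which is the excess over a full turn and is smaller than each single angle.
  refine h.fan (X := x j) (P := ![c (j + 1), c (j + 2), x (j + 1), o, x (j + 2)])
    (F := ![brim j, band (j + 2), crown (j + 2), crown (j + 1), band (j + 1)])
    (w := ![⟨41 / 841, 840 / 841⟩, ⟨578 / 21025, 4896 / 21025⟩, ⟨1 / 2, 2⟩, ⟨2 / 17, 8 / 17⟩,
      ⟨1 / 2, 72 / 17⟩]) (u := ⟨297 / 425, 304 / 425⟩) ?_ ?_ ?_ ?_ ?_ ?_ ?_ ?_ ?_ ?_ i hcut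
  · clear * -; revert j; decide
  · clear * -; revert j; decide
  · clear * -; revert j; decide
  · intro i; fin_cases i <;> simp [HatVertex.sqLen]
  · intro i; fin_cases i <;> simp
  · intro i; fin_cases i <;> simp [HatVertex.sqLen, normSq_apply] <;> norm_num
  · intro i; fin_cases i <;> simp [HatVertex.sqLen, normSq_apply] <;> norm_num
  · norm_num
  · apply Complex.ext <;> simp <;> norm_num
  · intro i; fin_cases i <;> simp <;> norm_num

/-- At least one edge at the centre is cut. -/
theorem fan_center (h : IsHatLayout Q cut ρ) (hcut : ∀ j, ¬ cut o (x j)) : False := by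
  have d1 : ∀ j l, (x j).sqLen o = (x l).sqLen o * normSq (⟨15 / 17, 8 / 17⟩ : ℂ) := by
    intro j l; simp [HatVertex.sqLen, normSq_apply]; norm_num
  have d2 : ∀ j l, j ≠ l → (x j).sqLen (x l) =
      (x l).sqLen o * normSq ((⟨15 / 17, 8 / 17⟩ : ℂ) - 1) := by
    intro j l hjl; simp [HatVertex.sqLen, normSq_apply, hjl]; norm_num
  have hx : ∀ j, 0 < (x j).sqLen o := by intro j; norm_num [HatVertex.sqLen]
  obtain ⟨Q', h', e0⟩ := h.exists_orientation (f := crown 2) (X := o) (p := x 0) (q := x 1)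
    (by decide) (hx _) (d1 _ _) (d2 _ _ (by decide))
  obtain ⟨a1, b1, e1⟩ := h'.turn (g := crown 0) (r := x 2) (by decide) (by decide) (by decide)
    (hcut 1) (by decide) (by norm_num) (by norm_num) (hx _) e0 (d1 _ _) (d2 _ _ (by decide))
  obtain ⟨a2, b2, e2⟩ := h'.turn (g := crown 1) (r := x 0) (by decide) (by decide) (by decide)
    (hcut 2) (by decide) (by norm_num) (by norm_num) (hx _) e1 (d1 _ _) (d2 _ _ (by decide))
  obtain ⟨a3, b3⟩ := h'.attached (crown 1) (crown 2) o (x 0) (by decide) (by decide) (by decide)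
    (by decide) (by decide) (hcut 0)
  have hne : Q' (crown 2) (x 0) - Q' (crown 2) o ≠ 0 :=
    sub_ne_zero.2 (h'.ne (by decide) (by decide) (hx _))
  rw [a1, b1] at e1
  rw [b3, a3, b2] at e2
  -- Without a cut at `o`, the three turns would have product 1. Each turns by arctan(8/15), about
  -- 28.1°, so the product has nonzero imaginary part.
  have key : Q' (crown 2) (x 0) - Q' (crown 2) o = (Q' (crown 2) (x 0) - Q' (crown 2) o) *
      ((⟨15 / 17, 8 / 17⟩ : ℂ) * ⟨15 / 17, 8 / 17⟩ * ⟨15 / 17, 8 / 17⟩) := by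
    linear_combination e2 + (⟨15 / 17, 8 / 17⟩ : ℂ) * e1 +
      (⟨15 / 17, 8 / 17⟩ : ℂ) * ⟨15 / 17, 8 / 17⟩ * e0
  have h1 : (1 : ℂ) = (⟨15 / 17, 8 / 17⟩ : ℂ) * ⟨15 / 17, 8 / 17⟩ * ⟨15 / 17, 8 / 17⟩ :=
    mul_left_cancel₀ hne ((mul_one _).trans key)
  have := congrArg Complex.im h1
  norm_num at this

/-- A chain of six faces that cannot remain attached: its ends overlap. -/
theorem chain_overlap (h : IsHatLayout Q cut ρ) {j l n : Fin 3} (hjl : j ≠ l) (hln : l ≠ n)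
    (hjn : j ≠ n) (h1 : ¬ cut (x j) (x n)) (h2 : ¬ cut (x j) (c l)) (h3 : ¬ cut (x j) (c n))
    (h4 : ¬ cut (x l) (c n)) (h5 : ¬ cut (x l) (c j)) : False := by
  -- The chain is crown `l`, band `l`, brim `j`, band `n` around `x j`, and then band `n`, brim `l`,
  -- band `j` around `x l`. Band `n` is listed twice, once for each pivot.
  have v : ∀ j l n : Fin 3, j ≠ l → l ≠ n → j ≠ n →
      (crown l).verts = {x j, o, x n} ∧ (band l).verts = {x j, x n, c l} ∧
      (brim j).verts = {x j, c l, c n} ∧ (band n).verts = {x j, c n, x l} ∧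
      (band n).verts = {x l, x j, c n} ∧ (brim l).verts = {x l, c n, c j} ∧
      (band j).verts = {x l, c j, x n} := by decide
  obtain ⟨v1, v2, v3, v4, v4', v5, v6⟩ := v j l n hjl hln hjn
  obtain ⟨Q', h', e0⟩ := h.exists_orientation (w := ⟨2 / 17, 8 / 17⟩) v1
    (by simp [HatVertex.sqLen])
    (by simp [HatVertex.sqLen, normSq_apply, hjn.symm]; norm_num)
    (by simp [HatVertex.sqLen, normSq_apply]; norm_num)
  obtain ⟨a1, b1, e1⟩ := h'.turn (w' := ⟨1 / 2, 72 / 17⟩) (by simp) v1 v2 h1 (by simp [hjn])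
    (by simp) (by simp) (by simp [HatVertex.sqLen]) e0
    (by simp [HatVertex.sqLen, normSq_apply, hjl.symm, hjn.symm]; norm_num)
    (by simp [HatVertex.sqLen, normSq_apply, hjn.symm, hln]; norm_num)
  obtain ⟨a2, b2, e2⟩ := h'.turn (w' := ⟨41 / 841, 840 / 841⟩) (by simp) v2 v3 h2 (by simp)
    (by simp) (by simp) (by simp [HatVertex.sqLen, hjn.symm]) e1
    (by simp [HatVertex.sqLen, normSq_apply, hjl.symm, hjn.symm]; norm_num)
    (by simp [HatVertex.sqLen, normSq_apply, hjl.symm, hln.symm]; norm_num)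
  obtain ⟨a3, b3, e3⟩ := h'.turn (w' := ⟨578 / 21025, 4896 / 21025⟩) (by simp) v3 v4 h3 (by simp)
    (by simp) (by simp) (by simp [HatVertex.sqLen, hjl.symm]) e2
    (by simp [HatVertex.sqLen, normSq_apply, hjl.symm, hjn.symm]; norm_num)
    (by simp [HatVertex.sqLen, normSq_apply, hjn.symm, hln]; norm_num)
  -- This identity changes the pivot: the shape of band `n`, known from `x j`, is rewritten as seen
  -- from `x l`.
  have hw : (⟨1 / 2, 72 / 17⟩ : ℂ) * ⟨578 / 21025, 4896 / 21025⟩ =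
      (⟨578 / 21025, 4896 / 21025⟩ : ℂ) - 1 := by
    apply Complex.ext <;> simp <;> norm_num
  have e3' : Q' (band n) (c n) - Q' (band n) (x l) =
      (Q' (band n) (x j) - Q' (band n) (x l)) * ⟨1 / 2, 72 / 17⟩ := by
    linear_combination ((⟨1 / 2, 72 / 17⟩ : ℂ) - 1) * e3 +
      (Q' (band n) (c n) - Q' (band n) (x j)) * hw
  obtain ⟨a4, b4, e4⟩ := h'.turn (w' := ⟨41 / 841, 840 / 841⟩) (by simp) v4' v5 h4
    (by simp) (by simp) (by simp) (by simp [HatVertex.sqLen, hjl]) e3'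
    (by simp [HatVertex.sqLen, normSq_apply, hjl, hln.symm]; norm_num)
    (by simp [HatVertex.sqLen, normSq_apply, hjn, hln.symm]; norm_num)
  obtain ⟨a5, b5, e5⟩ := h'.turn (w' := ⟨578 / 21025, 4896 / 21025⟩) (by simp) v5 v6 h5 (by simp)
    (by simp) (by simp) (by simp [HatVertex.sqLen, hln.symm]) e4
    (by simp [HatVertex.sqLen, normSq_apply, hjl, hln.symm]; norm_num)
    (by simp [HatVertex.sqLen, normSq_apply, hjl, hjn.symm]; norm_num)
  rw [a1, b1] at e1
  rw [a2, a1, b2] at e2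
  rw [a3, a2, a1, b3] at e3 e3'
  rw [a4, b4, b3] at e4
  rw [a5, a4, b5] at e5
  have hdis := h'.disjoint (crown l) (band j) (by simp)
  rw [v1, v6] at hdis
  simp only [Finset.coe_insert, Finset.coe_singleton, Set.image_insert_eq,
    Set.image_singleton] at hdis
  rw [a5, a4, b5] at hdis
  have hOX : Q' (crown l) o ≠ Q' (crown l) (x j) :=
    h'.ne (by simp [v1]) (by simp [v1]) (by simp [HatVertex.sqLen])
  have hYC : Q' (brim l) (c j) ≠ Q' (band n) (x l) := by
    rw [← a4]; exact h'.ne (by simp [v5]) (by simp [v5]) (by simp [HatVertex.sqLen, hjl])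
  generalize Q' (crown l) (x j) = X at *
  generalize Q' (crown l) o = O at *
  generalize Q' (crown l) (x n) = Z at *
  generalize Q' (band n) (x l) = Y at *
  generalize Q' (band j) (x n) = Z' at *
  generalize Q' (brim l) (c j) = A at *
  -- Crossing a band, a brim and a band at one inner vertex is a rotation by about 253.7° with ratio
  -- of lengths 1. It occurs once at `x j` and once at `x l`.
  have hκ : (⟨1 / 2, 72 / 17⟩ : ℂ) * ⟨41 / 841, 840 / 841⟩ * ⟨578 / 21025, 4896 / 21025⟩ =
      ⟨-7 / 25, -24 / 25⟩ := by
    apply Complex.ext <;> simp <;> norm_num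
  have hY : Y - X = (Z - X) * ⟨-7 / 25, -24 / 25⟩ := by
    linear_combination e3 + (⟨578 / 21025, 4896 / 21025⟩ : ℂ) * e2 +
      (⟨41 / 841, 840 / 841⟩ : ℂ) * ⟨578 / 21025, 4896 / 21025⟩ * e1 + (Z - X) * hκ
  have hZ' : Z' - Y = (X - Y) * ⟨-7 / 25, -24 / 25⟩ := by
    linear_combination e5 + (⟨578 / 21025, 4896 / 21025⟩ : ℂ) * e4 +
      (⟨41 / 841, 840 / 841⟩ : ℂ) * ⟨578 / 21025, 4896 / 21025⟩ * e3' + (X - Y) * hκ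
  -- In coordinates with X = 0 and Z = 1 the crown has apex O = 1/2 - 2i, and the side from `Y` to
  -- `Z'` of the last band runs into it. The witness is the point nine tenths of the way from `Y` to
  -- `Z'`, about 0.479 - 1.444i, written relative to `O`.
  have hm := mem_interior_triangle (X := X) (p := O) (w := ⟨2 / 17, 8 / 17⟩)
    (ζ := ⟨1250848 / 1700000, 94336 / 1700000⟩) hOX (by norm_num) (by norm_num) (by norm_num)
    (by norm_num)
  rw [← e0, add_sub_cancel] at hm
  have hζ : (⟨2 / 17, 8 / 17⟩ : ℂ) * (⟨-7 / 25, -24 / 25⟩ - 9 / 10 *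
      (⟨-7 / 25, -24 / 25⟩ * ⟨-7 / 25, -24 / 25⟩)) = ⟨1250848 / 1700000, 94336 / 1700000⟩ := by
    apply Complex.ext <;> simp <;> norm_num
  have hmem : X + (O - X) * ⟨1250848 / 1700000, 94336 / 1700000⟩ =
      (1 / 10 : ℝ) • Y + (9 / 10 : ℝ) • Z' := by
    simp only [Complex.real_smul]
    push_cast
    linear_combination -(O - X) * hζ - ((⟨-7 / 25, -24 / 25⟩ : ℂ) - 9 / 10 *
      (⟨-7 / 25, -24 / 25⟩ * ⟨-7 / 25, -24 / 25⟩)) * e0 - hY - 9 / 10 * hZ' +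
      9 / 10 * (⟨-7 / 25, -24 / 25⟩ : ℂ) * hY
  refine not_disjoint_interior_of_mem (convex_convexHull ℝ _) ?_ hm ?_ hdis
  · have e : Z' = Y + (A - Y) * ⟨578 / 21025, 4896 / 21025⟩ := by linear_combination e5
    rw [e]
    exact interior_triangle_nonempty hYC (by norm_num)
  · rw [hmem]
    exact (convex_convexHull ℝ _) (subset_convexHull _ _ (by simp))
      (subset_convexHull _ _ (by simp)) (by norm_num) (by norm_num) (by norm_num)

end IsHatLayout

/-- The interior edges of a hat, as (cut?, face, face), for given sets of cut edges. The edges are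
`x j, c (j + 1)`, then `x j, c (j + 2)`, then those opposite to `x j` in the ring, then `o, x j`. -/
def hatDualEdges (s0 s1 s2 t0 t1 t2 r0 r1 r2 d0 d1 d2 : Bool) : List (Bool × ℕ × ℕ) :=
  [(s0, 0, 4), (s1, 1, 5), (s2, 2, 3), (t0, 0, 5), (t1, 1, 3), (t2, 2, 4),
    (r0, 3, 6), (r1, 4, 7), (r2, 5, 8), (d0, 7, 8), (d1, 8, 6), (d2, 6, 7)]

/-- One round of spreading a set of faces (given by a bit mask) along the uncut edges. -/
def spreadMask (L : List (Bool × ℕ × ℕ)) (m : ℕ) : ℕ :=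
  L.foldl (fun m e => if !e.1 && (m.testBit e.2.1 || m.testBit e.2.2)
    then m ||| (1 <<< e.2.1) ||| (1 <<< e.2.2) else m) m

/-- The bit mask of the component of the first face. -/
def componentMask (L : List (Bool × ℕ × ℕ)) : ℕ :=
  spreadMask L (spreadMask L (spreadMask L (spreadMask L (spreadMask L (spreadMask L 1)))))

/-- The set of faces given by a bit mask is a union of components that contains the first face but
not every face. -/
def isSeparation (L : List (Bool × ℕ × ℕ)) (m : ℕ) : Bool :=
  L.all (fun e => e.1 || (m.testBit e.2.1 == m.testBit e.2.2)) && m.testBit 0 &&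
    !(List.range 9).all (fun i => m.testBit i)

/-- At least two of five. -/
def twoOfFive (a b c d e : Bool) : Bool :=
  (b || c || d || e) && (a || c || d || e) && (a || b || d || e) && (a || b || c || e) &&
    (a || b || c || d)

/-- The twelve Booleans say which interior edges are cut; the hypotheses are the three vertex
conditions, the centre condition and the six chain conditions. Since `isSeparation` tests that the
computed mask is closed under uncut edges, nothing has to be proved about how many rounds of
spreading suffice. -/
theorem isSeparation_componentMask : ∀ s0 s1 s2 t0 t1 t2 r0 r1 r2 d0 d1 d2 : Bool,
    (!(twoOfFive s0 t0 r2 d0 r1 && twoOfFive s1 t1 r0 d1 r2 && twoOfFive s2 t2 r1 d2 r0 &&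
      (d0 || d1 || d2) &&
      (s0 || t0 || s1 || t1 || r1) && (t1 || s1 || t0 || s0 || r0) &&
      (s1 || t1 || s2 || t2 || r2) && (t2 || s2 || t1 || s1 || r1) &&
      (s2 || t2 || s0 || t0 || r0) && (t0 || s0 || t2 || s2 || r2)) ||
      isSeparation (hatDualEdges s0 s1 s2 t0 t1 t2 r0 r1 r2 d0 d1 d2)
        (componentMask (hatDualEdges s0 s1 s2 t0 t1 t2 r0 r1 r2 d0 d1 d2))) = true := by
  decide +kernel

/-- The end points of the interior edges of a hat. -/
def hatEdgeVerts : Fin 12 → HatVertex × HatVertex :=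
  ![(x 0, c 1), (x 1, c 2), (x 2, c 0), (x 0, c 2), (x 1, c 0), (x 2, c 1),
    (x 1, x 2), (x 2, x 0), (x 0, x 1), (x 0, o), (x 1, o), (x 2, o)]

/-- The faces at the interior edges of a hat. -/
def hatEdgeFaces : Fin 12 → HatFace × HatFace :=
  ![(brim 0, band 1), (brim 1, band 2), (brim 2, band 0), (brim 0, band 2), (brim 1, band 0),
    (brim 2, band 1), (band 0, crown 0), (band 1, crown 1), (band 2, crown 2),
    (crown 1, crown 2), (crown 2, crown 0), (crown 0, crown 1)]

theorem HatFace.shared_edge : ∀ f g : HatFace, f ≠ g → ∀ u ∈ f.verts ∩ g.verts,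
    ∀ v ∈ f.verts ∩ g.verts, u ≠ v →
    ∃ e : Fin 12, (hatEdgeFaces e = (f, g) ∨ hatEdgeFaces e = (g, f)) ∧
      (hatEdgeVerts e = (u, v) ∨ hatEdgeVerts e = (v, u)) := by
  decide +kernel

/-- The position of a face in the bit masks. -/
def HatFace.bit : HatFace → ℕ
  | brim j => j
  | band j => 3 + j
  | crown j => 6 + j

/-- The faces of a hat cannot all remain attached. -/
theorem IsHatLayout.exists_separation {Q : HatFace → HatVertex → ℂ}
    {cut : HatVertex → HatVertex → Prop} {ρ : ℝ} (h : IsHatLayout Q cut ρ)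
    (symm : ∀ u v, cut u v → cut v u) :
    ∃ A : HatFace → Prop, (∃ f, A f) ∧ (∃ f, ¬ A f) ∧
      ∀ f g u v, u ≠ v → u ∈ f.verts → v ∈ f.verts → u ∈ g.verts → v ∈ g.verts → ¬ cut u v →
        A f → A g := by
  classical
  have hsy : ∀ u v, cut u v ↔ cut v u := fun u v => ⟨symm u v, symm v u⟩
  let K : HatVertex → HatVertex → Bool := fun u v => decide (cut u v)
  have hK : ∀ u v, K u v = K v u := fun u v => by simp only [K]; rw [decide_eq_decide]; exact hsy u v
  have hKf : ∀ u v, K u v = false → ¬ cut u v := fun u v huv => by simpa [K] using huv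
  have two : ∀ j, twoOfFive (K (x j) (c (j + 1))) (K (x j) (c (j + 2))) (K (x j) (x (j + 1)))
      (K (x j) o) (K (x j) (x (j + 2))) = true := by
    intro j
    by_contra hcon
    have : ∃ i : Fin 5, ∀ t, t ≠ i →
        ![K (x j) (c (j + 1)), K (x j) (c (j + 2)), K (x j) (x (j + 1)), K (x j) o,
          K (x j) (x (j + 2))] t = false := by
      revert hcon
      generalize K (x j) (c (j + 1)) = k1
      generalize K (x j) (c (j + 2)) = k2
      generalize K (x j) (x (j + 1)) = k3
      generalize K (x j) o = k4
      generalize K (x j) (x (j + 2)) = k5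
      revert k1 k2 k3 k4 k5
      decide +kernel
    obtain ⟨i, hi⟩ := this
    refine h.fan_inner j i fun t ht => hKf _ _ ?_
    rw [← hi t ht]
    fin_cases t <;> rfl
  have center : (K (x 0) o || K (x 1) o || K (x 2) o) = true := by
    by_contra hcon
    simp only [Bool.not_eq_true, Bool.or_eq_false_iff] at hcon
    refine h.fan_center fun j => hKf _ _ ?_
    rw [hK]
    fin_cases j
    exacts [hcon.1.1, hcon.1.2, hcon.2]
  have chain : ∀ j l n : Fin 3, j ≠ l → l ≠ n → j ≠ n →
      (K (x j) (c l) || K (x j) (c n) || K (x l) (c n) || K (x l) (c j) || K (x j) (x n)) = true := by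
    intro j l n hjl hln hjn
    by_contra hcon
    simp only [Bool.not_eq_true, Bool.or_eq_false_iff] at hcon
    exact h.chain_overlap hjl hln hjn (hKf _ _ hcon.2) (hKf _ _ hcon.1.1.1.1)
      (hKf _ _ hcon.1.1.1.2) (hKf _ _ hcon.1.1.2) (hKf _ _ hcon.1.2)
  have main := isSeparation_componentMask (K (x 0) (c 1)) (K (x 1) (c 2)) (K (x 2) (c 0))
    (K (x 0) (c 2)) (K (x 1) (c 0)) (K (x 2) (c 1)) (K (x 1) (x 2)) (K (x 2) (x 0))
    (K (x 0) (x 1)) (K (x 0) o) (K (x 1) o) (K (x 2) o)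
  set L := hatDualEdges (K (x 0) (c 1)) (K (x 1) (c 2)) (K (x 2) (c 0))
    (K (x 0) (c 2)) (K (x 1) (c 0)) (K (x 2) (c 1)) (K (x 1) (x 2)) (K (x 2) (x 0))
    (K (x 0) (x 1)) (K (x 0) o) (K (x 1) o) (K (x 2) o) with hL
  set m := componentMask L
  have hsep : isSeparation L m = true := by
    have t0 := two 0
    have t1 := two 1
    have t2 := two 2
    have c1 := chain 0 1 2 (by decide) (by decide) (by decide)
    have c2 := chain 1 0 2 (by decide) (by decide) (by decide)
    have c3 := chain 1 2 0 (by decide) (by decide) (by decide)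
    have c4 := chain 2 1 0 (by decide) (by decide) (by decide)
    have c5 := chain 2 0 1 (by decide) (by decide) (by decide)
    have c6 := chain 0 2 1 (by decide) (by decide) (by decide)
    have f1 : (1 : Fin 3) + 1 = 2 := rfl
    have f2 : (1 : Fin 3) + 2 = 0 := rfl
    have f3 : (2 : Fin 3) + 1 = 0 := rfl
    have f4 : (2 : Fin 3) + 2 = 1 := rfl
    simp only [zero_add, f1, f2, f3, f4] at t0 t1 t2
    rw [hK (x 0) (x 2)] at t0 c1
    rw [hK (x 1) (x 0)] at t1 c3
    rw [hK (x 2) (x 1)] at t2 c5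
    rw [t0, t1, t2, center, c1, c2, c3, c4, c5, c6] at main
    simpa using main
  simp only [isSeparation, Bool.and_eq_true] at hsep
  obtain ⟨⟨hall, h0⟩, hnot⟩ := hsep
  refine ⟨fun f => m.testBit f.bit = true, ⟨brim 0, h0⟩, ?_, ?_⟩
  · by_contra hcon
    push Not at hcon
    have : (List.range 9).all (fun i => m.testBit i) = true := by
      rw [List.all_eq_true]
      intro i hi
      rw [List.mem_range] at hi
      have : ∀ i < 9, ∃ f : HatFace, f.bit = i := by decide
      obtain ⟨f, rfl⟩ := this i hi
      exact hcon f
    rw [this] at hnot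
    exact Bool.noConfusion hnot
  · have edge : ∀ e : Fin 12, K (hatEdgeVerts e).1 (hatEdgeVerts e).2 = false →
        m.testBit (hatEdgeFaces e).1.bit = m.testBit (hatEdgeFaces e).2.bit := by
      intro e he
      rw [List.all_eq_true] at hall
      have := hall (K (hatEdgeVerts e).1 (hatEdgeVerts e).2, (hatEdgeFaces e).1.bit,
        (hatEdgeFaces e).2.bit) (by
          rw [hL]
          fin_cases e <;> simp [hatDualEdges, hatEdgeVerts, hatEdgeFaces, HatFace.bit])
      rw [he] at this
      simpa using this
    intro f g u v huv hu hv hu' hv' hc hf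
    rcases eq_or_ne f g with rfl | hfg
    · exact hf
    obtain ⟨e, he, he'⟩ := HatFace.shared_edge f g hfg u (Finset.mem_inter.2 ⟨hu, hu'⟩) v
      (Finset.mem_inter.2 ⟨hv, hv'⟩) huv
    have hKe : K (hatEdgeVerts e).1 (hatEdgeVerts e).2 = false := by
      rcases he' with he' | he' <;> rw [he']
      · simpa [K] using hc
      · simpa [K] using fun h' => hc (symm _ _ h')
    have := edge e hKe
    rcases he with he | he <;> rw [he] at this
    · rw [← this]; exact hf
    · rw [this]; exact hf

/-! ### The flat triangulation underlying a hat -/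

/-- The barycentric coordinates of the projection of a vertex of a hat to the base. -/
noncomputable def HatVertex.bary : HatVertex → Fin 3 → ℝ
  | c j, l => if l = j then 1 else 0
  | x j, l => if l = j then 11 / 50 else 39 / 100
  | o, _ => 1 / 3

theorem HatVertex.sum_univ {M : Type*} [AddCommMonoid M] (F : HatVertex → M) :
    ∑ v, F v = F (c 0) + F (c 1) + F (c 2) + F (x 0) + F (x 1) + F (x 2) + F o := by
  have : (Finset.univ : Finset HatVertex) = {c 0, c 1, c 2, x 0, x 1, x 2, o} := by decide
  rw [this]
  simp [Finset.sum_insert, add_assoc]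

theorem HatVertex.sum_bary (v : HatVertex) : ∑ l, v.bary l = 1 := by
  rcases v with j | j | _
  · simp [HatVertex.bary]
  · fin_cases j <;> simp [HatVertex.bary, Fin.sum_univ_three] <;> norm_num
  · simp [HatVertex.bary]

theorem HatVertex.bary_nonneg (v : HatVertex) (l : Fin 3) : 0 ≤ v.bary l := by
  rcases v with j | j | _
  · simp only [HatVertex.bary]; split_ifs <;> norm_num
  · simp only [HatVertex.bary]; split_ifs <;> norm_num
  · simp [HatVertex.bary]

/-- Weights of a convex combination of the vertices of a face. -/
structure IsFaceWeight (f : HatFace) (w : HatVertex → ℝ) : Prop where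
  nonneg : ∀ v, 0 ≤ w v
  sum : ∑ v, w v = 1
  support : ∀ v, v ∉ f.verts → w v = 0

/-- The barycentric coordinates of the projection of a convex combination of vertices of a hat. -/
noncomputable def baryOf (w : HatVertex → ℝ) (l : Fin 3) : ℝ := ∑ v, w v * v.bary l

theorem baryOf_eq (w : HatVertex → ℝ) (l : Fin 3) : baryOf w l = w (c l) +
    39 / 100 * (w (x 0) + w (x 1) + w (x 2)) - 17 / 100 * w (x l) + w o / 3 := by
  rw [baryOf, HatVertex.sum_univ]
  fin_cases l <;> simp [HatVertex.bary] <;> ring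

theorem baryOf_nonneg {f : HatFace} {w : HatVertex → ℝ} (hw : IsFaceWeight f w) (l : Fin 3) :
    0 ≤ baryOf w l :=
  Finset.sum_nonneg fun v _ => mul_nonneg (hw.nonneg v) (v.bary_nonneg l)

theorem sum_baryOf {f : HatFace} {w : HatVertex → ℝ} (hw : IsFaceWeight f w) :
    ∑ l, baryOf w l = 1 := by
  simp only [baryOf]
  rw [Finset.sum_comm]
  simp only [← Finset.mul_sum, HatVertex.sum_bary, mul_one]
  exact hw.sum

/-- The inner vertices and the centre project into the open base triangle. Hence a point using one
of them cannot project to the boundary of its small triangle, where other small triangles could meet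
it. -/
theorem baryOf_pos {f : HatFace} {w : HatVertex → ℝ} (hw : IsFaceWeight f w)
    (h : 0 < w o ∨ ∃ j, 0 < w (x j)) (l : Fin 3) : 0 < baryOf w l := by
  rcases h with h | ⟨j, h⟩
  · refine Finset.sum_pos' (fun v _ => mul_nonneg (hw.nonneg v) (v.bary_nonneg l))
      ⟨o, Finset.mem_univ _, mul_pos h ?_⟩
    simp [HatVertex.bary]
  · refine Finset.sum_pos' (fun v _ => mul_nonneg (hw.nonneg v) (v.bary_nonneg l))
      ⟨x j, Finset.mem_univ _, mul_pos h ?_⟩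
    simp only [HatVertex.bary]; split_ifs <;> norm_num

/-- The piecewise linear nodal function of the centre. -/
noncomputable def nodalO (a : Fin 3 → ℝ) : ℝ :=
  max 0 ((39 / 100 - max (a 0) (max (a 1) (a 2))) * (300 / 17))

/-- The piecewise linear nodal function of the inner vertex `x j`. -/
noncomputable def nodalX (a : Fin 3 → ℝ) (j : Fin 3) : ℝ :=
  max 0 (min (min (a j * (50 / 11)) ((max (a (j + 1)) (a (j + 2)) - a j) * (100 / 17)))
    (min ((39 / 100 * a (j + 1) - 11 / 50 * a j) * (10000 / 1037))
      ((39 / 100 * a (j + 2) - 11 / 50 * a j) * (10000 / 1037))))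

/-- For each face, the vertices of a hat that do not belong to it, listed relative to an index. -/
theorem HatFace.cases_rel (f : HatFace) (j : Fin 3) :
    f = brim j ∨ f = brim (j + 1) ∨ f = brim (j + 2) ∨ f = band j ∨ f = band (j + 1) ∨
      f = band (j + 2) ∨ f = crown j ∨ f = crown (j + 1) ∨ f = crown (j + 2) := by
  revert f j; decide

/-- `nodalX` is the tent function of `x j` on the flat triangulation. Its linear pieces belong to
the brim, the two crowns (combined by a `max`, because the boundary of the star is not convex there)
and the two bands at `x j`. -/
theorem IsFaceWeight.eq_nodalX {f : HatFace} {w : HatVertex → ℝ} (hw : IsFaceWeight f w)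
    (j : Fin 3) : w (x j) = nodalX (baryOf w) j := by
  have hj : ∀ F : Fin 3 → ℝ, F 0 + F 1 + F 2 = F j + F (j + 1) + F (j + 2) := by
    intro F; fin_cases j <;> simp <;> ring
  have hxs := hj fun t => w (x t)
  have hcs := hj fun t => w (c t)
  have hsum := hw.sum
  rw [HatVertex.sum_univ] at hsum
  have hsum' : w (c j) + w (c (j + 1)) + w (c (j + 2)) + (w (x j) + w (x (j + 1)) + w (x (j + 2)))
    + w o = 1 := by linarith
  simp only [nodalX, baryOf_eq, hxs]
  have n0 := hw.nonneg (c j)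
  have n1 := hw.nonneg (c (j + 1))
  have n2 := hw.nonneg (c (j + 2))
  have n3 := hw.nonneg (x j)
  have n4 := hw.nonneg (x (j + 1))
  have n5 := hw.nonneg (x (j + 2))
  have n6 := hw.nonneg o
  have z0 := hw.support (c j)
  have z1 := hw.support (c (j + 1))
  have z2 := hw.support (c (j + 2))
  have z3 := hw.support (x j)
  have z4 := hw.support (x (j + 1))
  have z5 := hw.support (x (j + 2))
  have z6 := hw.support o
  clear hxs hcs hsum hj
  have q1 : j + 1 + 1 = j + 2 := by clear * -; revert j; decide
  have q2 : j + 1 + 2 = j := by clear * -; revert j; decide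
  have q3 : j + 2 + 1 = j := by clear * -; revert j; decide
  have q4 : j + 2 + 2 = j + 1 := by clear * -; revert j; decide
  have d1 : j ≠ j + 1 := by clear * -; revert j; decide
  have d2 : j ≠ j + 2 := by clear * -; revert j; decide
  have d3 : j + 1 ≠ j + 2 := by clear * -; revert j; decide
  -- On a face containing `x j`, the term of `nodalX` belonging to that face equals the weight and
  -- the others are at least as large. On any other face, some term is nonpositive.
  obtain rfl | rfl | rfl | rfl | rfl | rfl | rfl | rfl | rfl := f.cases_rel j <;>
    simp only [HatFace.verts, q1, q2, q3, q4, Finset.mem_insert, Finset.mem_singleton, c.injEq,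
      x.injEq, reduceCtorEq, d1, d2, d3, d1.symm, d2.symm, d3.symm, or_self, not_false_eq_true,
      or_false, or_true, not_true_eq_false, true_implies, false_implies]
      at z0 z1 z2 z3 z4 z5 z6 <;>
    clear hw q1 q2 q3 q4 d1 d2 d3 <;>
    generalize w (c j) = cj at * <;> generalize w (c (j + 1)) = cl at * <;>
    generalize w (c (j + 2)) = cn at * <;> generalize w (x j) = xj at * <;>
    generalize w (x (j + 1)) = xl at * <;> generalize w (x (j + 2)) = xn at * <;>
    generalize w o = wo at * <;> subst_vars <;>
    (refine le_antisymm ?_ (max_le n3 ?_)) <;>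
    first
    | exact le_max_of_le_left le_rfl
    | (refine le_max_of_le_right (le_min (le_min ?_ ?_) (le_min ?_ ?_)) <;>
        first
        | linarith
        | (rw [← div_le_iff₀ (by norm_num), le_sub_iff_add_le, le_max_iff]
           first | (left; linarith) | (right; linarith)))
    | (refine (min_le_left _ _).trans ((min_le_left _ _).trans ?_); linarith)
    | (refine (min_le_right _ _).trans ((min_le_left _ _).trans ?_); linarith)
    | (refine (min_le_right _ _).trans ((min_le_right _ _).trans ?_); linarith)
    | (refine (min_le_left _ _).trans ((min_le_right _ _).trans ?_)
       rw [← le_div_iff₀ (by norm_num), sub_le_iff_le_add]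
       refine max_le ?_ ?_ <;> linarith)

/-- The crown projects to the triangle where no coordinate exceeds 39/100. The tent function of `o`
vanishes on its boundary and is 1 at the centroid, whence the slope 300/17 = 1 / (39/100 - 1/3). -/
theorem IsFaceWeight.eq_nodalO {f : HatFace} {w : HatVertex → ℝ} (hw : IsFaceWeight f w) :
    w o = nodalO (baryOf w) := by
  have hsum := hw.sum
  rw [HatVertex.sum_univ] at hsum
  have n0 := hw.nonneg (c 0)
  have n1 := hw.nonneg (c 1)
  have n2 := hw.nonneg (c 2)
  have n3 := hw.nonneg (x 0)
  have n4 := hw.nonneg (x 1)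
  have n5 := hw.nonneg (x 2)
  have n6 := hw.nonneg o
  have z0 := hw.support (c 0)
  have z1 := hw.support (c 1)
  have z2 := hw.support (c 2)
  have z3 := hw.support (x 0)
  have z4 := hw.support (x 1)
  have z5 := hw.support (x 2)
  have z6 := hw.support o
  simp only [nodalO, baryOf_eq]
  rcases f with j | j | j <;> fin_cases j <;>
    simp [HatFace.verts] at z0 z1 z2 z3 z4 z5 z6 <;>
    (refine le_antisymm ?_ (max_le n6 ?_)) <;>
    first
    | (rw [z6]; exact le_max_left _ _)
    | (refine le_max_of_le_right ?_
       rw [← div_le_iff₀ (by norm_num), le_sub_comm]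
       refine max_le ?_ (max_le ?_ ?_) <;> linarith)
    | (rw [← le_div_iff₀ (by norm_num), sub_le_comm, le_max_iff, le_max_iff]
       by_contra hcon
       simp only [not_or, not_le] at hcon
       linarith [hcon.1, hcon.2.1, hcon.2.2])

/-- The weights are determined by the projected point. -/
theorem IsFaceWeight.ext_of_baryOf {f f' : HatFace} {w w' : HatVertex → ℝ} (hw : IsFaceWeight f w)
    (hw' : IsFaceWeight f' w') (h : baryOf w = baryOf w') : w = w' := by
  have eo : w o = w' o := by rw [hw.eq_nodalO, hw'.eq_nodalO, h]
  have ex : ∀ j, w (x j) = w' (x j) := fun j => by rw [hw.eq_nodalX, hw'.eq_nodalX, h]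
  funext v
  rcases v with j | j | _
  · have := congrFun h j
    rw [baryOf_eq, baryOf_eq, ex 0, ex 1, ex 2, ex j, eo] at this
    linarith
  · exact ex j
  · exact eo

theorem isFaceWeight_mk {f : HatFace} {w : HatVertex → ℝ} (hw : ∀ v, 0 ≤ w v)
    (hs : ∀ v, v ∉ f.verts → w v = 0) {a : Fin 3 → ℝ} (ha : ∑ l, a l = 1) (h : baryOf w = a) :
    IsFaceWeight f w ∧ baryOf w = a := by
  refine ⟨⟨hw, ?_, hs⟩, h⟩
  rw [← ha, ← h]
  simp only [baryOf]
  rw [Finset.sum_comm]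
  simp only [← Finset.mul_sum, HatVertex.sum_bary, mul_one]

/-- Every point of the base is the projection of a point of the hat. -/
theorem exists_isFaceWeight {a : Fin 3 → ℝ} (ha : ∀ l, 0 ≤ a l) (hs : ∑ l, a l = 1) :
    ∃ f w, IsFaceWeight f w ∧ baryOf w = a := by
  have hsum := hs
  rw [Fin.sum_univ_three] at hsum
  have idx : ∀ j l : Fin 3, l = j ∨ l = j + 1 ∨ l = j + 2 := by decide
  have brimCase : ∀ j : Fin 3, a j * (39 / 22) ≤ a (j + 1) → a j * (39 / 22) ≤ a (j + 2) →
      ∃ f w, IsFaceWeight f w ∧ baryOf w = a := by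
    intro j h1 h2
    refine ⟨brim j, fun v => if v = c (j + 1) then a (j + 1) - a j * (39 / 22) else
      if v = c (j + 2) then a (j + 2) - a j * (39 / 22) else
      if v = x j then a j * (100 / 22) else 0, isFaceWeight_mk ?_ ?_ hs ?_⟩
    · intro v
      have := ha j
      split_ifs <;> linarith
    · intro v hv
      simp only [HatFace.verts, Finset.mem_insert, Finset.mem_singleton, not_or] at hv
      simp [hv]
    · funext l
      rw [baryOf_eq]
      fin_cases j <;> fin_cases l <;> simp <;> ring
  have bandCase : ∀ j : Fin 3, 39 / 100 ≤ a j → 22 * a (j + 2) ≤ 39 * a (j + 1) →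
      22 * a (j + 1) ≤ 39 * a (j + 2) → ∃ f w, IsFaceWeight f w ∧ baryOf w = a := by
    intro j h0 h1 h2
    have hj : a j + a (j + 1) + a (j + 2) = 1 := by
      rw [← hsum]; fin_cases j <;> simp <;> ring
    refine ⟨band j, fun v => if v = c j then 1 - (a (j + 1) + a (j + 2)) * (100 / 61) else
      if v = x (j + 1) then (39 * a (j + 2) - 22 * a (j + 1)) * (100 / 1037) else
      if v = x (j + 2) then (39 * a (j + 1) - 22 * a (j + 2)) * (100 / 1037) else 0,
      isFaceWeight_mk ?_ ?_ hs ?_⟩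
    · intro v
      split_ifs <;> linarith
    · intro v hv
      simp only [HatFace.verts, Finset.mem_insert, Finset.mem_singleton, not_or] at hv
      simp [hv]
    · funext l
      rw [baryOf_eq]
      fin_cases j <;> fin_cases l <;> simp at hj ⊢ <;> linarith
  have crownCase : ∀ j : Fin 3, a (j + 1) ≤ a j → a (j + 2) ≤ a j → a j ≤ 39 / 100 →
      ∃ f w, IsFaceWeight f w ∧ baryOf w = a := by
    intro j h0 h1 h2
    have hj : a j + a (j + 1) + a (j + 2) = 1 := by
      rw [← hsum]; fin_cases j <;> simp <;> ring
    refine ⟨crown j, fun v => if v = o then (39 / 100 - a j) * (300 / 17) else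
      if v = x (j + 1) then (a j - a (j + 1)) * (100 / 17) else
      if v = x (j + 2) then (a j - a (j + 2)) * (100 / 17) else 0,
      isFaceWeight_mk ?_ ?_ hs ?_⟩
    · intro v
      split_ifs <;> linarith
    · intro v hv
      simp only [HatFace.verts, Finset.mem_insert, Finset.mem_singleton, not_or] at hv
      simp [hv]
    · funext l
      rw [baryOf_eq]
      fin_cases j <;> fin_cases l <;> simp at hj ⊢ <;> linarith
  -- Let `a j` be the largest coordinate. If it is at most 39/100 the point is under the crown.
  -- Otherwise the rays from the corner `c j` to the two nearby inner vertices, where the other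
  -- coordinates have ratio 22 : 39 or 39 : 22, separate band `j` from the two adjacent brims.
  obtain ⟨j, hj⟩ : ∃ j : Fin 3, a (j + 1) ≤ a j ∧ a (j + 2) ≤ a j := by
    obtain ⟨j, -, hj⟩ := Finset.exists_max_image Finset.univ a ⟨0, Finset.mem_univ _⟩
    exact ⟨j, hj _ (Finset.mem_univ _), hj _ (Finset.mem_univ _)⟩
  have hj1 : a j + a (j + 1) + a (j + 2) = 1 := by
    rw [← hsum]; fin_cases j <;> simp <;> ring
  have q1 : j + 1 + 1 = j + 2 := by clear * -; revert j; decide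
  have q2 : j + 1 + 2 = j := by clear * -; revert j; decide
  have q3 : j + 2 + 1 = j := by clear * -; revert j; decide
  have q4 : j + 2 + 2 = j + 1 := by clear * -; revert j; decide
  rcases le_total (a j) (39 / 100) with h | h
  · exact crownCase j hj.1 hj.2 h
  rcases le_total (22 * a (j + 2)) (39 * a (j + 1)) with h1 | h1
  · rcases le_total (22 * a (j + 1)) (39 * a (j + 2)) with h2 | h2
    · exact bandCase j h h1 h2
    · refine brimCase (j + 2) ?_ ?_
      · rw [q3]; linarith [hj.1, hj.2, ha (j + 2)]
      · rw [q4]; linarith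
  · refine brimCase (j + 1) ?_ ?_
    · rw [q1]; linarith
    · rw [q2]; linarith [hj.1, hj.2, ha (j + 1)]

/-! ### The triangulation of the boundary of the tetrahedron by small triangles -/

/-- A small triangle, in integer barycentric coordinates: it lies on the face opposite to vertex `i`
and has the vertices `b ± eⱼ`, `j ≠ i`. -/
@[ext]
structure Tile (k : ℕ) where
  i : Fin 4
  up : Bool
  b : Fin 4 → ℤ
  b_i : b i = 0
  sum_b : ∑ l, b l + (if up then 1 else -1) = k
  nonneg : ∀ l, 0 ≤ b l
  pos : up = false → ∀ l, l ≠ i → 1 ≤ b l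

namespace Tile

variable {k : ℕ}

/-- The orientation of a small triangle as a sign. -/
def sgn (τ : Tile k) : ℤ := if τ.up then 1 else -1

theorem sgn_eq (τ : Tile k) : τ.up = true ∧ τ.sgn = 1 ∨ τ.up = false ∧ τ.sgn = -1 := by
  unfold sgn; cases τ.up <;> simp

theorem sum_b' (τ : Tile k) : ∑ l, τ.b l + τ.sgn = k := τ.sum_b

/-- The vertices of a small triangle. -/
def corner (τ : Tile k) (j : Fin 3) : Fin 4 → ℤ :=
  fun l => τ.b l + if l = τ.i.succAbove j then τ.sgn else 0

theorem corner_injective (τ : Tile k) : Function.Injective τ.corner := by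
  intro j j' h
  by_contra hne
  have := congrFun h (τ.i.succAbove j)
  have h2 : τ.i.succAbove j ≠ τ.i.succAbove j' := fun h => hne (Fin.succAbove_right_injective h)
  simp only [corner, if_true, h2, if_false] at this
  rcases τ.sgn_eq with h | h <;> omega

theorem sum_corner (τ : Tile k) (j : Fin 3) : ∑ l, τ.corner j l = k := by
  simp only [corner, Finset.sum_add_distrib, Finset.sum_ite_eq', Finset.mem_univ, if_true]
  exact τ.sum_b'

theorem corner_i (τ : Tile k) (j : Fin 3) : τ.corner j τ.i = 0 := by
  simp [corner, τ.b_i, (Fin.succAbove_ne τ.i j).symm]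

instance : Finite (Tile k) := by
  have hb : ∀ (τ : Tile k) l, τ.b l ≤ k + 1 := by
    intro τ l
    have h1 := τ.sum_b'
    have h2 : τ.b l ≤ ∑ l, τ.b l := Finset.single_le_sum (fun l _ => τ.nonneg l) (Finset.mem_univ l)
    rcases τ.sgn_eq with h | h <;> omega
  refine Finite.of_injective (β := Fin 4 × Bool × (Fin 4 → Fin (k + 2)))
    (fun τ => (τ.i, τ.up, fun l => ⟨(τ.b l).toNat, by have := hb τ l; omega⟩)) ?_
  intro τ τ' h
  simp only [Prod.mk.injEq] at h
  refine Tile.ext h.1 h.2.1 (funext fun l => ?_)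
  have h3 := congrFun h.2.2 l
  simp only [Fin.mk.injEq] at h3
  have := τ.nonneg l
  have := τ'.nonneg l
  omega

/-- There are at least `4k²` small triangles. -/
theorem le_card (k : ℕ) : 4 * k ^ 2 ≤ Nat.card (Tile k) := by
  have hcard : Nat.card (Fin 4 × Fin k × Fin k) = 4 * k ^ 2 := by
    simp [sq]
  rw [← hcard]
  -- On each face a k × k array is split along its antidiagonal: pairs with sum below k index the
  -- upward triangles, the remaining ones the downward triangles.
  let f : Fin 4 × Fin k × Fin k → Tile k := fun x =>
    { i := x.1
      up := decide ((x.2.1 : ℕ) + x.2.2 < k)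
      b := x.1.insertNth 0 (if (x.2.1 : ℕ) + x.2.2 < k then
          ![(x.2.1 : ℤ), (x.2.2 : ℤ), k - 1 - x.2.1 - x.2.2] else
          ![(k : ℤ) - x.2.1, k - x.2.2, x.2.1 + x.2.2 + 1 - k])
      b_i := by simp
      sum_b := by
        rw [Fin.sum_univ_succAbove _ x.1]
        split_ifs with h1 h2 h2
        · simp [Fin.sum_univ_three]
        · simp at h2; omega
        · simp at h2; omega
        · simp [Fin.sum_univ_three]; ring
      nonneg := by
        intro l
        have h1 := x.2.1.2
        have h2 := x.2.2.2
        rcases Fin.eq_self_or_eq_succAbove x.1 l with rfl | ⟨j, rfl⟩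
        · simp
        · split_ifs with h <;> fin_cases j <;> simp <;> omega
      pos := by
        intro hup l hl
        have h1 := x.2.1.2
        have h2 := x.2.2.2
        have h : ¬ (x.2.1 : ℕ) + x.2.2 < k := by simpa using hup
        rcases Fin.eq_self_or_eq_succAbove x.1 l with rfl | ⟨j, rfl⟩
        · exact absurd rfl hl
        · rw [if_neg h]; fin_cases j <;> simp <;> omega }
  refine Nat.card_le_card_of_injective f ?_
  rintro ⟨i, p, q⟩ ⟨i', p', q'⟩ h
  have hi : i = i' := congrArg Tile.i h
  subst hi
  have hup : decide ((p : ℕ) + q < k) = decide ((p' : ℕ) + q' < k) := congrArg Tile.up h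
  have hb := congrArg Tile.b h
  have h0 := congrFun hb (i.succAbove 0)
  have h1 := congrFun hb (i.succAbove 1)
  simp only [f, Fin.insertNth_apply_succAbove] at h0 h1
  rw [decide_eq_decide] at hup
  by_cases hc : (p : ℕ) + q < k
  · simp only [hc, hup.1 hc, if_true] at h0 h1
    simp at h0 h1
    simp only [Prod.mk.injEq, true_and]
    exact ⟨Fin.ext (by omega), Fin.ext (by omega)⟩
  · simp only [hc, mt hup.2 hc, if_false] at h0 h1
    simp at h0 h1
    simp only [Prod.mk.injEq, true_and]
    exact ⟨Fin.ext (by omega), Fin.ext (by omega)⟩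

/-- The point with barycentric coordinates `a` in a small triangle. -/
noncomputable def flat (τ : Tile k) (a : Fin 3 → ℝ) : Fin 4 → ℝ :=
  fun l => τ.b l + τ.sgn * (τ.i.insertNth (α := fun _ => ℝ) 0 a) l

theorem flat_i (τ : Tile k) (a : Fin 3 → ℝ) : τ.flat a τ.i = 0 := by
  simp [flat, τ.b_i]

theorem flat_succAbove (τ : Tile k) (a : Fin 3 → ℝ) (j : Fin 3) :
    τ.flat a (τ.i.succAbove j) = τ.b (τ.i.succAbove j) + τ.sgn * a j := by
  simp [flat]

theorem abs_sgn (τ : Tile k) : |(τ.sgn : ℝ)| = 1 := by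
  rcases τ.sgn_eq with h | h <;> simp [h.2]

/-- The barycentric coordinates of a point in a small triangle are given by the piecewise linear
nodal functions of the triangulation. -/
theorem nodal_flat (τ : Tile k) {a : Fin 3 → ℝ} (ha : ∀ j, 0 ≤ a j) (hs : ∑ j, a j = 1)
    (g : Fin 4 → ℤ) (hg : ∑ l, g l = k) :
    max 0 (1 - ‖τ.flat a - fun l => (g l : ℝ)‖) = ∑ j, if τ.corner j = g then a j else 0 := by
  by_cases hex : ∃ m, τ.corner m = g
  · obtain ⟨m, rfl⟩ := hex
    have h1 : ∑ j, (if τ.corner j = τ.corner m then a j else 0) = a m := by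
      simp [τ.corner_injective.eq_iff]
    rw [h1]
    have hle : ∀ j, j ≠ m → a j ≤ 1 - a m := by
      intro j hj
      have := Finset.sum_le_sum_of_subset_of_nonneg (Finset.subset_univ {j, m})
        (f := a) (fun i _ _ => ha i)
      rw [Finset.sum_pair hj, hs] at this
      linarith
    have ham : a m ≤ 1 := by
      rw [← hs]; exact Finset.single_le_sum (fun j _ => ha j) (Finset.mem_univ m)
    have hcoord : ∀ j, τ.flat a (τ.i.succAbove j) - (τ.corner m (τ.i.succAbove j) : ℝ) =
        τ.sgn * (a j - if j = m then 1 else 0) := by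
      intro j
      rw [flat_succAbove, corner]
      by_cases hjm : j = m
      · simp [hjm]; ring
      · have : τ.i.succAbove j ≠ τ.i.succAbove m := fun h => hjm (Fin.succAbove_right_injective h)
        simp [hjm, this]
    -- In the sup norm the distance to corner `m` is attained at that corner's own coordinate,
    -- because every other coordinate is at most 1 - `a m`.
    have hnorm : ‖τ.flat a - fun l => (τ.corner m l : ℝ)‖ = 1 - a m := by
      apply le_antisymm
      · rw [pi_norm_le_iff_of_nonneg (by linarith)]
        intro l
        rcases Fin.eq_self_or_eq_succAbove τ.i l with rfl | ⟨j, rfl⟩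
        · simp [flat_i, corner_i, ham]
        · rw [Pi.sub_apply, hcoord, Real.norm_eq_abs, abs_mul, abs_sgn, one_mul]
          split_ifs with hj
          · rw [hj, abs_sub_comm, abs_of_nonneg (by linarith)]
          · rw [sub_zero, abs_of_nonneg (ha j)]; exact hle j hj
      · have := norm_le_pi_norm (τ.flat a - fun l => (τ.corner m l : ℝ)) (τ.i.succAbove m)
        rw [Pi.sub_apply, hcoord, Real.norm_eq_abs, abs_mul, abs_sgn, one_mul, if_pos rfl,
          abs_sub_comm, abs_of_nonneg (by linarith)] at this
        exact this
    rw [hnorm, sub_sub_cancel, max_eq_right (ha m)]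
  · push Not at hex
    have h0 : ∑ j, (if τ.corner j = g then a j else 0) = 0 :=
      Finset.sum_eq_zero fun j _ => if_neg (hex j)
    rw [h0, max_eq_left_iff, sub_nonpos]
    have hss : τ.sgn * τ.sgn = 1 := by rcases τ.sgn_eq with h | h <;> simp [h.2]
    have key : ∀ l, |(τ.i.insertNth (α := fun _ => ℝ) 0 a) l - ((τ.sgn * (g l - τ.b l) : ℤ) : ℝ)| ≤
        ‖τ.flat a - fun l => (g l : ℝ)‖ := by
      intro l
      refine le_trans (le_of_eq ?_) (norm_le_pi_norm _ l)
      rw [Pi.sub_apply, Real.norm_eq_abs, ← one_mul |_|, ← abs_sgn τ, ← abs_mul]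
      congr 1
      have : (τ.sgn : ℝ) * τ.sgn = 1 := by exact_mod_cast hss
      simp only [flat]; push_cast
      linear_combination -((g l : ℝ) - τ.b l) * this
    have hnn : ∀ l, 0 ≤ (τ.i.insertNth (α := fun _ => ℝ) 0 a) l := by
      intro l
      rcases Fin.eq_self_or_eq_succAbove τ.i l with rfl | ⟨j, rfl⟩ <;> simp [ha]
    -- Here `g` is not a corner and the tent must vanish, so some coordinate must differ by at least
    -- 1. The integer vector `sgn * (g - b)` has sum 1. A negative entry gives such a coordinate;
    -- otherwise it is a unit vector, at position `i` because `g` is not a corner, and there the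
    -- flat point has coordinate 0.
    by_cases hneg : ∃ l, τ.sgn * (g l - τ.b l) ≤ -1
    · obtain ⟨l, hl⟩ := hneg
      refine le_trans ?_ (key l)
      refine le_trans ?_ (le_abs_self _)
      have : ((τ.sgn * (g l - τ.b l) : ℤ) : ℝ) ≤ -1 := by exact_mod_cast hl
      linarith [hnn l]
    · push Not at hneg
      have hsum : ∑ l, τ.sgn * (g l - τ.b l) = 1 := by
        rw [← Finset.mul_sum, Finset.sum_sub_distrib, hg, ← τ.sum_b', add_sub_cancel_left, hss]
      obtain ⟨l, hl⟩ : ∃ l, 1 ≤ τ.sgn * (g l - τ.b l) := by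
        by_contra hcon
        push Not at hcon
        have := Finset.sum_nonpos (s := Finset.univ) (f := fun l => τ.sgn * (g l - τ.b l))
          (fun l _ => by have := hcon l; omega)
        omega
      have hother : ∀ l', l' ≠ l → τ.sgn * (g l' - τ.b l') = 0 ∧ τ.sgn * (g l - τ.b l) = 1 := by
        intro l' hl'
        have h1 := Finset.sum_le_sum_of_subset_of_nonneg (Finset.subset_univ {l', l})
          (f := fun l => τ.sgn * (g l - τ.b l)) (fun i _ _ => by have := hneg i; omega)
        rw [Finset.sum_pair hl', hsum] at h1
        have := hneg l'
        constructor <;> linarith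
      rcases Fin.eq_self_or_eq_succAbove τ.i l with rfl | ⟨j, rfl⟩
      · refine le_trans ?_ (key τ.i)
        rw [Fin.insertNth_apply_same, zero_sub, abs_neg]
        refine le_trans ?_ (le_abs_self _)
        exact_mod_cast hl
      · exfalso
        refine hex j (funext fun l' => ?_)
        simp only [corner]
        have hcancel : ∀ l', g l' - τ.b l' = τ.sgn * (τ.sgn * (g l' - τ.b l')) := fun l' => by
          rw [← mul_assoc, hss, one_mul]
        split_ifs with hl'
        · have h1 := hcancel l'
          have h2 : ∃ l', l' ≠ τ.i.succAbove j := ⟨τ.i, (Fin.succAbove_ne _ _).symm⟩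
          obtain ⟨l2, hl2⟩ := h2
          rw [hl', (hother l2 hl2).2] at h1
          rw [hl']
          linarith
        · have h1 := hcancel l'
          rw [(hother l' hl').1] at h1
          linarith

end Tile

/-! ### Covering by small triangles, and their adjacency. -/

namespace Tile

variable {k : ℕ}

/-- The small triangles cover the faces of the tetrahedron. -/
theorem exists_flat_eq (hk : 1 ≤ k) {q : Fin 4 → ℝ} (hq : ∀ l, 0 ≤ q l) (hs : ∑ l, q l = k)
    {i : Fin 4} (hi : q i = 0) :
    ∃ (τ : Tile k) (a : Fin 3 → ℝ), (∀ j, 0 ≤ a j) ∧ ∑ j, a j = 1 ∧ τ.flat a = q := by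
  have hfl : ∀ l, (⌊q l⌋ : ℝ) + Int.fract (q l) = q l := fun l => Int.floor_add_fract _
  have hf0 : ∀ l, 0 ≤ ⌊q l⌋ := fun l => Int.floor_nonneg.2 (hq l)
  have hsumq : ∑ j, q (i.succAbove j) = k := by
    rw [Fin.sum_univ_succAbove _ i, hi, zero_add] at hs; exact hs
  obtain ⟨F, hF⟩ : ∃ F : ℤ, F = k - ∑ j, ⌊q (i.succAbove j)⌋ := ⟨_, rfl⟩
  have hFr : ∑ j, Int.fract (q (i.succAbove j)) = F := by
    rw [hF]; push_cast
    rw [eq_sub_iff_add_eq, ← Finset.sum_add_distrib, ← hsumq]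
    exact Finset.sum_congr rfl fun j _ => by rw [add_comm]; exact hfl _
  have hFlo : 0 ≤ F := by
    have : (0 : ℝ) ≤ F := by rw [← hFr]; exact Finset.sum_nonneg fun j _ => Int.fract_nonneg _
    exact_mod_cast this
  have hFhi : F < 3 := by
    have : (F : ℝ) < 3 := by
      rw [← hFr, Fin.sum_univ_three]
      linarith [Int.fract_lt_one (q (i.succAbove 0)), Int.fract_lt_one (q (i.succAbove 1)),
        Int.fract_lt_one (q (i.succAbove 2))]
    exact_mod_cast this
  -- The sum of the three fractional parts decides the case: 0 for a grid point, 1 for an upward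
  -- triangle based at the floors, 2 for a downward triangle based at the floors plus one.
  obtain rfl | rfl | rfl : F = 0 ∨ F = 1 ∨ F = 2 := by omega
  · have hz : ∀ j, Int.fract (q (i.succAbove j)) = 0 := by
      intro j
      have := (Finset.sum_eq_zero_iff_of_nonneg (fun j _ => Int.fract_nonneg _)).1
        (hFr.trans (by simp)) j (Finset.mem_univ j)
      exact this
    obtain ⟨m, hm⟩ : ∃ m, 1 ≤ ⌊q (i.succAbove m)⌋ := by
      by_contra hcon
      push Not at hcon
      have : ∑ j, ⌊q (i.succAbove j)⌋ ≤ 0 :=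
        Finset.sum_nonpos fun j _ => by have := hcon j; omega
      omega
    refine ⟨⟨i, true, i.insertNth 0 fun j => ⌊q (i.succAbove j)⌋ - if j = m then 1 else 0,
      by simp, ?_, ?_, by simp⟩, fun j => if j = m then 1 else 0, ?_, by simp, ?_⟩
    · rw [Fin.sum_univ_succAbove _ i]; simp; omega
    · intro l
      rcases Fin.eq_self_or_eq_succAbove i l with rfl | ⟨j, rfl⟩
      · simp
      · simp only [Fin.insertNth_apply_succAbove]
        have := hf0 (i.succAbove j)
        split_ifs with h
        · subst h; omega
        · omega
    · intro j; dsimp only; split_ifs <;> norm_num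
    · funext l
      rcases Fin.eq_self_or_eq_succAbove i l with rfl | ⟨j, rfl⟩
      · simp [flat, hi]
      · simp only [flat, sgn, Fin.insertNth_apply_succAbove]
        have h1 := hfl (i.succAbove j)
        rw [hz j] at h1
        push_cast
        split_ifs <;> simp <;> linarith
  · refine ⟨⟨i, true, i.insertNth 0 fun j => ⌊q (i.succAbove j)⌋,
      by simp, ?_, ?_, by simp⟩, fun j => Int.fract (q (i.succAbove j)),
      fun j => Int.fract_nonneg _, by rw [hFr]; simp, ?_⟩
    · rw [Fin.sum_univ_succAbove _ i]; simp; omega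
    · intro l
      rcases Fin.eq_self_or_eq_succAbove i l with rfl | ⟨j, rfl⟩
      · simp
      · simpa only [Fin.insertNth_apply_succAbove] using hf0 _
    · funext l
      rcases Fin.eq_self_or_eq_succAbove i l with rfl | ⟨j, rfl⟩
      · simp [flat, hi]
      · simp only [flat, sgn, Fin.insertNth_apply_succAbove]
        have h1 := hfl (i.succAbove j)
        simp
  · refine ⟨⟨i, false, i.insertNth 0 fun j => ⌊q (i.succAbove j)⌋ + 1,
      by simp, ?_, ?_, ?_⟩, fun j => 1 - Int.fract (q (i.succAbove j)), ?_, ?_, ?_⟩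
    · rw [Fin.sum_univ_succAbove _ i]; simp [Finset.sum_add_distrib]; omega
    · intro l
      rcases Fin.eq_self_or_eq_succAbove i l with rfl | ⟨j, rfl⟩
      · simp
      · simp only [Fin.insertNth_apply_succAbove]
        have := hf0 (i.succAbove j)
        omega
    · intro _ l hl
      rcases Fin.eq_self_or_eq_succAbove i l with rfl | ⟨j, rfl⟩
      · exact absurd rfl hl
      · simp only [Fin.insertNth_apply_succAbove]
        have := hf0 (i.succAbove j)
        omega
    · intro j; linarith [Int.fract_lt_one (q (i.succAbove j))]
    · rw [Finset.sum_sub_distrib, hFr]; simp; norm_num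
    · funext l
      rcases Fin.eq_self_or_eq_succAbove i l with rfl | ⟨j, rfl⟩
      · simp [flat, hi]
      · simp only [flat, sgn, Fin.insertNth_apply_succAbove]
        have h1 := hfl (i.succAbove j)
        simp

/-- The two ways in which a second small triangle can share the edge opposite to a vertex. -/
def Opposite (τ : Tile k) (j : Fin 3) (τ' : Tile k) : Prop :=
  (τ'.i = τ.i ∧ τ'.up = !τ.up ∧
    ∀ l, τ'.b l = τ.b l + if l = τ.i ∨ l = τ.i.succAbove j then 0 else τ.sgn) ∨
  (τ.up = true ∧ τ'.up = true ∧ τ.b (τ.i.succAbove j) = 0 ∧ τ'.b = τ.b ∧ τ'.i = τ.i.succAbove j)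

/-- Each alternative determines the neighbour, and they exclude each other: a downward neighbour on
the same face has coordinates at least 1, whereas bending around an edge of the tetrahedron requires
that coordinate to be 0. -/
theorem opposite_unique {τ τ₁ τ₂ : Tile k} {j : Fin 3} (h₁ : τ.Opposite j τ₁)
    (h₂ : τ.Opposite j τ₂) : τ₁ = τ₂ := by
  have aux : ∀ τ₁ τ₂ : Tile k, (τ₁.i = τ.i ∧ τ₁.up = !τ.up ∧
      ∀ l, τ₁.b l = τ.b l + if l = τ.i ∨ l = τ.i.succAbove j then 0 else τ.sgn) →
      (τ.up = true ∧ τ₂.up = true ∧ τ.b (τ.i.succAbove j) = 0 ∧ τ₂.b = τ.b ∧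
        τ₂.i = τ.i.succAbove j) → False := by
    rintro τ₁ τ₂ ⟨a1, a2, a3⟩ ⟨b1, b2, b3, b4, b5⟩
    have := τ₁.pos (by rw [a2, b1]; rfl) (τ.i.succAbove j) (by rw [a1]; exact Fin.succAbove_ne _ _)
    rw [a3, if_pos (Or.inr rfl), b3] at this
    omega
  rcases h₁ with h₁ | h₁ <;> rcases h₂ with h₂ | h₂
  · exact Tile.ext (h₁.1.trans h₂.1.symm) (h₁.2.1.trans h₂.2.1.symm)
      (funext fun l => (h₁.2.2 l).trans (h₂.2.2 l).symm)
  · exact (aux _ _ h₁ h₂).elim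
  · exact (aux _ _ h₂ h₁).elim
  · exact Tile.ext (h₁.2.2.2.2.trans h₂.2.2.2.2.symm) (h₁.2.1.trans h₂.2.1.symm)
      (h₁.2.2.2.1.trans h₂.2.2.2.1.symm)

theorem Opposite.ne {τ τ' : Tile k} {j : Fin 3} (h : τ.Opposite j τ') : τ' ≠ τ := by
  rintro rfl
  rcases h with h | h
  · have := h.2.1; cases hh : τ'.up <;> simp [hh] at this
  · exact Fin.succAbove_ne _ _ h.2.2.2.2.symm

/-- Compare coordinates at the two shared corners. With equal orientations the shifted coordinates
agree, so the bases agree and only the face can differ. With opposite orientations they are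
interchanged, which forces the flip within one face. -/
theorem eq_or_opposite {τ τ' : Tile k} {j m n : Fin 3} (hm : m ≠ j) (hn : n ≠ j) (hmn : m ≠ n)
    {m' n' : Fin 3} (h1 : τ.corner m = τ'.corner m') (h2 : τ.corner n = τ'.corner n') :
    τ' = τ ∨ τ.Opposite j τ' := by
  have hm'n' : m' ≠ n' := by
    rintro rfl
    exact hmn (τ.corner_injective (h1.trans h2.symm))
  obtain ⟨p, hp⟩ : ∃ p, p = τ.i.succAbove m := ⟨_, rfl⟩
  obtain ⟨q, hq⟩ : ∃ q, q = τ.i.succAbove n := ⟨_, rfl⟩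
  obtain ⟨r, hr⟩ : ∃ r, r = τ.i.succAbove j := ⟨_, rfl⟩
  obtain ⟨p', hp'⟩ : ∃ p, p = τ'.i.succAbove m' := ⟨_, rfl⟩
  obtain ⟨q', hq'⟩ : ∃ q, q = τ'.i.succAbove n' := ⟨_, rfl⟩
  have hpq : p ≠ q := by rw [hp, hq]; exact fun h => hmn (Fin.succAbove_right_injective h)
  have hpr : p ≠ r := by rw [hp, hr]; exact fun h => hm (Fin.succAbove_right_injective h)
  have hqr : q ≠ r := by rw [hq, hr]; exact fun h => hn (Fin.succAbove_right_injective h)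
  have hpi : p ≠ τ.i := by rw [hp]; exact Fin.succAbove_ne _ _
  have hqi : q ≠ τ.i := by rw [hq]; exact Fin.succAbove_ne _ _
  have hri : r ≠ τ.i := by rw [hr]; exact Fin.succAbove_ne _ _
  have hpq' : p' ≠ q' := by rw [hp', hq']; exact fun h => hm'n' (Fin.succAbove_right_injective h)
  have hpi' : p' ≠ τ'.i := by rw [hp']; exact Fin.succAbove_ne _ _
  have hqi' : q' ≠ τ'.i := by rw [hq']; exact Fin.succAbove_ne _ _
  have four : ∀ i p q r l : Fin 4, p ≠ q → p ≠ r → q ≠ r → p ≠ i → q ≠ i → r ≠ i → l ≠ p → l ≠ q →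
      l = i ∨ l = r := by decide
  have E1 : ∀ l, τ.b l + (if l = p then τ.sgn else 0) = τ'.b l + if l = p' then τ'.sgn else 0 := by
    intro l; have := congrFun h1 l; simpa only [corner, hp, hp'] using this
  have E2 : ∀ l, τ.b l + (if l = q then τ.sgn else 0) = τ'.b l + if l = q' then τ'.sgn else 0 := by
    intro l; have := congrFun h2 l; simpa only [corner, hq, hq'] using this
  have e1 := E1 p
  have e2 := E2 p
  have e3 := E1 q
  have e4 := E2 q
  rw [if_pos rfl] at e1 e4
  rw [if_neg hpq] at e2
  rw [if_neg hpq.symm] at e3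
  have hs : τ.sgn = 1 ∨ τ.sgn = -1 := by rcases τ.sgn_eq with h | h <;> simp [h.2]
  have hs' : τ'.sgn = 1 ∨ τ'.sgn = -1 := by rcases τ'.sgn_eq with h | h <;> simp [h.2]
  by_cases hss : τ.sgn = τ'.sgn
  · have hup : τ'.up = τ.up := by
      rcases τ.sgn_eq with h | h <;> rcases τ'.sgn_eq with h' | h' <;> simp_all
    have hpp : p = p' := by
      by_contra hne
      rw [if_neg hne] at e1
      split_ifs at e2 <;> omega
    have hqq : q = q' := by
      by_contra hne
      rw [if_neg hne] at e4
      split_ifs at e3 <;> omega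
    have hb : τ'.b = τ.b := by
      funext l
      have := E1 l
      rw [← hpp, hss] at this
      omega
    rcases four τ.i p q r τ'.i hpq hpr hqr hpi hqi hri (by rw [hpp]; exact hpi'.symm)
      (by rw [hqq]; exact hqi'.symm) with hi | hi
    · left; exact Tile.ext hi hup hb
    · right; right
      have hbr : τ.b r = 0 := by rw [← hb, ← hi, τ'.b_i]
      have hu : τ.up = true := by
        by_contra hu
        have := τ.pos (by simpa using hu) r hri
        omega
      rw [← hr]
      exact ⟨hu, hup.trans hu, hbr, hb, hi⟩
  · have hss' : τ'.sgn = -τ.sgn := by omega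
    have hup : τ'.up = !τ.up := by
      rcases τ.sgn_eq with h | h <;> rcases τ'.sgn_eq with h' | h' <;> simp_all
    have hpp : p = q' := by
      by_contra hne
      rw [if_neg hne] at e2
      split_ifs at e1 <;> omega
    have hqq : q = p' := by
      by_contra hne
      rw [if_neg hne] at e3
      split_ifs at e4 <;> omega
    have hi := four τ.i p q r τ'.i hpq hpr hqr hpi hqi hri (by rw [hpp]; exact hqi'.symm)
      (by rw [hqq]; exact hpi'.symm)
    have hb : ∀ l, τ'.b l = τ.b l + if l = τ.i ∨ l = r then 0 else τ.sgn := by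
      intro l
      have := E1 l
      rw [← hqq, hss'] at this
      by_cases hlp : l = p
      · have h3 : ¬ (l = τ.i ∨ l = r) := by rw [hlp]; tauto
        have h4 : l ≠ q := by rw [hlp]; exact hpq
        rw [if_pos hlp, if_neg h4] at this
        rw [if_neg h3]; omega
      · by_cases hlq : l = q
        · have h3 : ¬ (l = τ.i ∨ l = r) := by rw [hlq]; tauto
          rw [if_neg hlp, if_pos hlq] at this
          rw [if_neg h3]; omega
        · rw [if_neg hlp, if_neg hlq] at this
          rw [if_pos (four τ.i p q r l hpq hpr hqr hpi hqi hri hlp hlq)]; omega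
    right; left
    rw [← hr]
    refine ⟨?_, hup, hb⟩
    rcases hi with hi | hi
    · exact hi
    · exfalso
      have hbr : τ.b r = 0 := by
        have := hb r
        rw [if_pos (Or.inr rfl), ← hi, τ'.b_i] at this
        rw [← hi]; omega
      cases hu : τ.up
      · have := τ.pos hu r hri; omega
      · have h5 := τ'.pos (by rw [hup, hu]; rfl) τ.i (by rw [hi]; exact hri.symm)
        rw [hb, if_pos (Or.inl rfl), τ.b_i] at h5
        omega

/-- A small triangle is determined by its vertices. -/
theorem eq_of_corners {τ τ' : Tile k} (h : ∀ m, ∃ m', τ.corner m = τ'.corner m') : τ' = τ := by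
  obtain ⟨m0, h0⟩ := h 0
  obtain ⟨m1, h1⟩ := h 1
  obtain ⟨m2, h2⟩ := h 2
  rcases eq_or_opposite (j := 0) (by decide) (by decide) (by decide) h1 h2 with h | h
  · exact h
  rcases eq_or_opposite (j := 1) (by decide) (by decide) (by decide) h0 h2 with h' | h'
  · exact h'
  exfalso
  have hne : τ.i.succAbove 0 ≠ τ.i.succAbove 1 := fun h =>
    absurd (Fin.succAbove_right_injective h) (by decide)
  rcases h with ⟨-, hu, hb⟩ | ⟨hu, hu', -, -, hi⟩ <;>
    rcases h' with ⟨-, gu, gb⟩ | ⟨gu, gu', -, -, gi⟩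
  · have e1 := hb (τ.i.succAbove 0)
    rw [gb, if_pos (Or.inr rfl), if_neg (by simp [hne, Fin.succAbove_ne])] at e1
    rcases τ.sgn_eq with h | h <;> omega
  · rw [gu, gu'] at hu; exact Bool.noConfusion hu
  · rw [hu, hu'] at gu; exact Bool.noConfusion gu
  · exact hne (hi.symm.trans gi)

/-- Every edge of a small triangle is shared with a second one. -/
theorem exists_opposite (τ : Tile k) (j : Fin 3) : ∃ τ', τ.Opposite j τ' := by
  have hr : τ.i.succAbove j ≠ τ.i := Fin.succAbove_ne _ _
  have count : ∀ (i r : Fin 4) (s : ℤ), r ≠ i → ∑ l, (if l = i ∨ l = r then 0 else s) = 2 * s := by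
    intro i r s h
    fin_cases i <;> fin_cases r <;> simp [Fin.sum_univ_four] at h ⊢ <;> ring
  have hsum := τ.sum_b
  cases hu : τ.up
  · have hs : τ.sgn = -1 := by simp [sgn, hu]
    refine ⟨⟨τ.i, true, fun l => τ.b l + if l = τ.i ∨ l = τ.i.succAbove j then 0 else τ.sgn,
      by simp [τ.b_i], ?_, ?_, by simp⟩, Or.inl ⟨rfl, by simp [hu], fun l => rfl⟩⟩
    · rw [Finset.sum_add_distrib, count _ _ _ hr, hs]
      rw [hu] at hsum
      simp at hsum ⊢
      omega
    · intro l
      have := τ.nonneg l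
      split_ifs with h
      · omega
      · have := τ.pos hu l (fun h' => h (Or.inl h'))
        omega
  · have hs : τ.sgn = 1 := by simp [sgn, hu]
    rcases eq_or_ne (τ.b (τ.i.succAbove j)) 0 with h0 | h0
    · exact ⟨⟨τ.i.succAbove j, true, τ.b, h0, by rw [hu] at hsum; exact hsum, τ.nonneg, by simp⟩,
        Or.inr ⟨hu, rfl, h0, rfl, rfl⟩⟩
    · refine ⟨⟨τ.i, false, fun l => τ.b l + if l = τ.i ∨ l = τ.i.succAbove j then 0 else τ.sgn,
        by simp [τ.b_i], ?_, ?_, ?_⟩, Or.inl ⟨rfl, by simp [hu], fun l => rfl⟩⟩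
      · rw [Finset.sum_add_distrib, count _ _ _ hr, hs]
        rw [hu] at hsum
        simp at hsum ⊢
        omega
      · intro l
        have := τ.nonneg l
        rw [hs]
        split_ifs <;> omega
      · intro _ l hl
        have := τ.nonneg l
        have := τ.nonneg (τ.i.succAbove j)
        rw [hs]
        simp only [hl, false_or]
        split_ifs with h
        · rw [h]; omega
        · omega

/-- Opposite small triangles share the edge. -/
theorem Opposite.exists_corner {τ τ' : Tile k} {j : Fin 3} (h : τ.Opposite j τ') :
    ∃ j', (∀ m, m ≠ j → ∃ m', m' ≠ j' ∧ τ.corner m = τ'.corner m') ∧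
      ((τ'.i = τ.i ∧ j' = j) ∨ τ'.i.succAbove j' = τ.i) := by
  rcases h with ⟨hi, hu, hb⟩ | ⟨hu, hu', hr, hb, hi⟩
  · refine ⟨j, fun m hm => ?_, Or.inl ⟨hi, rfl⟩⟩
    have third : ∀ m j : Fin 3, m ≠ j → ∃ n, n ≠ j ∧ n ≠ m ∧ ∀ l, l = m ∨ l = n ∨ l = j := by decide
    obtain ⟨n, hn, hnm, hall⟩ := third m j hm
    refine ⟨n, hn, funext fun l => ?_⟩
    have hs : τ'.sgn = -τ.sgn := by
      unfold sgn; rw [hu]; cases τ.up <;> simp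
    simp only [corner, hb, hi, hs]
    rcases Fin.eq_self_or_eq_succAbove τ.i l with rfl | ⟨t, rfl⟩
    · simp [(Fin.succAbove_ne _ _).symm]
    · have inj : ∀ a b : Fin 3, τ.i.succAbove a = τ.i.succAbove b ↔ a = b := fun a b =>
        (Fin.succAbove_right_injective (p := τ.i)).eq_iff
      simp only [inj, Fin.succAbove_ne, false_or]
      rcases hall t with rfl | rfl | rfl
      · simp [hnm.symm, hm]
      · simp [hnm, hn]
      · simp [hm.symm, hn.symm]
  · have hne : τ'.i ≠ τ.i := by rw [hi]; exact Fin.succAbove_ne _ _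
    obtain ⟨j', hj'⟩ := Fin.exists_succAbove_eq hne.symm
    refine ⟨j', fun m hm => ?_, Or.inr hj'⟩
    have hm' : τ.i.succAbove m ≠ τ'.i := by
      rw [hi]; exact fun h => hm (Fin.succAbove_right_injective h)
    obtain ⟨m', hm'⟩ := Fin.exists_succAbove_eq hm'
    refine ⟨m', ?_, funext fun l => ?_⟩
    · rintro rfl
      rw [hj'] at hm'
      exact Fin.succAbove_ne _ _ hm'.symm
    · simp only [corner, hb, hm', sgn, hu, hu']

end Tile

/-! ### Coordinates in space -/

/-- The vertices of a regular tetrahedron centred at the origin. -/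
noncomputable def tetra : Fin 4 → E3 :=
  ![!₂[1, 1, 1], !₂[1, -1, -1], !₂[-1, 1, -1], !₂[-1, -1, 1]]

/-- The point with barycentric coordinates `X / k`. -/
noncomputable def tetraPoint (k : ℕ) (X : Fin 4 → ℝ) : E3 := (1 / (k : ℝ)) • ∑ j, X j • tetra j

theorem inner_tetra (i j : Fin 4) :
    inner ℝ (tetra i) (tetra j) = if i = j then (3 : ℝ) else -1 := by
  fin_cases i <;> fin_cases j <;>
    simp [tetra, PiLp.inner_apply, Fin.sum_univ_three, EuclideanSpace.norm_sq_eq] <;> norm_num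

theorem sum_tetra : ∑ j, tetra j = 0 := by
  ext i; fin_cases i <;> simp [tetra, Fin.sum_univ_four]

theorem inner_sum_tetra (X : Fin 4 → ℝ) (j : Fin 4) :
    inner ℝ (∑ i, X i • tetra i) (tetra j) = 4 * X j - ∑ i, X i := by
  rw [sum_inner]
  simp only [real_inner_smul_left, inner_tetra]
  fin_cases j <;> simp [Fin.sum_univ_four] <;> ring

/-- The `k`-fold barycentric coordinates as affine functions. -/
noncomputable def tetraCoord (k : ℕ) (j : Fin 4) : E3 →ᵃ[ℝ] ℝ :=
  ((k : ℝ) / 4) • ((innerSL ℝ (tetra j)).toLinearMap.toAffineMap) + AffineMap.const ℝ E3 ((k : ℝ) / 4)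

theorem tetraCoord_apply (k : ℕ) (j : Fin 4) (p : E3) :
    tetraCoord k j p = (k : ℝ) / 4 * inner ℝ p (tetra j) + (k : ℝ) / 4 := by
  simp [tetraCoord, real_inner_comm]

theorem tetraCoord_tetraPoint {k : ℕ} (hk : 1 ≤ k) {X : Fin 4 → ℝ} (hX : ∑ i, X i = k) (j : Fin 4) :
    tetraCoord k j (tetraPoint k X) = X j := by
  have : (k : ℝ) ≠ 0 := by positivity
  rw [tetraCoord_apply, tetraPoint, real_inner_smul_left, inner_sum_tetra, hX]
  field_simp; ring

theorem tetraPoint_injective {k : ℕ} (hk : 1 ≤ k) {X Y : Fin 4 → ℝ} (hX : ∑ i, X i = k)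
    (hY : ∑ i, Y i = k) (h : tetraPoint k X = tetraPoint k Y) : X = Y := by
  funext j
  rw [← tetraCoord_tetraPoint hk hX j, h, tetraCoord_tetraPoint hk hY j]

/-- The Gram matrix of the four vertices is four times the identity minus the all-ones matrix, and
the latter vanishes on differences, whose coordinates sum to 0. -/
theorem dist_tetraPoint_sq {k : ℕ} {X Y : Fin 4 → ℝ} (hX : ∑ i, X i = k)
    (hY : ∑ i, Y i = k) :
    dist (tetraPoint k X) (tetraPoint k Y) ^ 2 = 4 / (k : ℝ) ^ 2 * ∑ j, (X j - Y j) ^ 2 := by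
  have h1 : tetraPoint k X - tetraPoint k Y = (1 / (k : ℝ)) • ∑ j, (X j - Y j) • tetra j := by
    simp only [tetraPoint, sub_smul, Finset.sum_sub_distrib, smul_sub]
  have h0 : ∑ i, (X i - Y i) = 0 := by rw [Finset.sum_sub_distrib, hX, hY, sub_self]
  rw [dist_eq_norm, h1, norm_smul, mul_pow,
    ← real_inner_self_eq_norm_sq (∑ j, (X j - Y j) • tetra j), inner_sum]
  simp only [real_inner_smul_right, inner_sum_tetra, h0, sub_zero]
  rw [Real.norm_eq_abs, sq_abs, Finset.mul_sum, Finset.mul_sum]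
  refine Finset.sum_congr rfl fun j _ => ?_
  ring

theorem sum_smul_tetraPoint {ι : Type*} (s : Finset ι) (k : ℕ) (w : ι → ℝ) (X : ι → Fin 4 → ℝ) :
    ∑ v ∈ s, w v • tetraPoint k (X v) = tetraPoint k (∑ v ∈ s, w v • X v) := by
  simp only [tetraPoint, Finset.sum_apply, Pi.smul_apply, smul_eq_mul, Finset.sum_smul]
  rw [Finset.sum_comm, Finset.smul_sum]
  refine Finset.sum_congr rfl fun v _ => ?_
  rw [smul_comm, Finset.smul_sum]
  simp only [smul_smul]

theorem exists_tetraPoint_eq {k : ℕ} (hk : 1 ≤ k) (p : E3) :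
    ∃ X : Fin 4 → ℝ, ∑ i, X i = k ∧ tetraPoint k X = p := by
  have hk' : (k : ℝ) ≠ 0 := by positivity
  refine ⟨fun j => tetraCoord k j p, ?_, ?_⟩
  · simp only [tetraCoord_apply, Finset.sum_add_distrib, ← Finset.mul_sum]
    rw [← inner_sum, sum_tetra, inner_zero_right]; simp; ring
  · ext i
    simp only [tetraPoint, tetraCoord_apply]
    fin_cases i <;>
      simp [tetra, Fin.sum_univ_four, PiLp.inner_apply, Fin.sum_univ_three] <;> field_simp <;> ring

/-! ### The vertices of the hats -/

/-- The height of the inner vertices of a hat. -/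
noncomputable def innerHeight : ℝ := √(3589875 / 10000000)

/-- The height of the centre of a hat above the inner vertices. -/
noncomputable def crownHeight : ℝ := √(1697875 / 10000000)

theorem innerHeight_sq : innerHeight ^ 2 = 3589875 / 10000000 := Real.sq_sqrt (by norm_num)

theorem crownHeight_sq : crownHeight ^ 2 = 1697875 / 10000000 := Real.sq_sqrt (by norm_num)

theorem innerHeight_pos : 0 < innerHeight := Real.sqrt_pos.2 (by norm_num)

theorem crownHeight_pos : 0 < crownHeight := Real.sqrt_pos.2 (by norm_num)

theorem innerHeight_lt : innerHeight < 3 / 5 := by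
  rw [innerHeight, Real.sqrt_lt' (by norm_num)]; norm_num

theorem lt_innerHeight : 1 / 2 < innerHeight := by
  rw [innerHeight, Real.lt_sqrt (by norm_num)]; norm_num

theorem lt_crownHeight : 2 / 5 < crownHeight := by
  rw [crownHeight, Real.lt_sqrt (by norm_num)]; norm_num

/-- The height of a vertex of a hat. -/
noncomputable def HatVertex.height : HatVertex → ℝ
  | c _ => 0
  | x _ => innerHeight
  | o => innerHeight + crownHeight

theorem HatVertex.height_nonneg (v : HatVertex) : 0 ≤ v.height := by
  have := innerHeight_pos
  have := crownHeight_pos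
  rcases v with j | j | _ <;> simp only [HatVertex.height] <;> linarith

/-- The outward direction at the face opposite to vertex `i`. -/
noncomputable def outward (i : Fin 4) : Fin 4 → ℝ := fun l => if l = i then -1 else 1 / 3

theorem sum_outward (i : Fin 4) : ∑ l, outward i l = 0 := by
  rw [Fin.sum_univ_succAbove _ i]
  simp [outward, Fin.succAbove_ne]

namespace Tile

variable {k : ℕ}

/-- The `k`-fold barycentric coordinates of a vertex of the hat over a small triangle. -/
noncomputable def coord (τ : Tile k) (v : HatVertex) : Fin 4 → ℝ :=
  τ.flat v.bary + v.height • outward τ.i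

/-- A vertex of the hat over a small triangle. -/
noncomputable def pt (τ : Tile k) (v : HatVertex) : E3 := tetraPoint k (τ.coord v)

theorem sum_flat (τ : Tile k) {a : Fin 3 → ℝ} (ha : ∑ j, a j = 1) : ∑ l, τ.flat a l = k := by
  have h := τ.sum_b'
  simp only [flat, Finset.sum_add_distrib, ← Finset.mul_sum]
  rw [Fin.sum_univ_succAbove (fun l => (τ.i.insertNth (α := fun _ => ℝ) 0 a) l) τ.i]
  simp only [Fin.insertNth_apply_same, Fin.insertNth_apply_succAbove, ha]
  have h' : ((∑ l, τ.b l + τ.sgn : ℤ) : ℝ) = k := by rw [h]; simp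
  push_cast at h'
  linarith

theorem sum_coord (τ : Tile k) (v : HatVertex) : ∑ l, τ.coord v l = k := by
  simp only [coord, Pi.add_apply, Pi.smul_apply, smul_eq_mul, Finset.sum_add_distrib,
    ← Finset.mul_sum, sum_outward, mul_zero, add_zero]
  exact τ.sum_flat v.sum_bary

theorem coord_corner (τ : Tile k) (j : Fin 3) : τ.coord (c j) = fun l => (τ.corner j l : ℝ) := by
  funext l
  simp only [coord, HatVertex.height, zero_smul, add_zero]
  rcases Fin.eq_self_or_eq_succAbove τ.i l with rfl | ⟨m, rfl⟩
  · rw [flat_i, corner_i]; simp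
  · rw [flat_succAbove, corner]
    by_cases h : m = j
    · simp [HatVertex.bary, h]
    · have : τ.i.succAbove m ≠ τ.i.succAbove j := fun h' => h (Fin.succAbove_right_injective h')
      simp [HatVertex.bary, h]

theorem coord_i (τ : Tile k) (v : HatVertex) : τ.coord v τ.i = -v.height := by
  simp [coord, flat_i, outward]

theorem coord_succAbove (τ : Tile k) (v : HatVertex) (j : Fin 3) : τ.coord v (τ.i.succAbove j) =
    τ.b (τ.i.succAbove j) + τ.sgn * v.bary j + v.height / 3 := by
  simp [coord, flat_succAbove, outward, Fin.succAbove_ne]; ring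

theorem sum_smul_coord (τ : Tile k) {w : HatVertex → ℝ} (hw : ∑ v, w v = 1) :
    ∑ v, w v • τ.coord v = τ.flat (baryOf w) + (∑ v, w v * v.height) • outward τ.i := by
  funext l
  simp only [Finset.sum_apply, Pi.add_apply, Pi.smul_apply, smul_eq_mul, coord, mul_add,
    Finset.sum_add_distrib, Finset.sum_mul, mul_assoc]
  congr 1
  rcases Fin.eq_self_or_eq_succAbove τ.i l with rfl | ⟨m, rfl⟩
  · simp [flat_i]
  · simp only [flat_succAbove, mul_add, Finset.sum_add_distrib, ← Finset.sum_mul, hw, one_mul,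
      baryOf]
    rw [Finset.mul_sum]
    congr 1
    exact Finset.sum_congr rfl fun v _ => by ring

/-- Two convex combinations of vertices of faces with the same flat projection have the same
weights. -/
theorem weights_unique {τ τ' : Tile k} {f f' : HatFace} {w w' : HatVertex → ℝ}
    (hw : IsFaceWeight f w) (hw' : IsFaceWeight f' w')
    (h : τ.flat (baryOf w) = τ'.flat (baryOf w')) :
    (τ = τ' ∧ w = w') ∨ ((w o = 0 ∧ ∀ j, w (x j) = 0) ∧ (w' o = 0 ∧ ∀ j, w' (x j) = 0) ∧
      ∀ g, (∑ j, if τ.corner j = g then w (c j) else 0) =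
        ∑ j, if τ'.corner j = g then w' (c j) else 0) := by
  -- Both sides are the tent function of the grid point `g` evaluated at the common flat point.
  have key : ∀ g, (∑ j, if τ.corner j = g then baryOf w j else 0) =
      ∑ j, if τ'.corner j = g then baryOf w' j else 0 := by
    intro g
    by_cases hg : ∑ l, g l = k
    · rw [← τ.nodal_flat (baryOf_nonneg hw) (sum_baryOf hw) g hg,
        ← τ'.nodal_flat (baryOf_nonneg hw') (sum_baryOf hw') g hg, h]
    · rw [Finset.sum_eq_zero, Finset.sum_eq_zero]
      · intro j _; rw [if_neg]; rintro rfl; exact hg (τ'.sum_corner j)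
      · intro j _; rw [if_neg]; rintro rfl; exact hg (τ.sum_corner j)
  by_cases hττ : τ = τ'
  · subst hττ
    left
    refine ⟨rfl, hw.ext_of_baryOf hw' (funext fun j => ?_)⟩
    have := key (τ.corner j)
    simpa [τ.corner_injective.eq_iff] using this
  · right
    -- A positive weight at an inner vertex or at the centre makes all three flat coordinates
    -- positive. Then every corner of `τ` must also be a corner of `τ'`, and the two small triangles
    -- coincide.
    have aux : ∀ {τ τ' : Tile k} {f f' : HatFace} {w w' : HatVertex → ℝ}, IsFaceWeight f w →
        IsFaceWeight f' w' → (∀ g, (∑ j, if τ.corner j = g then baryOf w j else 0) =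
        ∑ j, if τ'.corner j = g then baryOf w' j else 0) → τ ≠ τ' →
        w o = 0 ∧ ∀ j, w (x j) = 0 := by
      intro τ τ' f f' w w' hw hw' key hne
      by_contra hcon
      have hpos : 0 < w o ∨ ∃ j, 0 < w (x j) := by
        by_contra h2
        push Not at h2
        exact hcon ⟨le_antisymm h2.1 (hw.nonneg _), fun j => le_antisymm (h2.2 j) (hw.nonneg _)⟩
      refine hne (eq_of_corners fun m => ?_).symm
      by_contra h3
      push Not at h3
      have h4 := key (τ.corner m)
      rw [Finset.sum_eq_zero (s := Finset.univ) (f := fun j => if τ'.corner j = τ.corner m then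
        baryOf w' j else 0) (fun j _ => if_neg (h3 j).symm)] at h4
      simp [τ.corner_injective.eq_iff] at h4
      exact (baryOf_pos hw hpos m).ne' h4
    have h1 := aux hw hw' key hττ
    have h2 := aux hw' hw (fun g => (key g).symm) (Ne.symm hττ)
    refine ⟨h1, h2, fun g => ?_⟩
    have := key g
    have e1 : ∀ j, baryOf w j = w (c j) := fun j => by rw [baryOf_eq, h1.1, h1.2, h1.2, h1.2, h1.2]; ring
    have e2 : ∀ j, baryOf w' j = w' (c j) := fun j => by
      rw [baryOf_eq, h2.1, h2.2, h2.2, h2.2, h2.2]; ring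
    simpa only [e1, e2] using this

/-- Points of the surface with the same flat projection are equal. -/
theorem sum_coord_eq_of_flat_eq {τ τ' : Tile k} {f f' : HatFace} {w w' : HatVertex → ℝ}
    (hw : IsFaceWeight f w) (hw' : IsFaceWeight f' w')
    (h : τ.flat (baryOf w) = τ'.flat (baryOf w')) :
    ∑ v, w v • τ.coord v = ∑ v, w' v • τ'.coord v := by
  rcases weights_unique hw hw' h with ⟨rfl, rfl⟩ | ⟨h1, h2, -⟩
  · rfl
  · rw [sum_smul_coord _ hw.sum, sum_smul_coord _ hw'.sum, h]
    have : ∀ w : HatVertex → ℝ, (w o = 0 ∧ ∀ j, w (x j) = 0) → ∑ v, w v * v.height = 0 := by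
      intro w hw
      rw [HatVertex.sum_univ, hw.1, hw.2, hw.2, hw.2]
      simp [HatVertex.height]
    rw [this w h1, this w' h2, zero_smul, zero_smul]

theorem exists_vertex_of_flat_eq {τ τ' : Tile k} {f f' : HatFace} {w w' : HatVertex → ℝ}
    (hw : IsFaceWeight f w) (hw' : IsFaceWeight f' w')
    (h : τ.flat (baryOf w) = τ'.flat (baryOf w')) {v : HatVertex} (hv : w v ≠ 0) :
    ∃ v' ∈ f'.verts, τ'.pt v' = τ.pt v ∧
      ((τ' = τ ∧ v' = v) ∨ ∃ j j', v = c j ∧ v' = c j' ∧ τ'.corner j' = τ.corner j) := by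
  have mem : ∀ {f : HatFace} {w}, IsFaceWeight f w → ∀ {v}, w v ≠ 0 → v ∈ f.verts :=
    fun hw v hv => by by_contra hn; exact hv (hw.support _ hn)
  rcases weights_unique hw hw' h with ⟨rfl, rfl⟩ | ⟨h1, h2, h3⟩
  · exact ⟨v, mem hw' hv, rfl, Or.inl ⟨rfl, rfl⟩⟩
  · rcases v with j | j | _
    · have := h3 (τ.corner j)
      simp only [τ.corner_injective.eq_iff, Finset.sum_ite_eq', Finset.mem_univ, if_true] at this
      rw [this] at hv
      obtain ⟨j', -, hj'⟩ := Finset.exists_ne_zero_of_sum_ne_zero hv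
      have hcj : τ'.corner j' = τ.corner j := by
        by_contra hne; rw [if_neg hne] at hj'; exact hj' rfl
      rw [if_pos hcj] at hj'
      exact ⟨c j', mem hw' hj', by rw [pt, pt, coord_corner, coord_corner, hcj],
        Or.inr ⟨j, j', rfl, rfl, hcj⟩⟩
    · exact absurd (h1.2 j) hv
    · exact absurd h1.1 hv

end Tile

/-- The projection of the outward prisms over the faces to the faces, in barycentric
coordinates. -/
noncomputable def pushDown (X : Fin 4 → ℝ) : Fin 4 → ℝ :=
  fun j => max (X j) 0 + (∑ i, min (X i) 0 - min (X j) 0) / 3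

/-- Above face `i` only coordinate `i` can be negative; it equals -h, and each of the others has
gained h/3. Truncating at 0 and subtracting a third of the negative part undoes the shift, without
reference to which face is meant. -/
theorem pushDown_add_outward {y : Fin 4 → ℝ} {i : Fin 4} {h : ℝ} (hi : y i = 0)
    (hy : ∀ l, 0 ≤ y l) (hh : 0 ≤ h) : pushDown (y + h • outward i) = y := by
  have hsum : ∑ l, min ((y + h • outward i) l) 0 = -h := by
    rw [Fin.sum_univ_succAbove _ i, Finset.sum_eq_zero]
    · simp [hi, outward, hh]
    · intro j _
      simp only [Pi.add_apply, Pi.smul_apply, smul_eq_mul, outward, Fin.succAbove_ne, if_false]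
      exact min_eq_right (by linarith [hy (i.succAbove j)])
  funext l
  simp only [pushDown, hsum]
  rcases Fin.eq_self_or_eq_succAbove i l with rfl | ⟨j, rfl⟩
  · simp [hi, outward, hh]
  · simp only [Pi.add_apply, Pi.smul_apply, smul_eq_mul, outward, Fin.succAbove_ne, if_false]
    have := hy (i.succAbove j)
    rw [max_eq_left (by linarith), min_eq_right (by linarith)]
    ring

theorem continuous_pushDown : Continuous pushDown := by
  unfold pushDown; fun_prop

theorem HatVertex.exists_face : ∀ v : HatVertex, ∃ f : HatFace, v ∈ f.verts := by decide

theorem isFaceWeight_single {f : HatFace} {v : HatVertex} (hv : v ∈ f.verts) :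
    IsFaceWeight f (Pi.single v 1) where
  nonneg u := by
    rcases eq_or_ne u v with rfl | h
    · simp
    · simp [h]
  sum := by simp
  support u hu := by rw [Pi.single_eq_of_ne]; rintro rfl; exact hu hv

namespace Tile

variable {k : ℕ}

theorem flat_nonneg (τ : Tile k) {a : Fin 3 → ℝ} (ha : ∀ j, 0 ≤ a j) (hs : ∑ j, a j = 1)
    (l : Fin 4) : 0 ≤ τ.flat a l := by
  have h0 : (0 : ℝ) ≤ τ.b l := by exact_mod_cast τ.nonneg l
  rcases Fin.eq_self_or_eq_succAbove τ.i l with rfl | ⟨j, rfl⟩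
  · rw [flat_i]
  · rw [flat_succAbove]
    have h1 : a j ≤ 1 := by
      rw [← hs]; exact Finset.single_le_sum (fun j _ => ha j) (Finset.mem_univ j)
    rcases τ.sgn_eq with h | h
    · rw [h.2]; push_cast; linarith [ha j]
    · have := τ.pos h.1 (τ.i.succAbove j) (Fin.succAbove_ne _ _)
      have h2 : (1 : ℝ) ≤ τ.b (τ.i.succAbove j) := by exact_mod_cast this
      rw [h.2]; push_cast; linarith

theorem pushDown_sum_coord (τ : Tile k) {f : HatFace} {w : HatVertex → ℝ} (hw : IsFaceWeight f w) :
    pushDown (∑ v, w v • τ.coord v) = τ.flat (baryOf w) := by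
  rw [sum_smul_coord _ hw.sum]
  exact pushDown_add_outward (flat_i _ _) (τ.flat_nonneg (baryOf_nonneg hw) (sum_baryOf hw))
    (Finset.sum_nonneg fun v _ => mul_nonneg (hw.nonneg v) v.height_nonneg)

theorem sum_sum_coord (τ : Tile k) {w : HatVertex → ℝ} (hw : ∑ v, w v = 1) :
    ∑ l, (∑ v, w v • τ.coord v) l = k := by
  simp only [Finset.sum_apply, Pi.smul_apply, smul_eq_mul]
  rw [Finset.sum_comm]
  simp only [← Finset.mul_sum, sum_coord, ← Finset.sum_mul, hw, one_mul]

theorem sum_smul_pt (τ : Tile k) (w : HatVertex → ℝ) :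
    ∑ v, w v • τ.pt v = tetraPoint k (∑ v, w v • τ.coord v) :=
  sum_smul_tetraPoint _ _ _ _

/-- This reduces coincidences in space to coincidences on the flat boundary: `pushDown` is one map
for all hats, so equal points have equal flat projections. -/
theorem flat_eq_of_sum_eq (hk : 1 ≤ k) {τ τ' : Tile k} {f f' : HatFace} {w w' : HatVertex → ℝ}
    (hw : IsFaceWeight f w) (hw' : IsFaceWeight f' w')
    (h : ∑ v, w v • τ.pt v = ∑ v, w' v • τ'.pt v) : τ.flat (baryOf w) = τ'.flat (baryOf w') := by
  rw [sum_smul_pt, sum_smul_pt] at h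
  have := tetraPoint_injective hk (τ.sum_sum_coord hw.sum) (τ'.sum_sum_coord hw'.sum) h
  rw [← τ.pushDown_sum_coord hw, ← τ'.pushDown_sum_coord hw', this]

theorem pt_eq (hk : 1 ≤ k) {τ τ' : Tile k} {v v' : HatVertex} (h : τ.pt v = τ'.pt v') :
    (τ' = τ ∧ v' = v) ∨ ∃ j j', v = c j ∧ v' = c j' ∧ τ'.corner j' = τ.corner j := by
  obtain ⟨f, hf⟩ := v.exists_face
  obtain ⟨f', hf'⟩ := v'.exists_face
  have hw := isFaceWeight_single hf
  have hw' := isFaceWeight_single hf'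
  have hfl := flat_eq_of_sum_eq hk (τ := τ) (τ' := τ') hw hw' (by
    simp only [Pi.single_apply, ite_smul, one_smul, zero_smul, Finset.sum_ite_eq', Finset.mem_univ,
      if_true, h])
  rcases weights_unique hw hw' hfl with ⟨rfl, hww⟩ | ⟨h1, h2, h3⟩
  · left
    refine ⟨rfl, ?_⟩
    by_contra hne
    have := congrFun hww v'
    rw [Pi.single_eq_of_ne hne, Pi.single_eq_same] at this
    exact zero_ne_one this
  · right
    rcases v with j | j | _
    · rcases v' with j' | j' | _
      · refine ⟨j, j', rfl, rfl, ?_⟩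
        by_contra hne
        have := h3 (τ.corner j)
        rw [Finset.sum_eq_single j (by
          intro b _ hb; rw [if_neg]; exact fun h => hb (τ.corner_injective h)) (by simp), if_pos rfl,
          Pi.single_eq_same, Finset.sum_eq_zero] at this
        · exact one_ne_zero this
        · intro b _
          split_ifs with hb
          · rw [Pi.single_eq_of_ne]
            intro hbj
            rw [c.injEq] at hbj
            subst hbj
            exact hne hb
          · rfl
      · have := h2.2 j'; rw [Pi.single_eq_same] at this; exact absurd this one_ne_zero
      · have := h2.1; rw [Pi.single_eq_same] at this; exact absurd this one_ne_zero
    · have := h1.2 j; rw [Pi.single_eq_same] at this; exact absurd this one_ne_zero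
    · have := h1.1; rw [Pi.single_eq_same] at this; exact absurd this one_ne_zero

theorem pt_injective (hk : 1 ≤ k) (τ : Tile k) : Function.Injective τ.pt := by
  intro v v' h
  rcases pt_eq hk h with ⟨-, h'⟩ | ⟨j, j', rfl, rfl, h'⟩
  · exact h'.symm
  · rw [τ.corner_injective h']

open Classical in
/-- The vertex set of a face of the hat over a small triangle. -/
noncomputable def face (τ : Tile k) (f : HatFace) : Finset E3 := f.verts.image τ.pt

theorem mem_face {τ : Tile k} {f : HatFace} {p : E3} : p ∈ τ.face f ↔ ∃ v ∈ f.verts, τ.pt v = p := by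
  simp [face]

theorem pt_mem_face {τ : Tile k} {f : HatFace} {v : HatVertex} (hv : v ∈ f.verts) :
    τ.pt v ∈ τ.face f := mem_face.2 ⟨v, hv, rfl⟩

theorem pt_mem_face_iff (hk : 1 ≤ k) {τ : Tile k} {f : HatFace} {v : HatVertex} :
    τ.pt v ∈ τ.face f ↔ v ∈ f.verts := by
  refine ⟨fun h => ?_, pt_mem_face⟩
  obtain ⟨u, hu, h⟩ := mem_face.1 h
  rwa [← τ.pt_injective hk h]

theorem coe_face (τ : Tile k) (f : HatFace) : (τ.face f : Set E3) = τ.pt '' f.verts := by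
  ext p; simp [face]

theorem mem_convexHull_face (hk : 1 ≤ k) {τ : Tile k} {f : HatFace} {p : E3} :
    p ∈ convexHull ℝ (τ.face f : Set E3) ↔ ∃ w, IsFaceWeight f w ∧ ∑ v, w v • τ.pt v = p := by
  classical
  constructor
  · intro h
    obtain ⟨w, h0, h1, h2⟩ := Finset.mem_convexHull'.1 h
    have inj : ∀ v ∈ f.verts, ∀ u ∈ f.verts, τ.pt v = τ.pt u → v = u :=
      fun v _ u _ h => τ.pt_injective hk h
    refine ⟨fun v => if v ∈ f.verts then w (τ.pt v) else 0, ⟨fun v => ?_, ?_, fun v hv => if_neg hv⟩,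
      ?_⟩
    · split_ifs with hv
      · exact h0 _ (pt_mem_face hv)
      · exact le_rfl
    · rw [Finset.sum_ite_mem, Finset.univ_inter, ← h1, face, Finset.sum_image inj]
    · simp only [ite_smul, zero_smul]
      rw [Finset.sum_ite_mem, Finset.univ_inter, ← h2, face, Finset.sum_image inj]
  · rintro ⟨w, hw, rfl⟩
    have hsum : ∑ v ∈ f.verts, w v = 1 := by
      rw [← hw.sum]
      exact Finset.sum_subset (Finset.subset_univ _) fun v _ hv => hw.support v hv
    have hpt : ∑ v ∈ f.verts, w v • τ.pt v = ∑ v, w v • τ.pt v :=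
      Finset.sum_subset (Finset.subset_univ _) fun v _ hv => by rw [hw.support v hv, zero_smul]
    rw [← hpt]
    exact (convex_convexHull ℝ _).sum_mem (fun v _ => hw.nonneg v) hsum
      fun v hv => subset_convexHull ℝ _ (pt_mem_face hv)

/-- Distinct convex combinations of the vertices of a face are distinct points. -/
theorem weights_eq_of_sum_eq (hk : 1 ≤ k) {τ : Tile k} {f : HatFace} {w w' : HatVertex → ℝ}
    (hw : IsFaceWeight f w) (hw' : IsFaceWeight f w')
    (h : ∑ v, w v • τ.pt v = ∑ v, w' v • τ.pt v) : w = w' := by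
  have hfl := flat_eq_of_sum_eq hk hw hw' h
  refine hw.ext_of_baryOf hw' (funext fun j => ?_)
  have := congrFun hfl (τ.i.succAbove j)
  rw [flat_succAbove, flat_succAbove] at this
  have h2 : (τ.sgn : ℝ) ≠ 0 := by rcases τ.sgn_eq with h | h <;> rw [h.2] <;> norm_num
  exact mul_left_cancel₀ h2 (by linarith)

theorem card_face (hk : 1 ≤ k) (τ : Tile k) (f : HatFace) : (τ.face f).card = 3 := by
  rw [face, Finset.card_image_of_injective _ (τ.pt_injective hk)]
  revert f; decide

/-- An affine dependence could be added, in small multiples, to the weights of the barycentre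
without moving the point, which contradicts uniqueness of weights. -/
theorem affineIndependent_face (hk : 1 ≤ k) (τ : Tile k) (f : HatFace) :
    AffineIndependent ℝ (fun v : τ.face f => (v : E3)) := by
  have hcard : f.verts.card = 3 := by revert f; decide
  have main : AffineIndependent ℝ (fun v : f.verts => τ.pt v) := by
    rw [affineIndependent_iff]
    intro s w h0 h1 v hv
    obtain ⟨W, hW⟩ : ∃ W : HatVertex → ℝ,
        W = fun v => if h : v ∈ f.verts then (if ⟨v, h⟩ ∈ s then w ⟨v, h⟩ else 0) else 0 := ⟨_, rfl⟩
    have hsupp : ∀ v ∉ f.verts, W v = 0 := fun v hv => by rw [hW]; exact dif_neg hv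
    have hval : ∀ v : f.verts, W v = if v ∈ s then w v else 0 := fun v => by
      rw [hW]; exact dif_pos v.2
    have hW0 : ∑ v, W v = 0 := by
      rw [← Finset.sum_subset (Finset.subset_univ f.verts) fun v _ hv => hsupp v hv,
        ← Finset.sum_coe_sort]
      simp only [hval]
      rw [Finset.sum_ite_mem, Finset.univ_inter, h0]
    have hW1 : ∑ v, W v • τ.pt v = 0 := by
      rw [← Finset.sum_subset (Finset.subset_univ f.verts) fun v _ hv => by
        rw [hsupp v hv, zero_smul], ← Finset.sum_coe_sort f.verts (fun v => W v • τ.pt v)]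
      simp only [hval, ite_smul, zero_smul]
      rw [Finset.sum_ite_mem, Finset.univ_inter, h1]
    -- The bound 1/3 is the barycentric weight, so the perturbed weights stay nonnegative.
    obtain ⟨ε, hε, hb⟩ : ∃ ε > 0, ∀ v, ε * |W v| ≤ 1 / 3 := by
      obtain ⟨B, hB⟩ := (Set.finite_range fun v => |W v|).bddAbove
      have hB0 : 0 ≤ B := (abs_nonneg (W o)).trans (hB ⟨o, rfl⟩)
      refine ⟨1 / (3 * (B + 1)), by positivity, fun v => ?_⟩
      have : |W v| ≤ B + 1 := (hB ⟨v, rfl⟩).trans (by linarith)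
      rw [div_mul_eq_mul_div, div_le_div_iff₀ (by positivity) (by norm_num)]
      linarith
    obtain ⟨u, hu⟩ : ∃ u : HatVertex → ℝ, u = fun v => if v ∈ f.verts then 1 / 3 else 0 := ⟨_, rfl⟩
    have hu1 : ∑ v, u v = 1 := by
      rw [hu, Finset.sum_ite_mem, Finset.univ_inter, Finset.sum_const, hcard]; norm_num
    have hfw : IsFaceWeight f u := ⟨fun v => by rw [hu]; dsimp only; split_ifs <;> norm_num, hu1,
      fun v hv => by rw [hu]; exact if_neg hv⟩
    have hfw' : IsFaceWeight f (u + ε • W) := by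
      refine ⟨fun v => ?_, ?_, fun v hv => ?_⟩
      · by_cases hv : v ∈ f.verts
        · have h1 := hb v
          have h2 := neg_abs_le (W v)
          simp only [hu, Pi.add_apply, Pi.smul_apply, smul_eq_mul, hv, if_true]
          nlinarith
        · simp [hu, hv, hsupp v hv]
      · simp [Finset.sum_add_distrib, hu1, ← Finset.mul_sum, hW0]
      · simp [hu, hv, hsupp v hv]
    have heq := weights_eq_of_sum_eq hk (τ := τ) hfw hfw' (by
      simp [add_smul, Finset.sum_add_distrib, mul_smul, ← Finset.smul_sum, hW1])
    have := congrFun heq v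
    simp only [Pi.add_apply, Pi.smul_apply, smul_eq_mul, left_eq_add, mul_eq_zero, hε.ne',
      false_or, hval, hv, if_true] at this
    exact this
  have := main.range
  have hset : Set.range (fun v : f.verts => τ.pt v) = (τ.face f : Set E3) := by
    ext p; simp [mem_face]
  rw [hset] at this
  exact this

/-- By `exists_vertex_of_flat_eq`, every vertex that carries positive weight at a common point is a
vertex of both faces. -/
theorem convexHull_inter_face (hk : 1 ≤ k) (τ τ' : Tile k) (f f' : HatFace) :
    convexHull ℝ (τ.face f : Set E3) ∩ convexHull ℝ (τ'.face f' : Set E3) =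
      convexHull ℝ ((τ.face f : Set E3) ∩ τ'.face f') := by
  refine subset_antisymm ?_ (Set.subset_inter (convexHull_mono Set.inter_subset_left)
    (convexHull_mono Set.inter_subset_right))
  rintro p ⟨hp, hp'⟩
  obtain ⟨w, hw, h⟩ := (mem_convexHull_face hk).1 hp
  obtain ⟨w', hw', h'⟩ := (mem_convexHull_face hk).1 hp'
  have hfl := flat_eq_of_sum_eq hk hw hw' (h.trans h'.symm)
  have hs : ∀ v ∈ (Finset.univ : Finset HatVertex), v ∉ Finset.univ.filter (w · ≠ 0) → w v = 0 := by
    intro v _ hv; simpa using hv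
  rw [← h, ← Finset.sum_subset (Finset.subset_univ (Finset.univ.filter (w · ≠ 0)))
    fun v h1 h2 => by rw [hs v h1 h2, zero_smul]]
  refine (convex_convexHull ℝ _).sum_mem (fun v _ => hw.nonneg v) ?_ fun v hv => ?_
  · rw [Finset.sum_subset (Finset.subset_univ _) hs, hw.sum]
  · have hv : w v ≠ 0 := by simpa using hv
    obtain ⟨v', hv', hpt, -⟩ := exists_vertex_of_flat_eq hw hw' hfl hv
    have hvf : v ∈ f.verts := by by_contra hn; exact hv (hw.support _ hn)
    exact subset_convexHull ℝ _ ⟨pt_mem_face hvf, by rw [← hpt]; exact pt_mem_face hv'⟩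

end Tile

/-! ### The polyhedron -/

/-- The three points of `s` already span the plane of `s ∪ t`, so an affine function vanishing on
`s` would vanish on `t` as well. -/
theorem not_coplanar_of_affineMap {s t : Set E3} (hs : AffineIndependent ℝ (fun v : s => (v : E3)))
    (hcard : s.ncard = 3) (g : E3 →ᵃ[ℝ] ℝ) (hg : ∀ p ∈ s, g p = 0) {p : E3} (hp : p ∈ t)
    (hgp : g p ≠ 0) : ¬ Coplanar ℝ (s ∪ t) := by
  intro hco
  have hfin : s.Finite := Set.finite_of_ncard_ne_zero (by omega)
  have := hfin.fintype
  have h1 : Module.finrank ℝ (vectorSpan ℝ s) = 2 := by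
    have := hs.finrank_vectorSpan (n := 2) (by
      rw [← Nat.card_eq_fintype_card]; exact hcard)
    rwa [Subtype.range_coe] at this
  have h2 : Module.finrank ℝ (vectorSpan ℝ (s ∪ t)) ≤ 2 := coplanar_iff_finrank_le_two.1 hco
  have heq := Submodule.eq_of_le_of_finrank_le (vectorSpan_mono ℝ (Set.subset_union_left (t := t)))
    (h2.trans h1.ge)
  obtain ⟨a, ha⟩ : s.Nonempty := by
    rw [← Set.ncard_pos hfin]; omega
  have hmem : p - a ∈ vectorSpan ℝ s := by
    rw [heq]
    exact vsub_mem_vectorSpan ℝ (Or.inr hp) (Or.inl ha)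
  have hle : vectorSpan ℝ s ≤ LinearMap.ker g.linear := by
    rw [vectorSpan_def, Submodule.span_le]
    rintro _ ⟨u, hu, v, hv, rfl⟩
    rw [SetLike.mem_coe, LinearMap.mem_ker, AffineMap.linearMap_vsub, hg u hu, hg v hv, vsub_self]
  have h3 := hle hmem
  rw [LinearMap.mem_ker, ← vsub_eq_sub, AffineMap.linearMap_vsub, hg a ha] at h3
  simp at h3
  exact hgp h3

theorem fin_three_ne_add_one : ∀ j : Fin 3, j ≠ j + 1 := by decide

theorem fin_three_ne_add_two : ∀ j : Fin 3, j ≠ j + 2 := by decide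

theorem exists_fin_three_ne : ∀ m n : Fin 3, ∃ j, m ≠ j ∧ n ≠ j := by decide

theorem HatFace.eq_of_verts_eq : ∀ f g : HatFace, f.verts = g.verts → f = g := by decide

theorem HatFace.exists_inner : ∀ f : HatFace, ∃ v ∈ f.verts, ∀ j, v ≠ c j := by decide

theorem HatFace.exists_neighbour : ∀ f : HatFace, ∀ u ∈ f.verts, ∀ v ∈ f.verts, u ≠ v →
    (∃ j m n, f = brim j ∧ m ≠ n ∧ m ≠ j ∧ n ≠ j ∧ u = c m ∧ v = c n) ∨
    ((∀ j, u ≠ c j) ∨ ∀ j, v ≠ c j) ∧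
      ∃ g, g ≠ f ∧ ∀ h : HatFace, (u ∈ h.verts ∧ v ∈ h.verts) ↔ h = f ∨ h = g := by decide

theorem HatFace.eq_brim : ∀ f : HatFace, ∀ m n, m ≠ n → c m ∈ f.verts → c n ∈ f.verts →
    ∀ j, m ≠ j → n ≠ j → f = brim j := by decide

/-! ### Edges shared by faces, and non-coplanarity. -/

namespace Tile

variable {k : ℕ}

theorem face_eq_iff (hk : 1 ≤ k) {τ τ' : Tile k} {f f' : HatFace} :
    τ.face f = τ'.face f' ↔ τ = τ' ∧ f = f' := by
  refine ⟨fun h => ?_, by rintro ⟨rfl, rfl⟩; rfl⟩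
  obtain ⟨v, hv, hvc⟩ := f.exists_inner
  have h1 := pt_mem_face (τ := τ) hv
  rw [h] at h1
  obtain ⟨v', -, h2⟩ := mem_face.1 h1
  have hτ : τ = τ' := by
    rcases pt_eq hk h2 with ⟨h, -⟩ | ⟨j, j', -, h3, -⟩
    · exact h
    · exact absurd h3 (hvc _)
  subst hτ
  refine ⟨rfl, HatFace.eq_of_verts_eq _ _ (Finset.ext fun v => ?_)⟩
  rw [← pt_mem_face_iff hk (τ := τ), h, pt_mem_face_iff hk]

/-- An inner vertex lies only on faces of its own hat. -/
theorem pt_mem_face_of_inner (hk : 1 ≤ k) {τ σ : Tile k} {g : HatFace} {v : HatVertex}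
    (hv : ∀ j, v ≠ c j) (h : τ.pt v ∈ σ.face g) : σ = τ := by
  obtain ⟨v', -, h2⟩ := mem_face.1 h
  rcases pt_eq hk h2 with ⟨h, -⟩ | ⟨j, j', -, h3, -⟩
  · exact h.symm
  · exact absurd h3 (hv _)

theorem exists_corner_of_mem_face (hk : 1 ≤ k) {τ σ : Tile k} {g : HatFace} {m : Fin 3}
    (h : τ.pt (c m) ∈ σ.face g) : ∃ m', c m' ∈ g.verts ∧ τ.corner m = σ.corner m' := by
  obtain ⟨v', hv, h2⟩ := mem_face.1 h
  rcases pt_eq hk h2 with ⟨rfl, rfl⟩ | ⟨j, j', rfl, h3, h4⟩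
  · exact ⟨m, hv, rfl⟩
  · rw [c.injEq] at h3
    subst h3
    exact ⟨j, hv, h4⟩

theorem pt_corner_eq {τ σ : Tile k} {m m' : Fin 3} (h : τ.corner m = σ.corner m') :
    τ.pt (c m) = σ.pt (c m') := by
  rw [pt, pt, coord_corner, coord_corner, h]

/-- Across a grid edge lie exactly the brim faces of the two hats. -/
theorem exists_opposite_brim (hk : 1 ≤ k) (τ : Tile k) (j : Fin 3) :
    ∃ τ' j', τ.Opposite j τ' ∧ ((τ'.i = τ.i ∧ j' = j) ∨ τ'.i.succAbove j' = τ.i) ∧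
      ∀ m n, m ≠ n → m ≠ j → n ≠ j → ∀ σ g, (τ.pt (c m) ∈ σ.face g ∧ τ.pt (c n) ∈ σ.face g) ↔
        (σ = τ ∧ g = brim j) ∨ (σ = τ' ∧ g = brim j') := by
  obtain ⟨τ', h⟩ := τ.exists_opposite j
  obtain ⟨j', h1, h2⟩ := h.exists_corner
  refine ⟨τ', j', h, h2, fun m n hmn hm hn σ g => ⟨?_, ?_⟩⟩
  · rintro ⟨h3, h4⟩
    obtain ⟨m', hm', h5⟩ := exists_corner_of_mem_face hk h3
    obtain ⟨n', hn', h6⟩ := exists_corner_of_mem_face hk h4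
    have hmn' : m' ≠ n' := by
      rintro rfl; exact hmn (τ.corner_injective (h5.trans h6.symm))
    rcases eq_or_opposite hm hn hmn h5 h6 with rfl | hσ
    · left
      have e1 := σ.corner_injective h5
      have e2 := σ.corner_injective h6
      subst e1 e2
      exact ⟨rfl, g.eq_brim _ _ hmn hm' hn' j hm hn⟩
    · right
      have e := opposite_unique hσ h
      subst e
      obtain ⟨m1, hm1, e1⟩ := h1 m hm
      obtain ⟨n1, hn1, e2⟩ := h1 n hn
      rw [σ.corner_injective (h5.symm.trans e1)] at hm' hmn'
      rw [σ.corner_injective (h6.symm.trans e2)] at hn' hmn'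
      exact ⟨rfl, g.eq_brim _ _ hmn' hm' hn' j' hm1 hn1⟩
  · have mem : ∀ m j : Fin 3, m ≠ j → c m ∈ (brim j).verts := by decide
    rintro (⟨rfl, rfl⟩ | ⟨rfl, rfl⟩)
    · exact ⟨pt_mem_face (mem _ _ hm), pt_mem_face (mem _ _ hn)⟩
    · obtain ⟨m1, hm1, e1⟩ := h1 m hm
      obtain ⟨n1, hn1, e2⟩ := h1 n hn
      rw [pt_corner_eq e1, pt_corner_eq e2]
      exact ⟨pt_mem_face (mem _ _ hm1), pt_mem_face (mem _ _ hn1)⟩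

/-- An edge either joins two corners and is a grid edge, shared by two brims of different hats, or
has an inner endpoint or the centre, and then both its faces lie in one hat. -/
theorem exists_neighbour (hk : 1 ≤ k) (τ : Tile k) (f : HatFace) {u v : HatVertex}
    (hu : u ∈ f.verts) (hv : v ∈ f.verts) (huv : u ≠ v) : ∃ τ' f', ¬ (τ' = τ ∧ f' = f) ∧
      ∀ σ g, (τ.pt u ∈ σ.face g ∧ τ.pt v ∈ σ.face g) ↔ (σ = τ ∧ g = f) ∨ (σ = τ' ∧ g = f') := by
  rcases f.exists_neighbour u hu v hv huv with ⟨j, m, n, rfl, hmn, hm, hn, rfl, rfl⟩ | ⟨h, g, hg, hh⟩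
  · obtain ⟨τ', j', h1, -, h2⟩ := τ.exists_opposite_brim hk j
    exact ⟨τ', brim j', fun h => h1.ne h.1, h2 m n hmn hm hn⟩
  · refine ⟨τ, g, fun h => hg h.2, fun σ h' => ⟨?_, ?_⟩⟩
    · rintro ⟨h1, h2⟩
      have hσ : σ = τ := by
        rcases h with h | h
        · exact pt_mem_face_of_inner hk h h1
        · exact pt_mem_face_of_inner hk h h2
      subst hσ
      rw [pt_mem_face_iff hk] at h1 h2
      exact ((hh h').1 ⟨h1, h2⟩).imp (fun h => ⟨rfl, h⟩) fun h => ⟨rfl, h⟩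
    · rintro (⟨rfl, h1⟩ | ⟨rfl, h1⟩)
      · rw [pt_mem_face_iff hk, pt_mem_face_iff hk]; exact (hh _).2 (Or.inl h1)
      · rw [pt_mem_face_iff hk, pt_mem_face_iff hk]; exact (hh _).2 (Or.inr h1)

/-- The affine function `A a + B h + C` in terms of the `j`-th barycentric coordinate `a` of the
projection to the small triangle and the height `h` above it. -/
noncomputable def affineFun (τ : Tile k) (j : Fin 3) (A B C : ℝ) : E3 →ᵃ[ℝ] ℝ :=
  (A * τ.sgn) • (tetraCoord k (τ.i.succAbove j) + (1 / 3 : ℝ) • tetraCoord k τ.i) -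
    B • tetraCoord k τ.i + AffineMap.const ℝ E3 (C - A * τ.sgn * τ.b (τ.i.succAbove j))

theorem affineFun_apply (τ : Tile k) (j : Fin 3) (A B C : ℝ) (p : E3) : τ.affineFun j A B C p =
    A * τ.sgn * (tetraCoord k (τ.i.succAbove j) p + tetraCoord k τ.i p / 3 -
      τ.b (τ.i.succAbove j)) - B * tetraCoord k τ.i p + C := by
  simp only [affineFun, AffineMap.coe_add, AffineMap.coe_sub, AffineMap.coe_smul, Pi.add_apply,
    Pi.sub_apply, Pi.smul_apply, smul_eq_mul, AffineMap.const_apply]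
  ring

theorem tetraCoord_pt (hk : 1 ≤ k) (τ : Tile k) (v : HatVertex) (l : Fin 4) :
    tetraCoord k l (τ.pt v) = τ.coord v l :=
  tetraCoord_tetraPoint hk (τ.sum_coord v) l

theorem affineFun_pt (hk : 1 ≤ k) (τ : Tile k) (j : Fin 3) (A B C : ℝ) (v : HatVertex) :
    τ.affineFun j A B C (τ.pt v) = A * v.bary j + B * v.height + C := by
  rw [affineFun_apply, tetraCoord_pt hk, tetraCoord_pt hk, coord_i, coord_succAbove]
  have : (τ.sgn : ℝ) * τ.sgn = 1 := by rcases τ.sgn_eq with h | h <;> rw [h.2] <;> norm_num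
  linear_combination A * v.bary j * this

/-- The function vanishes on the plane of brim `j`. On the same face the neighbouring inner vertex
is the mirror image across the grid edge, with value -(22/50) times the height. Around an edge of
the tetrahedron the value is negative because the height exceeds 1/2. -/
theorem affineFun_opposite_ne_zero (hk : 1 ≤ k) {τ τ' : Tile k} {j j' : Fin 3}
    (h : τ.Opposite j τ') (hj : (τ'.i = τ.i ∧ j' = j) ∨ τ'.i.succAbove j' = τ.i) :
    τ.affineFun j innerHeight (-(11 / 50)) 0 (τ'.pt (x j')) ≠ 0 := by
  have h1 := lt_innerHeight
  have h2 := innerHeight_lt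
  have hb : ∀ j, (x j).bary j = 11 / 50 := fun j => if_pos rfl
  have hh : ∀ j, (x j).height = innerHeight := fun j => rfl
  rw [affineFun_apply, tetraCoord_pt hk, tetraCoord_pt hk]
  rcases h with ⟨hi, hu, hbb⟩ | ⟨hu, hu', hr, hbb, hi⟩
  · have hj' : j' = j := by
      rcases hj with hj | hj
      · exact hj.2
      · rw [hi] at hj; exact absurd hj (Fin.succAbove_ne _ _)
    subst hj'
    have e1 := τ'.coord_i (x j')
    have e2 := τ'.coord_succAbove (x j') j'
    rw [hi] at e1 e2
    have hs : (τ'.sgn : ℝ) = -τ.sgn := by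
      have : τ'.sgn = -τ.sgn := by unfold sgn; rw [hu]; cases τ.up <;> simp
      rw [this]; push_cast; ring
    have : (τ.sgn : ℝ) * τ.sgn = 1 := by rcases τ.sgn_eq with h | h <;> rw [h.2] <;> norm_num
    rw [e1, e2, hbb, if_pos (Or.inr rfl), hs, hb, hh]
    push_cast
    have e : innerHeight * (τ.sgn : ℝ) * ((τ.b (τ.i.succAbove j') + 0) + -τ.sgn * (11 / 50) +
        innerHeight / 3 + -innerHeight / 3 - τ.b (τ.i.succAbove j')) - -(11 / 50) * -innerHeight + 0
        = -(22 / 50) * innerHeight := by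
      linear_combination (-(11 / 50) * innerHeight) * this
    rw [e]
    nlinarith
  · have hj' : τ'.i.succAbove j' = τ.i := by
      rcases hj with hj | hj
      · rw [hj.1] at hi; exact absurd hi.symm (Fin.succAbove_ne _ _)
      · exact hj
    have e1 := τ'.coord_i (x j')
    have e2 := τ'.coord_succAbove (x j') j'
    rw [hi] at e1
    rw [hj', hbb, τ.b_i, hb, hh] at e2
    have hs : τ.sgn = 1 := by simp [sgn, hu]
    have hs' : τ'.sgn = 1 := by simp [sgn, hu']
    rw [e1, e2, hs, hs', hr, hh]
    push_cast
    nlinarith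

theorem not_coplanar_of_affineFun (hk : 1 ≤ k) {τ : Tile k} {f : HatFace} {t : Set E3}
    (j : Fin 3) (A B C : ℝ) (h : ∀ v ∈ f.verts, A * v.bary j + B * v.height + C = 0) {p : E3}
    (hp : p ∈ t) (hne : τ.affineFun j A B C p ≠ 0) : ¬ Coplanar ℝ ((τ.face f : Set E3) ∪ t) := by
  refine not_coplanar_of_affineMap (τ.affineIndependent_face hk f)
    (by rw [Set.ncard_coe_finset]; exact τ.card_face hk f) (τ.affineFun j A B C) ?_ hp hne
  intro q hq
  obtain ⟨v, hv, rfl⟩ := mem_face.1 hq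
  rw [affineFun_pt hk]
  exact h v hv

theorem not_coplanar_brim (hk : 1 ≤ k) {τ : Tile k} {j : Fin 3} {t : Set E3} {p : E3}
    (hp : p ∈ t) (hne : τ.affineFun j innerHeight (-(11 / 50)) 0 p ≠ 0) :
    ¬ Coplanar ℝ ((τ.face (brim j) : Set E3) ∪ t) := by
  refine not_coplanar_of_affineFun hk j _ _ _ (fun v hv => ?_) hp hne
  simp only [HatFace.verts, Finset.mem_insert, Finset.mem_singleton] at hv
  have h1 := fin_three_ne_add_one j
  have h2 := fin_three_ne_add_two j
  rcases hv with rfl | rfl | rfl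
  · simp [HatVertex.bary, HatVertex.height, h1]
  · simp [HatVertex.bary, HatVertex.height, h2]
  · simp [HatVertex.bary, HatVertex.height]; ring

/-- Up to order, faces sharing an edge are a brim and a band, a band and its crown, or two crowns.
In each case an affine function in one barycentric coordinate and the height vanishes on the first
face and is nonzero at a vertex of the second. -/
theorem not_coplanar_hat (hk : 1 ≤ k) {τ : Tile k} {f g : HatFace} (hfg : f ≠ g)
    {u v : HatVertex} (huv : u ≠ v) (hu : u ∈ f.verts) (hv : v ∈ f.verts) (hu' : u ∈ g.verts)
    (hv' : v ∈ g.verts) : ¬ Coplanar ℝ ((τ.face f : Set E3) ∪ τ.face g) := by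
  have cases : ∀ f g : HatFace, f ≠ g → ∀ u v, u ≠ v → u ∈ f.verts → v ∈ f.verts → u ∈ g.verts →
      v ∈ g.verts → ∀ P : HatFace → HatFace → Prop, (∀ f g, P f g → P g f) →
      (∀ j l m : Fin 3, m ≠ j → x m ∈ (band l).verts → P (brim j) (band l)) →
      (∀ j, P (band j) (crown j)) → (∀ j l, j ≠ l → P (crown j) (crown l)) → P f g := by
    intro f g h u v huv h1 h2 h3 h4 P hP hbb hbc hcc
    have key : ∀ f g : HatFace, f ≠ g → 1 < (f.verts ∩ g.verts).card →
        ((∃ j l m, m ≠ j ∧ x m ∈ (band l).verts ∧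
          ((f = brim j ∧ g = band l) ∨ (g = brim j ∧ f = band l))) ∨
        (∃ j, (f = band j ∧ g = crown j) ∨ (g = band j ∧ f = crown j)) ∨
        ∃ j l, j ≠ l ∧ f = crown j ∧ g = crown l) := by decide
    have hcard : 1 < (f.verts ∩ g.verts).card := Finset.one_lt_card.2
      ⟨u, Finset.mem_inter.2 ⟨h1, h3⟩, v, Finset.mem_inter.2 ⟨h2, h4⟩, huv⟩
    rcases key f g h hcard with
      ⟨j, l, m, h5, h6, ⟨rfl, rfl⟩ | ⟨rfl, rfl⟩⟩ | ⟨j, ⟨rfl, rfl⟩ | ⟨rfl, rfl⟩⟩ | ⟨j, l, hjl, rfl, rfl⟩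
    · exact hbb _ _ _ h5 h6
    · exact hP _ _ (hbb _ _ _ h5 h6)
    · exact hbc _
    · exact hP _ _ (hbc _)
    · exact hcc _ _ hjl
  have p1 := lt_innerHeight
  have p2 := innerHeight_lt
  have p3 := lt_crownHeight
  refine cases f g hfg u v huv hu hv hu' hv'
    (fun f g => ¬ Coplanar ℝ ((τ.face f : Set E3) ∪ τ.face g)) (fun f g h => ?_)
    (fun j l m hm hml => ?_) (fun j => ?_) (fun j l hjl => ?_)
  · rwa [Set.union_comm]
  · refine not_coplanar_brim hk (pt_mem_face hml) ?_
    rw [affineFun_pt hk]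
    simp only [HatVertex.bary, HatVertex.height, hm.symm, if_false]
    nlinarith
  · have h1 := fin_three_ne_add_one j
    have h2 := fin_three_ne_add_two j
    refine not_coplanar_of_affineFun hk j innerHeight (61 / 100) (-innerHeight) (fun v hv => ?_)
      (pt_mem_face (v := o) (by simp [HatFace.verts])) ?_
    · simp only [HatFace.verts, Finset.mem_insert, Finset.mem_singleton] at hv
      rcases hv with rfl | rfl | rfl
      · simp [HatVertex.bary, HatVertex.height]
      · simp [HatVertex.bary, HatVertex.height, h1]; ring
      · simp [HatVertex.bary, HatVertex.height, h2]; ring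
    · rw [affineFun_pt hk]
      simp only [HatVertex.bary, HatVertex.height]
      nlinarith
  · have h1 := fin_three_ne_add_one j
    have h2 := fin_three_ne_add_two j
    refine not_coplanar_of_affineFun hk j crownHeight (17 / 300)
      (-(17 / 300) * innerHeight - 39 / 100 * crownHeight) (fun v hv => ?_)
      (pt_mem_face (v := x j) (by revert j l; decide)) ?_
    · simp only [HatFace.verts, Finset.mem_insert, Finset.mem_singleton] at hv
      rcases hv with rfl | rfl | rfl
      · simp [HatVertex.bary, HatVertex.height]; ring
      · simp [HatVertex.bary, HatVertex.height, h1]; ring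
      · simp [HatVertex.bary, HatVertex.height, h2]; ring
    · rw [affineFun_pt hk]
      simp only [HatVertex.bary, HatVertex.height, if_true]
      nlinarith

end Tile

/-- The tetrahedron with a hat over every small triangle. -/
noncomputable def hatted (k : ℕ) (hk : 1 ≤ k) : TriPolyhedron where
  faces := (Set.finite_range fun q : Tile k × HatFace => q.1.face q.2).toFinset
  card_eq_three t ht := by
    obtain ⟨⟨τ, f⟩, rfl⟩ := (Set.Finite.mem_toFinset _).1 ht
    exact τ.card_face hk f
  affineIndependent t ht := by
    obtain ⟨⟨τ, f⟩, rfl⟩ := (Set.Finite.mem_toFinset _).1 ht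
    exact τ.affineIndependent_face hk f
  inter_eq s hs t ht := by
    obtain ⟨⟨τ, f⟩, rfl⟩ := (Set.Finite.mem_toFinset _).1 hs
    obtain ⟨⟨τ', f'⟩, rfl⟩ := (Set.Finite.mem_toFinset _).1 ht
    exact Tile.convexHull_inter_face hk τ τ' f f'
  two_faces e he := by
    rintro ⟨t, ht, het⟩
    obtain ⟨⟨τ, f⟩, rfl⟩ := (Set.Finite.mem_toFinset _).1 ht
    obtain ⟨p, q, hpq, rfl⟩ := Finset.card_eq_two.1 he
    obtain ⟨u, hu, rfl⟩ := Tile.mem_face.1 (het (Finset.mem_insert_self _ _))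
    obtain ⟨v, hv, rfl⟩ := Tile.mem_face.1 (het (Finset.mem_insert_of_mem (Finset.mem_singleton_self _)))
    obtain ⟨τ', f', hne, h⟩ := τ.exists_neighbour hk f hu hv (by rintro rfl; exact hpq rfl)
    rw [Set.ncard_eq_two]
    refine ⟨τ.face f, τ'.face f', fun h => hne ?_, ?_⟩
    · obtain ⟨rfl, rfl⟩ := (Tile.face_eq_iff hk).1 h
      exact ⟨rfl, rfl⟩
    · ext t
      simp only [Set.mem_ofPred_eq, Set.Finite.mem_toFinset, Finset.insert_subset_iff,
        Finset.singleton_subset_iff, Set.mem_insert_iff, Set.mem_singleton_iff]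
      constructor
      · rintro ⟨⟨⟨σ, g⟩, rfl⟩, h1⟩
        rcases (h σ g).1 h1 with ⟨rfl, rfl⟩ | ⟨rfl, rfl⟩
        · exact Or.inl rfl
        · exact Or.inr rfl
      · rintro (rfl | rfl)
        · exact ⟨⟨(τ, f), rfl⟩, (h _ _).2 (Or.inl ⟨rfl, rfl⟩)⟩
        · exact ⟨⟨(τ', f'), rfl⟩, (h _ _).2 (Or.inr ⟨rfl, rfl⟩)⟩
  not_coplanar s hs t ht hst := by
    rintro ⟨e, he, hes, het⟩
    obtain ⟨⟨τ, f⟩, rfl⟩ := (Set.Finite.mem_toFinset _).1 hs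
    obtain ⟨⟨σ, g⟩, rfl⟩ := (Set.Finite.mem_toFinset _).1 ht
    obtain ⟨p, q, hpq, rfl⟩ := Finset.card_eq_two.1 he
    simp only [Finset.insert_subset_iff, Finset.singleton_subset_iff] at hes het
    obtain ⟨u, hu, rfl⟩ := Tile.mem_face.1 hes.1
    obtain ⟨v, hv, rfl⟩ := Tile.mem_face.1 hes.2
    have huv : u ≠ v := by rintro rfl; exact hpq rfl
    by_cases hτ : σ = τ
    · subst hτ
      have h1 := (Tile.pt_mem_face_iff hk).1 het.1
      have h2 := (Tile.pt_mem_face_iff hk).1 het.2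
      exact Tile.not_coplanar_hat hk (fun h => hst (by dsimp only at h ⊢; rw [h])) huv hu hv h1 h2
    · have corner : ∀ {w}, τ.pt w ∈ σ.face g → ∃ j, w = c j := by
        intro w hw
        by_contra hn
        push Not at hn
        exact hτ (Tile.pt_mem_face_of_inner hk hn hw)
      obtain ⟨m, rfl⟩ := corner het.1
      obtain ⟨n, rfl⟩ := corner het.2
      have hmn : m ≠ n := fun h => huv (by rw [h])
      obtain ⟨j, hm, hn⟩ := exists_fin_three_ne m n
      obtain ⟨τ', j', h1, h2, h3⟩ := τ.exists_opposite_brim hk j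
      rcases (h3 m n hmn hm hn σ g).1 het with h | ⟨rfl, rfl⟩
      · exact absurd h.1 hτ
      have := f.eq_brim m n hmn hu hv j hm hn
      subst this
      exact Tile.not_coplanar_brim hk (Tile.pt_mem_face (v := x j') (by simp [HatFace.verts]))
        (Tile.affineFun_opposite_ne_zero hk h1 h2)

theorem mem_hatted_faces {k : ℕ} {hk : 1 ≤ k} {t : Finset E3} :
    t ∈ (hatted k hk).faces ↔ ∃ (τ : Tile k) (f : HatFace), τ.face f = t := by
  simp [hatted]

/-! ### Metric properties -/

/-- The outward direction has squared coordinate length 1 + 3 · (1/9) = 4/3, whence the height term.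
`innerHeight` and `crownHeight` are exactly what makes the slanted edges have squared lengths
841/800 and 4913/20000. -/
theorem HatVertex.dist_formula {f : HatFace} {u v : HatVertex} (hu : u ∈ f.verts)
    (hv : v ∈ f.verts) :
    ∑ j, (u.bary j - v.bary j) ^ 2 + 4 / 3 * (u.height - v.height) ^ 2 = u.sqLen v := by
  have h1 := innerHeight_sq
  have h2 := crownHeight_sq
  have no : ∀ f : HatFace, (∀ j, c j ∈ f.verts → x j ∉ f.verts) ∧ (∀ j, c j ∈ f.verts → o ∉ f.verts) := by
    decide
  rcases u with i | i | _ <;> rcases v with j | j | _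
  · by_cases h : i = j
    · simp [h, HatVertex.sqLen]
    · simp only [HatVertex.sqLen, h, if_false, HatVertex.height]
      revert h; fin_cases i <;> fin_cases j <;>
        simp [Fin.sum_univ_three, HatVertex.bary] <;> norm_num
  · have h : i ≠ j := by rintro rfl; exact (no f).1 i hu hv
    simp only [HatVertex.sqLen, h, if_false, HatVertex.height]
    revert h; fin_cases i <;> fin_cases j <;>
      simp [Fin.sum_univ_three, HatVertex.bary] <;> linear_combination (4 / 3) * h1
  · exact absurd hv ((no f).2 i hu)
  · have h : i ≠ j := by rintro rfl; exact (no f).1 i hv hu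
    simp only [HatVertex.sqLen, h, if_false, HatVertex.height]
    revert h; fin_cases i <;> fin_cases j <;>
      simp [Fin.sum_univ_three, HatVertex.bary] <;> linear_combination (4 / 3) * h1
  · by_cases h : i = j
    · simp [h, HatVertex.sqLen]
    · simp only [HatVertex.sqLen, h, if_false, HatVertex.height]
      revert h; fin_cases i <;> fin_cases j <;>
        simp [Fin.sum_univ_three, HatVertex.bary] <;> norm_num
  · simp only [HatVertex.sqLen, HatVertex.height]
    fin_cases i <;> simp [Fin.sum_univ_three, HatVertex.bary] <;> linear_combination (4 / 3) * h2
  · exact absurd hu ((no f).2 j hv)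
  · simp only [HatVertex.sqLen, HatVertex.height]
    fin_cases j <;> simp [Fin.sum_univ_three, HatVertex.bary] <;> linear_combination (4 / 3) * h2
  · simp [HatVertex.sqLen]

theorem HatFace.acute {f : HatFace} {u v w : HatVertex} (hu : u ∈ f.verts) (hv : v ∈ f.verts)
    (hw : w ∈ f.verts) (huv : u ≠ v) (hvw : v ≠ w) (huw : u ≠ w) :
    u.sqLen w < u.sqLen v + w.sqLen v := by
  have sub : ∀ f : HatFace, (∃ i, f.verts = {c (i + 1), c (i + 2), x i}) ∨
      (∃ i, f.verts = {c i, x (i + 1), x (i + 2)}) ∨ ∃ i, f.verts = {o, x (i + 1), x (i + 2)} := by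
    decide
  have h1 := fin_three_ne_add_one
  have h2 := fin_three_ne_add_two
  have h3 : ∀ i : Fin 3, i + 1 ≠ i + 2 := by decide
  rcases sub f with ⟨i, h⟩ | ⟨i, h⟩ | ⟨i, h⟩ <;> rw [h] at hu hv hw <;>
    simp only [Finset.mem_insert, Finset.mem_singleton] at hu hv hw <;>
    rcases hu with rfl | rfl | rfl <;> rcases hv with rfl | rfl | rfl <;>
    rcases hw with rfl | rfl | rfl <;>
    first
      | exact absurd rfl huv
      | exact absurd rfl hvw
      | exact absurd rfl huw
      | (simp only [HatVertex.sqLen, h1 i, h2 i, h3 i, (h1 i).symm, (h2 i).symm, (h3 i).symm,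
          if_false]; norm_num)

theorem HatFace.exists_isosceles (f : HatFace) : ∃ u ∈ f.verts, ∃ v ∈ f.verts, ∃ w ∈ f.verts,
    u ≠ v ∧ v ≠ w ∧ u ≠ w ∧ u.sqLen v = u.sqLen w := by
  have h1 := fin_three_ne_add_one
  have h2 := fin_three_ne_add_two
  have h3 : ∀ i : Fin 3, i + 1 ≠ i + 2 := by decide
  rcases f with j | j | j
  · exact ⟨x j, by simp [HatFace.verts], c (j + 1), by simp [HatFace.verts], c (j + 2),
      by simp [HatFace.verts], by simp, by simp, by simp,
      by simp [HatVertex.sqLen]⟩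
  · exact ⟨c j, by simp [HatFace.verts], x (j + 1), by simp [HatFace.verts], x (j + 2),
      by simp [HatFace.verts], by simp, by simp, by simp,
      by simp [HatVertex.sqLen]⟩
  · exact ⟨o, by simp [HatFace.verts], x (j + 1), by simp [HatFace.verts], x (j + 2),
      by simp [HatFace.verts], by simp, by simp, by simp, rfl⟩

namespace Tile

variable {k : ℕ}

theorem dist_pt_sq (τ : Tile k) {f : HatFace} {u v : HatVertex} (hu : u ∈ f.verts)
    (hv : v ∈ f.verts) : dist (τ.pt u) (τ.pt v) ^ 2 = 4 / (k : ℝ) ^ 2 * u.sqLen v := by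
  rw [pt, pt, dist_tetraPoint_sq (τ.sum_coord u) (τ.sum_coord v), ← HatVertex.dist_formula hu hv]
  congr 1
  have e1 : ∑ j, (u.bary j - v.bary j) = 0 := by
    rw [Finset.sum_sub_distrib, u.sum_bary, v.sum_bary, sub_self]
  have hs : (τ.sgn : ℝ) * τ.sgn = 1 := by rcases τ.sgn_eq with h | h <;> rw [h.2] <;> norm_num
  rw [Fin.sum_univ_succAbove _ τ.i, coord_i, coord_i]
  simp only [coord_succAbove]
  rw [Fin.sum_univ_three] at e1 ⊢
  rw [Fin.sum_univ_three]
  linear_combination (2 / 3 * τ.sgn * (u.height - v.height)) * e1 +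
    ((u.bary 0 - v.bary 0) ^ 2 + (u.bary 1 - v.bary 1) ^ 2 + (u.bary 2 - v.bary 2) ^ 2) * hs

theorem isAcuteTriangle_face (hk : 1 ≤ k) (τ : Tile k) (f : HatFace) :
    IsAcuteTriangle (τ.face f) := by
  intro p hp q hq r hr hpq hqr hpr
  obtain ⟨u, hu, rfl⟩ := mem_face.1 hp
  obtain ⟨v, hv, rfl⟩ := mem_face.1 hq
  obtain ⟨w, hw, rfl⟩ := mem_face.1 hr
  have h := HatFace.acute hu hv hw (fun h => hpq (by rw [h])) (fun h => hqr (by rw [h]))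
    (fun h => hpr (by rw [h]))
  have hk' : (0 : ℝ) < 4 / (k : ℝ) ^ 2 := by positivity
  have h' := mul_lt_mul_of_pos_left h hk'
  rw [mul_add, ← τ.dist_pt_sq hu hv, ← τ.dist_pt_sq hu hw, ← τ.dist_pt_sq hw hv] at h'
  have hinner : 0 < inner ℝ (τ.pt u - τ.pt v) (τ.pt w - τ.pt v) := by
    rw [dist_eq_norm, dist_eq_norm, dist_eq_norm,
      ← sub_sub_sub_cancel_right (τ.pt u) (τ.pt w) (τ.pt v), @norm_sub_sq_real] at h'
    linarith
  rw [EuclideanGeometry.angle, InnerProductGeometry.angle, vsub_eq_sub, vsub_eq_sub,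
    Real.arccos_lt_pi_div_two]
  exact div_pos hinner (mul_pos (norm_pos_iff.2 (sub_ne_zero.2 hpq))
    (norm_pos_iff.2 (sub_ne_zero.2 hqr.symm)))

theorem isIsoscelesTriangle_face (hk : 1 ≤ k) (τ : Tile k) (f : HatFace) :
    IsIsoscelesTriangle (τ.face f) := by
  obtain ⟨u, hu, v, hv, w, hw, huv, hvw, huw, h⟩ := f.exists_isosceles
  have inj := τ.pt_injective hk
  refine ⟨_, pt_mem_face hu, _, pt_mem_face hv, _, pt_mem_face hw, inj.ne huv, inj.ne hvw,
    inj.ne huw, ?_⟩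
  rw [← sq_eq_sq₀ dist_nonneg dist_nonneg, τ.dist_pt_sq hu hv, τ.dist_pt_sq hu hw, h]

end Tile

/-! ### The shape of the polyhedron -/

theorem isRegularTetrahedron_tetra : IsRegularTetrahedron tetra := by
  refine ⟨√8, by positivity, fun i j hij => ?_⟩
  rw [dist_eq_norm, ← Real.sqrt_sq (norm_nonneg (tetra i - tetra j)), ← real_inner_self_eq_norm_sq,
    inner_sub_left, inner_sub_right, inner_sub_right]
  simp only [inner_tetra, if_true, hij, hij.symm, if_false]
  norm_num

theorem isOutwardNormal_tetra (i : Fin 4) : IsOutwardNormal tetra i (-tetra i) := by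
  refine ⟨fun j l hj hl => ?_, fun j hj => ?_⟩
  · simp [inner_neg_left, inner_sub_right, inner_tetra, hj.symm, hl.symm]
  · simp only [inner_neg_left, inner_sub_right, inner_tetra, hj.symm, if_true, if_false]
    norm_num

theorem sum_outward_smul_tetra (i : Fin 4) : ∑ l, outward i l • tetra l = (4 / 3 : ℝ) • -tetra i := by
  have h := sum_tetra
  rw [Fin.sum_univ_succAbove _ i] at h ⊢
  simp only [outward, if_true, Fin.succAbove_ne, if_false, ← Finset.smul_sum]
  rw [eq_neg_of_add_eq_zero_right h]
  module

theorem tetraPoint_add_smul (k : ℕ) (X : Fin 4 → ℝ) (h : ℝ) (i : Fin 4) :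
    tetraPoint k (X + h • outward i) = tetraPoint k X + (4 / 3 * h / k) • -tetra i := by
  simp only [tetraPoint, Pi.add_apply, Pi.smul_apply, smul_eq_mul, add_smul, Finset.sum_add_distrib,
    mul_smul, ← Finset.smul_sum, sum_outward_smul_tetra, smul_add]
  module

namespace Tile

variable {k : ℕ}

theorem flat_eq_sum (τ : Tile k) {a : Fin 3 → ℝ} (ha : ∑ j, a j = 1) :
    τ.flat a = ∑ j, a j • τ.coord (c j) := by
  funext l
  simp only [Finset.sum_apply, Pi.smul_apply, smul_eq_mul, coord_corner, corner]
  rcases Fin.eq_self_or_eq_succAbove τ.i l with rfl | ⟨m, rfl⟩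
  · simp [flat_i, τ.b_i, (Fin.succAbove_ne _ _).symm]
  · rw [flat_succAbove]
    push_cast
    simp only [mul_add, Finset.sum_add_distrib, ← Finset.sum_mul, ha, one_mul,
      (Fin.succAbove_right_injective (p := τ.i)).eq_iff]
    simp [mul_comm]

open Classical in
/-- The faces of the hat over a small triangle. -/
noncomputable def hat (τ : Tile k) : Finset (Finset E3) := Finset.univ.image τ.face

theorem isHat_hat (hk : 1 ≤ k) (τ : Tile k) {t : Finset E3}
    (ht : (t : Set E3) = Set.range fun j => τ.pt (c j)) : IsHat t (-tetra τ.i) τ.hat := by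
  classical
  refine ⟨τ.pt (c 0), τ.pt (c 1), τ.pt (c 2), τ.pt (x 0), τ.pt (x 1), τ.pt (x 2), τ.pt o, ?_, ?_, ?_⟩
  · rw [← Finset.coe_inj, ht]
    ext p
    simp [Fin.exists_fin_succ, eq_comm]
  · have key : ∀ v : HatVertex, 0 < v.height → ∃ q ∈ convexHull ℝ (t : Set E3), ∃ h : ℝ, 0 < h ∧
        τ.pt v = q + h • -tetra τ.i := by
      intro v hv
      refine ⟨tetraPoint k (τ.flat v.bary), ?_, 4 / 3 * v.height / k, by positivity,
        tetraPoint_add_smul _ _ _ _⟩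
      rw [τ.flat_eq_sum v.sum_bary, ← sum_smul_tetraPoint]
      refine (convex_convexHull ℝ _).sum_mem (fun j _ => v.bary_nonneg j) v.sum_bary
        fun j _ => subset_convexHull ℝ _ ?_
      rw [ht]
      exact ⟨j, rfl⟩
    have p1 := innerHeight_pos
    have p2 := crownHeight_pos
    intro v hv
    simp only [Finset.mem_insert, Finset.mem_singleton] at hv
    rcases hv with rfl | rfl | rfl | rfl
    · exact key _ p1
    · exact key _ p1
    · exact key _ p1
    · exact key _ (add_pos p1 p2)
  · have : (Finset.univ : Finset HatFace) = {brim 0, brim 1, brim 2, band 0, band 1, band 2,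
      crown 2, crown 0, crown 1} := by decide
    rw [hat, this]
    simp only [Finset.image_insert, Finset.image_singleton, face, HatFace.verts]
    rfl

theorem eq_of_range_eq (hk : 1 ≤ k) {τ τ' : Tile k}
    (h : Set.range (fun j => τ.pt (c j)) = Set.range fun j => τ'.pt (c j)) : τ = τ' := by
  refine (eq_of_corners fun m => ?_).symm
  obtain ⟨m', hm'⟩ : τ.pt (c m) ∈ Set.range fun j => τ'.pt (c j) := h ▸ ⟨m, rfl⟩
  rcases pt_eq hk hm' with ⟨rfl, h⟩ | ⟨j, j', h1, h2, h3⟩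
  · exact ⟨m, rfl⟩
  · rw [c.injEq] at h1 h2
    exact ⟨j, by rw [h2, h3]⟩

theorem range_pt_eq (τ : Tile k) (a : Fin 4 → Fin 4 → ℕ)
    (h : ∀ m l, (a (τ.i.succAbove m) l : ℤ) = τ.corner m l) :
    (Set.range fun m => τ.pt (c m)) = {p | ∃ j, j ≠ τ.i ∧ p = gridPoint tetra k (a j)} := by
  have key : ∀ m, gridPoint tetra k (a (τ.i.succAbove m)) = τ.pt (c m) := by
    intro m
    rw [pt, coord_corner, gridPoint, tetraPoint, Finset.smul_sum]
    refine Finset.sum_congr rfl fun l _ => ?_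
    rw [smul_smul, ← h]
    congr 1
    push_cast
    ring
  ext p
  constructor
  · rintro ⟨m, rfl⟩
    exact ⟨_, Fin.succAbove_ne _ _, (key m).symm⟩
  · rintro ⟨j, hj, rfl⟩
    obtain ⟨m, rfl⟩ := Fin.exists_succAbove_eq hj
    exact ⟨m, (key m).symm⟩

end Tile

theorem mem_smallTriangles_iff {k : ℕ} {i : Fin 4} {t : Finset E3} :
    t ∈ smallTriangles tetra k i ↔
      ∃ τ : Tile k, τ.i = i ∧ (t : Set E3) = Set.range fun j => τ.pt (c j) := by
  constructor
  · rintro (⟨b, hbi, hb, ht⟩ | ⟨b, hbi, hpos, hb, ht⟩)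
    · refine ⟨⟨i, true, fun l => b l, by simp [hbi], by simp; exact_mod_cast hb, by simp, by simp⟩,
        rfl, ?_⟩
      rw [ht, Tile.range_pt_eq _ fun j => b + Pi.single j 1]
      intro m l
      simp only [Tile.corner, Tile.sgn, if_true, Pi.add_apply, Pi.single_apply]
      split_ifs <;> simp
    · refine ⟨⟨i, false, fun l => b l, by simp [hbi], ?_, by simp, ?_⟩, rfl, ?_⟩
      · have : (∑ l, (b l : ℤ)) = k + 1 := by exact_mod_cast hb
        simp [this]
      · intro _ l hl; exact_mod_cast hpos l hl
      · rw [ht, Tile.range_pt_eq _ fun j => b - Pi.single j 1]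
        intro m l
        simp only [Tile.corner, Tile.sgn, Pi.sub_apply, Pi.single_apply]
        by_cases h1 : l = i.succAbove m
        · have := hpos l (by rw [h1]; exact Fin.succAbove_ne _ _)
          simp only [h1, if_true] at this ⊢
          push_cast [Nat.cast_sub this]
          simp [sub_eq_add_neg]
        · simp [h1]
  · rintro ⟨τ, rfl, ht⟩
    obtain ⟨b, hb⟩ : ∃ b : Fin 4 → ℕ, ∀ l, τ.b l = b l :=
      ⟨fun l => (τ.b l).toNat, fun l => (Int.toNat_of_nonneg (τ.nonneg l)).symm⟩
    have hs := τ.sum_b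
    have hb0 : b τ.i = 0 := by have := hb τ.i; rw [τ.b_i] at this; exact_mod_cast this.symm
    simp only [hb] at hs
    cases hu : τ.up
    · right
      have hp : ∀ l, l ≠ τ.i → 1 ≤ b l := fun l hl => by
        have := τ.pos hu l hl
        rw [hb] at this
        exact_mod_cast this
      refine ⟨b, hb0, hp, ?_, ?_⟩
      · rw [hu] at hs
        have hs' : (∑ l, (b l : ℤ)) = k + 1 := by simp at hs; linarith
        exact_mod_cast hs'
      · rw [ht, τ.range_pt_eq fun j => b - Pi.single j 1]
        intro m l
        simp only [Tile.corner, Tile.sgn, Pi.sub_apply, Pi.single_apply, hu, hb]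
        by_cases h1 : l = τ.i.succAbove m
        · have := hp l (by rw [h1]; exact Fin.succAbove_ne _ _)
          simp only [h1, if_true] at this ⊢
          push_cast [Nat.cast_sub this]
          simp [sub_eq_add_neg]
        · simp [h1]
    · left
      refine ⟨b, hb0, ?_, ?_⟩
      · rw [hu, if_pos rfl] at hs
        exact_mod_cast hs
      · rw [ht, τ.range_pt_eq fun j => b + Pi.single j 1]
        intro m l
        simp only [Tile.corner, Tile.sgn, Pi.add_apply, Pi.single_apply, hu, hb]
        split_ifs <;> simp

theorem isHattedTetrahedron_hatted (k : ℕ) (hk : 1 ≤ k) : (hatted k hk).IsHattedTetrahedron k := by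
  classical
  -- The hat of a vertex set is that of the chosen small triangle with these corners, unique by
  -- `eq_of_range_eq`; the default `∅` is never used for a genuine small triangle.
  refine ⟨tetra, fun i => -tetra i, fun i t => if h : ∃ τ : Tile k, τ.i = i ∧ (t : Set E3) =
    Set.range fun j => τ.pt (c j) then h.choose.hat else ∅, isRegularTetrahedron_tetra,
    isOutwardNormal_tetra, fun i t ht => ?_, fun f => ?_⟩
  · have h := mem_smallTriangles_iff.1 ht
    simp only [dif_pos h]
    have h1 := h.choose_spec
    have := Tile.isHat_hat hk _ h1.2
    rwa [h1.1] at this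
  · have key : ∀ (τ : Tile k) (t : Finset E3),
        (t : Set E3) = (Set.range fun j => τ.pt (c j)) →
        ∀ h : ∃ τ' : Tile k, τ'.i = τ.i ∧ (t : Set E3) = Set.range fun j => τ'.pt (c j),
        h.choose = τ := fun τ t ht h => Tile.eq_of_range_eq hk (h.choose_spec.2.symm.trans ht)
    rw [mem_hatted_faces]
    constructor
    · rintro ⟨τ, g, rfl⟩
      have ht : ((Finset.univ.image fun j => τ.pt (c j) : Finset E3) : Set E3) =
        Set.range fun j => τ.pt (c j) := by simp
      have h := mem_smallTriangles_iff.2 ⟨τ, rfl, ht⟩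
      refine ⟨τ.i, _, h, ?_⟩
      dsimp only
      rw [dif_pos (mem_smallTriangles_iff.1 h), key τ _ ht]
      exact Finset.mem_image_of_mem _ (Finset.mem_univ _)
    · rintro ⟨i, t, ht, hf⟩
      obtain ⟨τ, rfl, h⟩ := mem_smallTriangles_iff.1 ht
      dsimp only at hf
      rw [dif_pos (mem_smallTriangles_iff.1 ht), key τ _ h] at hf
      obtain ⟨g, -, hg⟩ := Finset.mem_image.1 hf
      exact ⟨τ, g, hg⟩

/-! ### Counting pieces -/

/-- A connected component with m vertices has at least m - 1 edges; this is summed over the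
components. -/
theorem SimpleGraph.card_le_card_connectedComponent_add_card_edgeSet {V : Type*} [Finite V]
    (G : SimpleGraph V) : Nat.card V ≤ Nat.card G.ConnectedComponent + Nat.card G.edgeSet := by
  classical
  have := Fintype.ofFinite V
  have h1 : Nat.card V = ∑ c : G.ConnectedComponent, Nat.card c := by
    rw [← Nat.card_sigma]
    exact Nat.card_congr (Equiv.sigmaFiberEquiv G.connectedComponentMk).symm
  have h2 : Nat.card (Σ c : G.ConnectedComponent, c.toSimpleGraph.edgeSet) ≤ Nat.card G.edgeSet := by
    refine Nat.card_le_card_of_injective (fun p => p.1.toSimpleGraph_hom.mapEdgeSet p.2) ?_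
    rintro ⟨c, e, he⟩ ⟨c', e', he'⟩ h
    have h' : e.map (Subtype.val) = e'.map Subtype.val := congrArg Subtype.val h
    induction e with | h u v
    induction e' with | h u' v'
    have hc : c = c' := by
      simp only [Sym2.map_mk, Sym2.eq_iff] at h'
      rcases h' with h' | h'
      · have e1 : G.connectedComponentMk u = c := u.2
        have e2 : G.connectedComponentMk u' = c' := u'.2
        rw [← e1, ← e2, h'.1]
      · have e1 : G.connectedComponentMk u = c := u.2
        have e2 : G.connectedComponentMk v' = c' := v'.2
        rw [← e1, ← e2, h'.1]
    subst hc
    have := Sym2.map.injective Subtype.val_injective h'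
    exact congrArg (Sigma.mk c) (Subtype.ext this)
  rw [Nat.card_sigma] at h2
  have h3 : ∀ c : G.ConnectedComponent, Nat.card c ≤ Nat.card c.toSimpleGraph.edgeSet + 1 :=
    fun c => c.connected_toSimpleGraph.card_vert_le_card_edgeSet_add_one
  calc Nat.card V = ∑ c : G.ConnectedComponent, Nat.card c := h1
    _ ≤ ∑ c : G.ConnectedComponent, (Nat.card c.toSimpleGraph.edgeSet + 1) :=
      Finset.sum_le_sum fun c _ => h3 c
    _ = ∑ c : G.ConnectedComponent, Nat.card c.toSimpleGraph.edgeSet +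
        Nat.card G.ConnectedComponent := by
      rw [Finset.sum_add_distrib]; simp
    _ ≤ _ := by omega

/-- If each of the `n` blocks of a graph falls apart into two parts with no edge between them, and
the edges between different blocks are given by at most three partners per block, then the graph has
at least `n / 2` components. -/
theorem SimpleGraph.card_le_two_mul_card_connectedComponent {T F : Type*} [Finite T] [Finite F]
    (G : SimpleGraph (T × F)) (A : T → F → Prop) (h1 : ∀ τ, ∃ f, A τ f) (h2 : ∀ τ, ∃ f, ¬ A τ f)
    (hA : ∀ τ f g, G.Adj (τ, f) (τ, g) → A τ f → A τ g) (s t : T × Fin 3 → T × F)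
    (hst : ∀ p q, p.1 ≠ q.1 → G.Adj p q → ∃ d, s d = p ∧ t d = q) :
    Nat.card T ≤ 2 * Nat.card G.ConnectedComponent := by
  classical
  have := Fintype.ofFinite T
  obtain ⟨β, hβ⟩ : ∃ β : T × F → T × Bool, β = fun p => (p.1, decide (A p.1 p.2)) := ⟨_, rfl⟩
  have hsurj : Function.Surjective β := by
    rintro ⟨τ, b⟩
    cases b
    · obtain ⟨f, hf⟩ := h2 τ
      exact ⟨(τ, f), by simp [hβ, hf]⟩
    · obtain ⟨f, hf⟩ := h1 τ
      exact ⟨(τ, f), by simp [hβ, hf]⟩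
  -- The quotient with two nodes per block. It has no more components than `G`, and by `hA` no edge
  -- inside a block.
  let H : SimpleGraph (T × Bool) :=
    { Adj := fun b b' => b ≠ b' ∧ ∃ p q, G.Adj p q ∧ β p = b ∧ β q = b'
      symm := ⟨fun b b' ⟨h, p, q, h1, h2, h3⟩ => ⟨h.symm, q, p, h1.symm, h3, h2⟩⟩
      loopless := ⟨fun b h => h.1 rfl⟩ }
  have hcc : Nat.card H.ConnectedComponent ≤ Nat.card G.ConnectedComponent := by
    have step : ∀ p q, G.Adj p q →
        H.connectedComponentMk (β p) = H.connectedComponentMk (β q) := by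
      intro p q h
      by_cases hne : β p = β q
      · rw [hne]
      · exact SimpleGraph.ConnectedComponent.sound (SimpleGraph.Adj.reachable
          (show H.Adj _ _ from ⟨hne, p, q, h, rfl, rfl⟩))
    refine Nat.card_le_card_of_surjective (SimpleGraph.ConnectedComponent.lift
      (fun p => H.connectedComponentMk (β p)) ?_) ?_
    · intro v w p hp
      clear hp
      induction p with
      | nil => rfl
      | cons h _ ih => exact (step _ _ h).trans ih
    · intro c
      induction c using SimpleGraph.ConnectedComponent.ind with | h b
      obtain ⟨p, rfl⟩ := hsurj b
      exact ⟨G.connectedComponentMk p, rfl⟩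
  -- Every oriented edge of the quotient comes from one of the three listed partners of its initial
  -- block. Hence there are at most 3n/2 edges among 2n nodes.
  have hdart : Fintype.card H.Dart ≤ 3 * Nat.card T := by
    have hex : ∀ d : H.Dart, ∃ e : T × Fin 3, β (s e) = d.fst ∧ β (t e) = d.snd := by
      intro d
      obtain ⟨hne, p, q, hpq, e1, e2⟩ := d.adj
      have hpq1 : p.1 ≠ q.1 := by
        intro h
        obtain ⟨τ, f⟩ := p
        obtain ⟨σ, g⟩ := q
        dsimp only at h
        subst h
        apply hne
        rw [← e1, ← e2, hβ]
        have : A τ f ↔ A τ g := ⟨hA _ _ _ hpq, hA _ _ _ hpq.symm⟩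
        simp [this]
      obtain ⟨e, rfl, rfl⟩ := hst p q hpq1 hpq
      exact ⟨e, e1, e2⟩
    choose e he1 he2 using hex
    have hinj : Function.Injective e := by
      intro d d' h
      apply SimpleGraph.Dart.ext
      apply Prod.ext
      · exact (he1 d).symm.trans (h ▸ he1 d')
      · exact (he2 d).symm.trans (h ▸ he2 d')
    have := Nat.card_le_card_of_injective e hinj
    rw [Nat.card_prod] at this
    simp only [Nat.card_eq_fintype_card, Fintype.card_fin] at this ⊢
    omega
  have hV := H.card_le_card_connectedComponent_add_card_edgeSet
  have hE := H.dart_card_eq_twice_card_edges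
  rw [Nat.card_eq_fintype_card (α := H.edgeSet), ← SimpleGraph.edgeFinset_card, Nat.card_prod] at hV
  simp only [Nat.card_eq_fintype_card (α := Bool), Fintype.card_bool] at hV
  omega

/-! ### The hats of an unfolding. -/

namespace Tile

variable {k : ℕ} {hk : 1 ≤ k}

theorem face_mem (τ : Tile k) (f : HatFace) : τ.face f ∈ (hatted k hk).faces :=
  mem_hatted_faces.2 ⟨τ, f, rfl⟩

/-- The faces of the polyhedron. -/
noncomputable def facesEquiv (hk : 1 ≤ k) : Tile k × HatFace ≃ (hatted k hk).faces :=
  Equiv.ofBijective (fun p => ⟨p.1.face p.2, p.1.face_mem p.2⟩) (by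
    constructor
    · rintro ⟨τ, f⟩ ⟨σ, g⟩ h
      obtain ⟨rfl, rfl⟩ := (face_eq_iff hk).1 (congrArg Subtype.val h)
      rfl
    · rintro ⟨t, ht⟩
      obtain ⟨τ, f, rfl⟩ := mem_hatted_faces.1 ht
      exact ⟨(τ, f), rfl⟩)

/-- The dual graph left after cutting, on the indices of the faces. -/
noncomputable def tileGraph (U : (hatted k hk).EdgeUnfolding) : SimpleGraph (Tile k × HatFace) :=
  ((hatted k hk).dualGraph U.cut).comap (facesEquiv hk)

theorem tileGraph_adj {U : (hatted k hk).EdgeUnfolding} {p q : Tile k × HatFace} :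
    (tileGraph U).Adj p q ↔ p ≠ q ∧ ∃ e ∈ (hatted k hk).edges, e ∉ U.cut ∧ e ⊆ p.1.face p.2 ∧
      e ⊆ q.1.face q.2 := by
  show (_ ≠ _ ∧ _) ↔ _
  rw [(facesEquiv hk).injective.ne_iff]
  rfl

theorem card_connectedComponent_tileGraph (U : (hatted k hk).EdgeUnfolding) :
    Nat.card (tileGraph U).ConnectedComponent = U.numPieces :=
  Nat.card_congr (SimpleGraph.Iso.comap (facesEquiv hk) _).connectedComponentEquiv

-- Nonoverlapping is only required within a piece, so the nine faces must be in the same piece; the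
-- connecting chain may leave the hat. The plane is identified with ℂ, and 4/k² is the squared scale
-- of the hat relative to the model.
open Classical in
theorem isHatLayout_of_reachable (U : (hatted k hk).EdgeUnfolding) (τ : Tile k)
    (h : ∀ f g, (tileGraph U).Reachable (τ, f) (τ, g)) :
    IsHatLayout (fun f v => Complex.orthonormalBasisOneI.repr.symm
      (U.place (facesEquiv hk (τ, f)) (τ.pt v)))
      (fun u v => ({τ.pt u, τ.pt v} : Finset E3) ∈ U.cut) (4 / (k : ℝ) ^ 2) where
  pos := by positivity
  shape f u hu v hv := by
    have e := τ.dist_pt_sq hu hv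
    rw [← U.isometric (facesEquiv hk (τ, f)) _ (subset_convexHull ℝ _ (pt_mem_face hu)) _
      (subset_convexHull ℝ _ (pt_mem_face hv))] at e
    rw [← e, Complex.normSq_eq_norm_sq, ← dist_eq_norm, LinearIsometryEquiv.dist_map]
  attached f g u v huv hu hv hu' hv' hcut := by
    have hsub : ∀ f : HatFace, u ∈ f.verts → v ∈ f.verts →
        ({τ.pt u, τ.pt v} : Finset E3) ⊆ τ.face f := by
      intro f hu hv
      rw [Finset.insert_subset_iff, Finset.singleton_subset_iff]
      exact ⟨pt_mem_face hu, pt_mem_face hv⟩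
    have he : ({τ.pt u, τ.pt v} : Finset E3) ∈ (hatted k hk).edges :=
      ⟨Finset.card_pair ((τ.pt_injective hk).ne huv), _, τ.face_mem f, hsub f hu hv⟩
    have := U.attached (facesEquiv hk (τ, f)) (facesEquiv hk (τ, g)) _ he hcut (hsub f hu hv)
      (hsub g hu' hv')
    exact ⟨by rw [this _ (subset_convexHull ℝ _ (by simp))],
      by rw [this _ (subset_convexHull ℝ _ (by simp))]⟩
  disjoint f g hfg := by
    have hd := U.nonoverlapping (facesEquiv hk (τ, f)) (facesEquiv hk (τ, g))
      ((facesEquiv hk).injective.ne (by simpa using hfg))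
      ((h f g).map (SimpleGraph.Iso.comap (facesEquiv hk) _).toHom)
    have him : ∀ f, interior (convexHull ℝ ((fun v => Complex.orthonormalBasisOneI.repr.symm
        (U.place (facesEquiv hk (τ, f)) (τ.pt v))) '' f.verts)) =
        Complex.orthonormalBasisOneI.repr.symm.toHomeomorph '' interior
          (U.place (facesEquiv hk (τ, f)) '' convexHull ℝ (τ.face f : Set E3)) := by
      intro f
      rw [Homeomorph.image_interior, AffineMap.image_convexHull, coe_face, Set.image_image]
      congr 1
      have := (Complex.orthonormalBasisOneI.repr.symm.toLinearEquiv.toLinearMap).image_convexHull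
        ((fun v => U.place (facesEquiv hk (τ, f)) (τ.pt v)) '' f.verts)
      rw [Set.image_image] at this
      exact this.symm
    rw [him, him]
    exact (Set.disjoint_image_iff (Homeomorph.injective _)).2 hd

open Classical in
/-- The faces of a hat cannot all belong together using only edges of the hat. -/
theorem exists_separation (U : (hatted k hk).EdgeUnfolding) (τ : Tile k) :
    ∃ A : HatFace → Prop, (∃ f, A f) ∧ (∃ f, ¬ A f) ∧
      ∀ f g, (tileGraph U).Adj (τ, f) (τ, g) → A f → A g := by
  -- In one piece, the planar argument separates the faces along edges of the hat. In several
  -- pieces, the faces reachable from one of them form the required class.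
  by_cases h : ∀ f g, (tileGraph U).Reachable (τ, f) (τ, g)
  · obtain ⟨A, h1, h2, h3⟩ := (isHatLayout_of_reachable U τ h).exists_separation
      (fun u v h => by rwa [Finset.pair_comm])
    refine ⟨A, h1, h2, fun f g hfg => ?_⟩
    obtain ⟨-, e, he, hcut, hf, hg⟩ := tileGraph_adj.1 hfg
    obtain ⟨p, q, hpq, rfl⟩ := Finset.card_eq_two.1 he.1
    simp only [Finset.insert_subset_iff, Finset.singleton_subset_iff] at hf hg
    obtain ⟨u, hu, rfl⟩ := mem_face.1 hf.1
    obtain ⟨v, hv, rfl⟩ := mem_face.1 hf.2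
    exact h3 f g u v (by rintro rfl; exact hpq rfl) hu hv ((pt_mem_face_iff hk).1 hg.1)
      ((pt_mem_face_iff hk).1 hg.2) hcut
  · push Not at h
    obtain ⟨f, g, h⟩ := h
    exact ⟨fun f' => (tileGraph U).Reachable (τ, f) (τ, f'), ⟨f, .refl _⟩, ⟨g, h⟩,
      fun f' g' h1 h2 => h2.trans h1.reachable⟩

end Tile

theorem le_numPieces_hatted {k : ℕ} {hk : 1 ≤ k} (U : (hatted k hk).EdgeUnfolding) :
    2 * k ^ 2 ≤ U.numPieces := by
  choose A h1 h2 h3 using Tile.exists_separation U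
  choose τ' j' h4 h5 h6 using fun τ : Tile k => Tile.exists_opposite_brim hk τ
  -- The partners of a hat are the brims across its three grid edges; every edge between different
  -- hats is of this kind.
  have := (Tile.tileGraph U).card_le_two_mul_card_connectedComponent A h1 h2 h3
    (fun d => (d.1, brim d.2)) (fun d => (τ' d.1 d.2, brim (j' d.1 d.2))) (by
      rintro ⟨τ, f⟩ ⟨σ, g⟩ hne hadj
      dsimp only at hne
      obtain ⟨-, e, he, -, hf, hg⟩ := Tile.tileGraph_adj.1 hadj
      obtain ⟨p, q, hpq, rfl⟩ := Finset.card_eq_two.1 he.1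
      simp only [Finset.insert_subset_iff, Finset.singleton_subset_iff] at hf hg
      obtain ⟨u, hu, rfl⟩ := Tile.mem_face.1 hf.1
      obtain ⟨v, hv, rfl⟩ := Tile.mem_face.1 hf.2
      have corner : ∀ {w}, τ.pt w ∈ σ.face g → ∃ j, w = c j := by
        intro w hw
        by_contra hn
        push Not at hn
        exact hne (Tile.pt_mem_face_of_inner hk hn hw).symm
      obtain ⟨m, rfl⟩ := corner hg.1
      obtain ⟨n, rfl⟩ := corner hg.2
      have hmn : m ≠ n := by rintro rfl; exact hpq rfl
      obtain ⟨j, hm, hn⟩ := exists_fin_three_ne m n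
      have := f.eq_brim m n hmn hu hv j hm hn
      subst this
      rcases (h6 τ j m n hmn hm hn σ g).1 hg with h | ⟨rfl, rfl⟩
      · exact absurd h.1.symm hne
      · exact ⟨(τ, j), rfl, rfl⟩)
  rw [Tile.card_connectedComponent_tileGraph] at this
  have := Tile.le_card k
  omega

/-! ### The surface is a sphere -/

theorem mem_surface_hatted {k : ℕ} {hk : 1 ≤ k} {p : E3} : p ∈ (hatted k hk).surface ↔
    ∃ (τ : Tile k) (f : HatFace) (w : HatVertex → ℝ), IsFaceWeight f w ∧ ∑ v, w v • τ.pt v = p := by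
  simp only [TriPolyhedron.surface, Set.mem_iUnion, exists_prop, mem_hatted_faces]
  constructor
  · rintro ⟨_, ⟨τ, f, rfl⟩, hp⟩
    exact ⟨τ, f, (Tile.mem_convexHull_face hk).1 hp⟩
  · rintro ⟨τ, f, hw⟩
    exact ⟨_, ⟨τ, f, rfl⟩, (Tile.mem_convexHull_face hk).2 hw⟩

theorem isCompact_surface (P : TriPolyhedron) : IsCompact P.surface :=
  P.faces.isCompact_biUnion fun t _ => t.finite_toSet.isCompact_convexHull ℝ

/-- The projection of the surface to the boundary of the tetrahedron. -/
noncomputable def project (k : ℕ) (p : E3) : E3 :=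
  tetraPoint k (pushDown fun j => tetraCoord k j p)

theorem continuous_tetraPoint (k : ℕ) : Continuous (tetraPoint k) := by
  unfold tetraPoint; fun_prop

theorem continuous_project (k : ℕ) : Continuous (project k) := by
  refine (continuous_tetraPoint k).comp (continuous_pushDown.comp (continuous_pi fun j => ?_))
  exact (tetraCoord k j).continuous_of_finiteDimensional

theorem Tile.project_sum {k : ℕ} (hk : 1 ≤ k) (τ : Tile k) {f : HatFace} {w : HatVertex → ℝ}
    (hw : IsFaceWeight f w) :
    project k (∑ v, w v • τ.pt v) = tetraPoint k (τ.flat (baryOf w)) := by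
  rw [project, ← τ.pushDown_sum_coord hw]
  congr 2
  funext j
  rw [τ.sum_smul_pt, tetraCoord_tetraPoint hk (τ.sum_sum_coord hw.sum)]

/-- The boundary of the tetrahedron, in barycentric coordinates. -/
def IsBoundaryPoint (k : ℕ) (y : Fin 4 → ℝ) : Prop :=
  (∀ l, 0 ≤ y l) ∧ ∑ l, y l = k ∧ ∃ i, y i = 0

theorem Tile.isBoundaryPoint_flat {k : ℕ} (τ : Tile k) {f : HatFace} {w : HatVertex → ℝ}
    (hw : IsFaceWeight f w) : IsBoundaryPoint k (τ.flat (baryOf w)) :=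
  ⟨τ.flat_nonneg (baryOf_nonneg hw) (sum_baryOf hw), τ.sum_flat (sum_baryOf hw), τ.i, flat_i _ _⟩

theorem IsBoundaryPoint.ne_zero {k : ℕ} (hk : 1 ≤ k) {y : Fin 4 → ℝ} (h : IsBoundaryPoint k y) :
    tetraPoint k y ≠ 0 := by
  obtain ⟨i, hi⟩ := h.2.2
  intro h0
  have := tetraCoord_tetraPoint hk h.2.1 i
  rw [h0, hi, tetraCoord_apply, inner_zero_left] at this
  have hk' : (0 : ℝ) < k := by positivity
  linarith

/-- A ray from the centre meets the boundary once: where `y` vanishes, nonnegativity of `y'` gives r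
≥ 1, and where `y'` vanishes, nonnegativity of `y` gives r ≤ 1. -/
theorem IsBoundaryPoint.eq_of_smul_eq {k : ℕ} (hk : 1 ≤ k) {y y' : Fin 4 → ℝ}
    (h : IsBoundaryPoint k y) (h' : IsBoundaryPoint k y') {r : ℝ} (hr : 0 < r)
    (heq : tetraPoint k y = r • tetraPoint k y') : y = y' := by
  have hk' : (0 : ℝ) < k := by positivity
  have key : ∀ j, y j - k / 4 = r * (y' j - k / 4) := by
    intro j
    have e1 := tetraCoord_tetraPoint hk h.2.1 j
    have e2 := tetraCoord_tetraPoint hk h'.2.1 j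
    rw [tetraCoord_apply] at e1 e2
    rw [heq, real_inner_smul_left] at e1
    linear_combination r * e2 - e1
  obtain ⟨i, hi⟩ := h.2.2
  obtain ⟨i', hi'⟩ := h'.2.2
  have h1 := key i
  have h2 := key i'
  rw [hi] at h1
  rw [hi'] at h2
  have p1 := mul_nonneg hr.le (h'.1 i)
  have p2 := h.1 i'
  have hr1 : r = 1 := by
    apply le_antisymm <;> nlinarith
  funext j
  have := key j
  rw [hr1] at this
  linarith

theorem sum_inner_smul_tetra (s : E3) : ∑ j, inner ℝ s (tetra j) • tetra j = (4 : ℝ) • s := by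
  obtain ⟨X, hX, rfl⟩ := exists_tetraPoint_eq le_rfl s
  simp only [tetraPoint, Nat.cast_one, div_one, one_smul, inner_sum_tetra, sub_smul,
    Finset.sum_sub_distrib, ← Finset.smul_sum, sum_tetra, smul_zero, sub_zero, mul_smul]

/-- The inner products of `s` with the vertices sum to 0 and do not all vanish, so the smallest is
negative. Scaling it to -1 makes the corresponding barycentric coordinate 0 and leaves the others
nonnegative. -/
theorem exists_isBoundaryPoint {k : ℕ} (hk : 1 ≤ k) {s : E3} (hs : s ≠ 0) :
    ∃ y, IsBoundaryPoint k y ∧ ∃ r : ℝ, 0 < r ∧ tetraPoint k y = r • s := by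
  have hk' : (0 : ℝ) < k := by positivity
  obtain ⟨i, -, hi⟩ := Finset.exists_min_image Finset.univ (fun j => inner ℝ s (tetra j))
    Finset.univ_nonempty
  have hsum : ∑ j, inner ℝ s (tetra j) = 0 := by rw [← inner_sum, sum_tetra, inner_zero_right]
  have hneg : inner ℝ s (tetra i) < 0 := by
    by_contra hn
    push Not at hn
    have h0 : ∀ j ∈ Finset.univ, inner ℝ s (tetra j) = 0 :=
      (Finset.sum_eq_zero_iff_of_nonneg fun j hj => hn.trans (hi j hj)).1 hsum
    have := sum_inner_smul_tetra s
    rw [Finset.sum_eq_zero fun j hj => by rw [h0 j hj, zero_smul]] at this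
    exact hs ((smul_eq_zero.1 this.symm).resolve_left (by norm_num))
  obtain ⟨m, hm⟩ : ∃ m, m = -inner ℝ s (tetra i) := ⟨_, rfl⟩
  have hm0 : 0 < m := by linarith
  refine ⟨fun j => k / 4 * (1 + inner ℝ s (tetra j) / m), ⟨fun l => ?_, ?_, i, ?_⟩, 1 / m,
    by positivity, ?_⟩
  · have h1 := hi l (Finset.mem_univ _)
    have : -1 ≤ inner ℝ s (tetra l) / m := by
      rw [le_div_iff₀ hm0]; linarith
    have : 0 ≤ 1 + inner ℝ s (tetra l) / m := by linarith
    positivity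
  · rw [← Finset.mul_sum, Finset.sum_add_distrib, ← Finset.sum_div, hsum]
    simp
  · have : inner ℝ s (tetra i) = -m := by linarith
    simp only [this]
    field_simp
    ring
  · have : ∀ j, ((k : ℝ) / 4 * (1 + inner ℝ s (tetra j) / m)) • tetra j =
        ((k : ℝ) / 4) • tetra j + ((k : ℝ) / 4 / m) • inner ℝ s (tetra j) • tetra j := by
      intro j
      rw [smul_smul, ← add_smul]
      congr 1
      ring
    simp only [tetraPoint, this, Finset.sum_add_distrib, ← Finset.smul_sum, sum_tetra,
      sum_inner_smul_tetra, smul_zero, zero_add]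
    rw [smul_smul, smul_smul]
    congr 1
    field_simp

/-- The radial projection of the surface. -/
noncomputable def toSphere (k : ℕ) (hk : 1 ≤ k) (p : (hatted k hk).surface) :
    Metric.sphere (0 : E3) 1 :=
  ⟨‖project k p‖⁻¹ • project k p, by
    obtain ⟨τ, f, w, hw, h⟩ := mem_surface_hatted.1 p.2
    have h0 : project k p ≠ 0 := by
      rw [← h, τ.project_sum hk hw]
      exact (τ.isBoundaryPoint_flat hw).ne_zero hk
    rw [mem_sphere_zero_iff_norm, norm_smul, norm_inv, norm_norm,
      inv_mul_cancel₀ (norm_ne_zero_iff.2 h0)]⟩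

theorem continuous_toSphere (k : ℕ) (hk : 1 ≤ k) : Continuous (toSphere k hk) := by
  have h1 : Continuous fun p : (hatted k hk).surface => project k p :=
    (continuous_project k).comp continuous_subtype_val
  refine Continuous.subtype_mk (Continuous.smul (h1.norm.inv₀ fun p => ?_) h1) _
  obtain ⟨τ, f, w, hw, h⟩ := mem_surface_hatted.1 p.2
  rw [← h, τ.project_sum hk hw]
  exact norm_ne_zero_iff.2 ((τ.isBoundaryPoint_flat hw).ne_zero hk)

/-- Injectivity combines uniqueness of the boundary point on a ray with uniqueness of the surface
point above a flat point. Surjectivity uses that the small triangles cover the boundary and that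
each hat covers its base. -/
theorem bijective_toSphere (k : ℕ) (hk : 1 ≤ k) : Function.Bijective (toSphere k hk) := by
  constructor
  · rintro ⟨p, hp⟩ ⟨p', hp'⟩ h
    obtain ⟨τ, f, w, hw, rfl⟩ := mem_surface_hatted.1 hp
    obtain ⟨τ', f', w', hw', rfl⟩ := mem_surface_hatted.1 hp'
    have h := congrArg Subtype.val h
    simp only [toSphere, τ.project_sum hk hw, τ'.project_sum hk hw'] at h
    have b := τ.isBoundaryPoint_flat hw
    have b' := τ'.isBoundaryPoint_flat hw'
    have n := norm_pos_iff.2 (b.ne_zero hk)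
    have n' := norm_pos_iff.2 (b'.ne_zero hk)
    have := b.eq_of_smul_eq hk b' (mul_pos n (inv_pos.2 n')) (by
      rw [mul_smul, ← h, smul_smul, mul_inv_cancel₀ n.ne', one_smul])
    rw [Subtype.mk.injEq, τ.sum_smul_pt, τ'.sum_smul_pt, Tile.sum_coord_eq_of_flat_eq hw hw' this]
  · rintro ⟨s, hs⟩
    have hs1 : ‖s‖ = 1 := mem_sphere_zero_iff_norm.1 hs
    obtain ⟨y, hy, r, hr, h⟩ := exists_isBoundaryPoint hk (s := s) (by
      rw [← norm_pos_iff, hs1]; norm_num)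
    obtain ⟨i, hi⟩ := hy.2.2
    obtain ⟨τ, a, ha, ha1, hτ⟩ := Tile.exists_flat_eq hk hy.1 hy.2.1 hi
    obtain ⟨f, w, hw, rfl⟩ := exists_isFaceWeight ha ha1
    refine ⟨⟨_, mem_surface_hatted.2 ⟨τ, f, w, hw, rfl⟩⟩, Subtype.ext ?_⟩
    simp only [toSphere, τ.project_sum hk hw, hτ, h, norm_smul, hs1, mul_one, Real.norm_eq_abs,
      abs_of_pos hr, smul_smul, inv_mul_cancel₀ hr.ne', one_smul]

/-- The surface is homeomorphic to the sphere. -/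
noncomputable def surfaceHomeomorph (k : ℕ) (hk : 1 ≤ k) :
    (hatted k hk).surface ≃ₜ Metric.sphere (0 : E3) 1 :=
  haveI : CompactSpace (hatted k hk).surface :=
    isCompact_iff_compactSpace.1 (isCompact_surface _)
  Continuous.homeoOfEquivCompactToT2 (f := Equiv.ofBijective _ (bijective_toSphere k hk))
    (continuous_toSphere k hk)

/-! ### Planarity -/

theorem skeleton_subset_surface (P : TriPolyhedron) : P.skeleton ⊆ P.surface := by
  intro p hp
  simp only [TriPolyhedron.skeleton, Set.mem_iUnion, exists_prop] at hp
  obtain ⟨e, ⟨-, t, ht, het⟩, hp⟩ := hp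
  exact Set.mem_biUnion ht (convexHull_mono (by exact_mod_cast het) hp)

/-- The barycentre of a crown face has three nonzero weights, whereas a point on an edge has at most
two. Its weight at `o` excludes a representation in another small triangle. -/
theorem exists_mem_surface_notMem_skeleton (k : ℕ) (hk : 1 ≤ k) :
    ∃ p ∈ (hatted k hk).surface, p ∉ (hatted k hk).skeleton := by
  have hne : Nonempty (Tile k) := by
    by_contra h
    rw [not_nonempty_iff] at h
    have := Tile.le_card k
    rw [Nat.card_of_isEmpty] at this
    have : 0 < 4 * k ^ 2 := by positivity
    omega
  obtain ⟨τ⟩ := hne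
  obtain ⟨w, hwdef⟩ : ∃ w : HatVertex → ℝ, w = fun v => if v ∈ (crown 0).verts then 1 / 3 else 0 :=
    ⟨_, rfl⟩
  have hw : IsFaceWeight (crown 0) w := by
    refine ⟨fun v => ?_, ?_, fun v hv => ?_⟩
    · rw [hwdef]; dsimp only; split_ifs <;> norm_num
    · rw [hwdef, Finset.sum_ite_mem, Finset.univ_inter, Finset.sum_const,
        show (crown 0).verts.card = 3 by decide]
      norm_num
    · rw [hwdef]; exact if_neg hv
  refine ⟨_, mem_surface_hatted.2 ⟨τ, crown 0, w, hw, rfl⟩, fun hp => ?_⟩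
  simp only [TriPolyhedron.skeleton, Set.mem_iUnion, exists_prop] at hp
  obtain ⟨e, ⟨he, t, ht, het⟩, hp⟩ := hp
  obtain ⟨σ, g, rfl⟩ := mem_hatted_faces.1 ht
  obtain ⟨a, b, hab, rfl⟩ := Finset.card_eq_two.1 he
  obtain ⟨u, hu, rfl⟩ := Tile.mem_face.1 (het (Finset.mem_insert_self _ _))
  obtain ⟨v, hv, rfl⟩ :=
    Tile.mem_face.1 (het (Finset.mem_insert_of_mem (Finset.mem_singleton_self _)))
  rw [Finset.coe_pair, convexHull_pair] at hp
  obtain ⟨α, β, hα, hβ, hαβ, hp⟩ := hp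
  have hw' : IsFaceWeight g (α • Pi.single u 1 + β • Pi.single v 1) := by
    refine ⟨fun v => ?_, ?_, fun z hz => ?_⟩
    · simp only [Pi.add_apply, Pi.smul_apply, smul_eq_mul, Pi.single_apply]
      split_ifs <;> simp <;> positivity
    · simp [Finset.sum_add_distrib, ← Finset.mul_sum, hαβ]
    · have h1 : z ≠ u := by rintro rfl; exact hz hu
      have h2 : z ≠ v := by rintro rfl; exact hz hv
      simp [h1, h2]
  have hfl := Tile.flat_eq_of_sum_eq hk (τ := τ) (τ' := σ) hw hw' (by
    rw [← hp]
    simp only [Pi.add_apply, Pi.smul_apply, smul_eq_mul, add_smul, Finset.sum_add_distrib, mul_smul,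
      ← Finset.smul_sum]
    simp [Pi.single_apply])
  have hmem : ∀ z ∈ (crown 0).verts, w z ≠ 0 := fun z hz => by
    rw [hwdef]; dsimp only; rw [if_pos hz]; norm_num
  rcases Tile.weights_unique hw hw' hfl with ⟨-, hww⟩ | ⟨h1, -⟩
  · have hsub : (crown 0).verts ⊆ {u, v} := by
      intro z hz
      by_contra hn
      simp only [Finset.mem_insert, Finset.mem_singleton, not_or] at hn
      apply hmem z hz
      rw [hww]
      simp [hn.1, hn.2]
    have h1 := Finset.card_le_card hsub
    have h2 : ({u, v} : Finset HatVertex).card ≤ 2 := Finset.card_le_two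
    have h3 : (crown 0).verts.card = 3 := by decide
    omega
  · exact hmem o (by decide) h1.1

/-- The skeleton embeds in the sphere minus one point, which stereographic projection carries into
the plane. -/
theorem graphIsPlanar_hatted (k : ℕ) (hk : 1 ≤ k) : (hatted k hk).GraphIsPlanar := by
  obtain ⟨p, hp, hps⟩ := exists_mem_surface_notMem_skeleton k hk
  have : Fact (Module.finrank ℝ E3 = 2 + 1) := ⟨by simp⟩
  let v := surfaceHomeomorph k hk ⟨p, hp⟩
  let e := stereographic' 2 v
  let i : (hatted k hk).skeleton → (hatted k hk).surface :=
    Set.inclusion (skeleton_subset_surface _)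
  have hi : Topology.IsEmbedding i := Topology.IsEmbedding.inclusion (skeleton_subset_surface _)
  have hsrc : ∀ q, surfaceHomeomorph k hk (i q) ∈ e.source := by
    intro q
    rw [stereographic'_source, Set.mem_compl_singleton_iff]
    intro h
    have : (q : E3) = p := congrArg Subtype.val ((surfaceHomeomorph k hk).injective h)
    exact hps (this ▸ q.2)
  refine ⟨fun q => e (surfaceHomeomorph k hk (i q)), ?_⟩
  have h1 : Topology.IsEmbedding fun q : (hatted k hk).skeleton =>
      (⟨surfaceHomeomorph k hk (i q), hsrc q⟩ : e.source) :=
    ((surfaceHomeomorph k hk).isEmbedding.comp hi).codRestrict _ hsrc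
  exact Topology.IsEmbedding.subtypeVal.comp (e.toHomeomorphSourceTarget.isEmbedding.comp h1)

/-! ### Moving between small triangles -/

namespace Tile

variable {k : ℕ}

theorem sgn_of_up {τ : Tile k} (h : τ.up = true) : τ.sgn = 1 := by simp [sgn, h]

theorem sgn_of_down {τ : Tile k} (h : τ.up = false) : τ.sgn = -1 := by simp [sgn, h]

/-- The upward small triangle at a corner. -/
def base (hk : 1 ≤ k) (i p : Fin 4) (hp : i ≠ p) : Tile k where
  i := i
  up := true
  b := Pi.single p ((k : ℤ) - 1)
  b_i := Pi.single_eq_of_ne hp _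
  sum_b := by simp
  nonneg l := by
    rw [Pi.single_apply]; split_ifs
    · omega
    · rfl
  pos h := by simp at h

section

variable {A : Tile k → Prop} (hA : ∀ τ j τ', τ.Opposite j τ' → (A τ ↔ A τ'))

include hA

/-- Crossing the edge opposite to corner `r` and then the one opposite to corner `p` moves an upward
triangle one step, from `r` towards `p`. -/
theorem iff_of_shift {τ τ' : Tile k} (hu : τ.up = true) (hu' : τ'.up = true) (hi : τ'.i = τ.i)
    {p r : Fin 4} (hp : p ≠ τ.i) (hr : r ≠ τ.i) (hpr : p ≠ r)
    (hb : ∀ l, τ'.b l = τ.b l + (if l = p then 1 else 0) - if l = r then 1 else 0) :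
    A τ ↔ A τ' := by
  obtain ⟨j, rfl⟩ := Fin.exists_succAbove_eq hr
  obtain ⟨m, rfl⟩ := Fin.exists_succAbove_eq hp
  obtain ⟨σ, hσ⟩ := τ.exists_opposite j
  rw [hA _ _ _ hσ]
  rcases hσ with ⟨hσi, hσu, hσb⟩ | ⟨-, -, h0, -⟩
  · obtain ⟨ρ, hρ⟩ := σ.exists_opposite m
    rw [hA _ _ _ hρ]
    rw [hu] at hσu
    rcases hρ with ⟨hρi, hρu, hρb⟩ | ⟨h, -⟩
    · have : ρ = τ' := by
        refine Tile.ext (by rw [hρi, hσi, hi]) (by rw [hρu, hσu, hu']; rfl) (funext fun l => ?_)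
        rw [hρb, hb, hσi, hσb, sgn_of_up hu, sgn_of_down hσu]
        by_cases h1 : l = τ.i
        · subst h1
          simp [hp.symm, hr.symm]
        · by_cases h2 : l = τ.i.succAbove j
          · subst h2
            simp [hr, hpr.symm, sub_eq_add_neg]
          · by_cases h3 : l = τ.i.succAbove m
            · subst h3
              simp [hp, hpr]
            · simp [h1, h2, h3]
      rw [this]
    · rw [hσu] at h; cases h
  · have h1 := hb (τ.i.succAbove j)
    rw [h0, if_neg hpr.symm, if_pos rfl] at h1
    have := τ'.nonneg (τ.i.succAbove j)
    omega

/-- Induction on the number of steps from the triangle to the corner `p` of its face. -/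
theorem iff_base (hk : 1 ≤ k) {i p : Fin 4} (hp : i ≠ p) (n : ℕ) : ∀ τ : Tile k, τ.up = true →
    τ.i = i → (k : ℤ) - 1 - τ.b p = n → (A τ ↔ A (base hk i p hp)) := by
  induction n with
  | zero =>
    intro τ hu hi hn
    have hs := τ.sum_b'
    rw [sgn_of_up hu] at hs
    have hsp : ∑ l, τ.b l = τ.b p := by push_cast at hn; linarith
    have h0 : ∀ l, l ≠ p → τ.b l = 0 := by
      rw [← Finset.add_sum_erase _ _ (Finset.mem_univ p)] at hsp
      have := (Finset.sum_eq_zero_iff_of_nonneg fun l _ => τ.nonneg l).1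
        (show ∑ l ∈ Finset.univ.erase p, τ.b l = 0 by linarith)
      intro l hl
      exact this l (Finset.mem_erase.2 ⟨hl, Finset.mem_univ _⟩)
    have : τ = base hk i p hp := by
      refine Tile.ext hi hu (funext fun l => ?_)
      show τ.b l = (Pi.single p ((k : ℤ) - 1) : Fin 4 → ℤ) l
      rcases eq_or_ne l p with rfl | h
      · rw [Pi.single_eq_same]; push_cast at hn; linarith
      · rw [Pi.single_eq_of_ne h, h0 l h]
    rw [this]
  | succ n ih =>
    intro τ hu hi hn
    have hs := τ.sum_b'
    rw [sgn_of_up hu] at hs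
    obtain ⟨r, hrp, hr⟩ : ∃ r, r ≠ p ∧ 1 ≤ τ.b r := by
      by_contra hcon
      push Not at hcon
      have : ∑ l ∈ Finset.univ.erase p, τ.b l ≤ 0 := Finset.sum_nonpos fun l hl => by
        have := hcon l (Finset.ne_of_mem_erase hl); omega
      rw [← Finset.add_sum_erase _ _ (Finset.mem_univ p)] at hs
      push_cast at hn
      linarith
    have hri : r ≠ τ.i := by rintro rfl; rw [τ.b_i] at hr; omega
    obtain ⟨τ', hi', hu', hb'⟩ : ∃ τ' : Tile k, τ'.i = τ.i ∧ τ'.up = true ∧ ∀ l, τ'.b l =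
        τ.b l + (if l = p then 1 else 0) - if l = r then 1 else 0 := by
      refine ⟨⟨τ.i, true, fun l => τ.b l + (if l = p then 1 else 0) - if l = r then 1 else 0,
        ?_, ?_, fun l => ?_, by simp⟩, rfl, rfl, fun l => rfl⟩
      · rw [τ.b_i, if_neg (hi ▸ hp), if_neg hri.symm]; rfl
      · simp [Finset.sum_sub_distrib, Finset.sum_add_distrib]; exact hs
      · have := τ.nonneg l
        split_ifs with h1 h2 h2
        · omega
        · omega
        · subst h2; omega
        · omega
    rw [iff_of_shift hA hu hu' hi' (hi ▸ hp.symm) hri hrp.symm hb']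
    refine ih τ' hu' (hi'.trans hi) ?_
    rw [hb', if_pos rfl, if_neg hrp.symm]
    push_cast at hn
    linarith

/-- Any two small triangles are joined by a sequence of opposite small triangles. -/
theorem iff_of_opposite (hk : 1 ≤ k) (τ τ' : Tile k) : A τ ↔ A τ' := by
  have h1 : ∀ (τ : Tile k) (p : Fin 4) (hp : τ.i ≠ p), A τ ↔ A (base hk τ.i p hp) := by
    have up : ∀ (τ : Tile k) (p : Fin 4) (hp : τ.i ≠ p), τ.up = true →
        (A τ ↔ A (base hk τ.i p hp)) := by
      intro τ p hp hu
      have hs := τ.sum_b'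
      rw [sgn_of_up hu] at hs
      have h2 : τ.b p ≤ ∑ l, τ.b l :=
        Finset.single_le_sum (fun l _ => τ.nonneg l) (Finset.mem_univ p)
      obtain ⟨n, hn⟩ := Int.eq_ofNat_of_zero_le (show 0 ≤ (k : ℤ) - 1 - τ.b p by linarith)
      exact iff_base hA hk hp n τ hu rfl hn
    intro τ p hp
    cases hu : τ.up
    · obtain ⟨σ, hσ⟩ := τ.exists_opposite 0
      rw [hA _ _ _ hσ]
      rcases hσ with ⟨hi, hu', -⟩ | ⟨h, -⟩
      · rw [hu] at hu'
        have hp' := hp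
        rw [← hi] at hp'
        rw [up σ p hp' hu']
        simp only [hi]
      · rw [hu] at h; cases h
    · exact up τ p hp hu
  -- The upward triangles at one corner `p` of the tetrahedron, on two different faces, are
  -- neighbours across an edge of the tetrahedron.
  have h2 : ∀ (i r p : Fin 4) (hp : i ≠ p) (hrp : r ≠ p), A (base hk i p hp) ↔
      A (base hk r p hrp) := by
    intro i r p hp hrp
    rcases eq_or_ne r i with rfl | hri
    · rfl
    obtain ⟨j, hj⟩ := Fin.exists_succAbove_eq hri
    exact hA _ j _ (Or.inr ⟨rfl, rfl, by
      show (Pi.single p _ : Fin 4 → ℤ) (i.succAbove j) = 0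
      rw [hj, Pi.single_eq_of_ne hrp], rfl, hj.symm⟩)
  have h3 : ∀ i i' : Fin 4, ∃ p, i ≠ p ∧ i' ≠ p := by decide
  obtain ⟨p, hp, hp'⟩ := h3 τ.i τ'.i
  rw [h1 τ p hp, h1 τ' p hp', h2 _ _ _ hp hp']

end

/-! ### Crossing the edges of one direction -/

/-- The three fixed point free involutions in the Klein four-group of permutations. -/
def swap : Fin 3 → Fin 4 → Fin 4 := ![![1, 0, 3, 2], ![2, 3, 0, 1], ![3, 2, 1, 0]]

theorem swap_swap : ∀ d i, swap d (swap d i) = i := by decide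

theorem swap_ne : ∀ d i, swap d i ≠ i := by decide

theorem exists_swap_eq : ∀ i r, r ≠ i → ∃ d, r = swap d i := by decide

theorem swap_injective : ∀ d d' i, swap d i = swap d' i → d = d' := by decide

/-- The small triangle `τ'` is the neighbour of `τ` across the edge in direction `d`. -/
def Cross (d : Fin 3) (τ τ' : Tile k) : Prop :=
  ∃ j, τ.i.succAbove j = swap d τ.i ∧ τ.Opposite j τ'

theorem exists_cross (d : Fin 3) (τ : Tile k) : ∃ τ', Cross d τ τ' := by
  obtain ⟨j, hj⟩ := Fin.exists_succAbove_eq (swap_ne d τ.i)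
  obtain ⟨τ', h⟩ := τ.exists_opposite j
  exact ⟨τ', j, hj, h⟩

theorem Cross.unique {d : Fin 3} {τ τ₁ τ₂ : Tile k} (h₁ : Cross d τ τ₁) (h₂ : Cross d τ τ₂) :
    τ₁ = τ₂ := by
  obtain ⟨j, hj, h⟩ := h₁
  obtain ⟨j', hj', h'⟩ := h₂
  rw [← Fin.succAbove_right_injective (hj.trans hj'.symm)] at h'
  exact opposite_unique h h'

theorem Cross.symm {d : Fin 3} {τ τ' : Tile k} (h : Cross d τ τ') : Cross d τ' τ := by
  obtain ⟨j, hj, ⟨hi, hu, hb⟩ | ⟨hu, hu', h0, hb, hi⟩⟩ := h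
  · refine ⟨j, by rw [hi, hj], Or.inl ⟨hi.symm, by rw [hu]; simp, fun l => ?_⟩⟩
    have hs : τ'.sgn = -τ.sgn := by unfold sgn; rw [hu]; cases τ.up <;> simp
    rw [hb, hi, hs]
    split_ifs <;> ring
  · have hi' : τ.i = swap d τ'.i := by rw [hi, hj, swap_swap]
    obtain ⟨j', hj'⟩ := Fin.exists_succAbove_eq (swap_ne d τ'.i)
    exact ⟨j', hj', Or.inr ⟨hu', hu, by rw [hj', ← hi', hb, τ.b_i], hb.symm, by rw [hj', hi']⟩⟩

theorem Cross.ne {d : Fin 3} {τ τ' : Tile k} (h : Cross d τ τ') : τ' ≠ τ :=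
  h.choose_spec.2.ne

theorem Opposite.cross {j : Fin 3} {τ τ' : Tile k} (h : τ.Opposite j τ') :
    ∃ d, τ.i.succAbove j = swap d τ.i ∧ Cross d τ τ' := by
  obtain ⟨d, hd⟩ := exists_swap_eq τ.i _ (Fin.succAbove_ne τ.i j)
  exact ⟨d, hd, j, hd, h⟩

/-- A set of small triangles closed under crossing the edges of one direction is even. -/
theorem even_card_of_cross (d : Fin 3) (s : Finset (Tile k))
    (h : ∀ τ ∈ s, ∀ τ', Cross d τ τ' → τ' ∈ s) : Even s.card := by
  choose ι hι using exists_cross (k := k) d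
  have : (∑ _τ ∈ s, (1 : ZMod 2)) = 0 :=
    Finset.sum_involution (fun τ _ => ι τ) (fun _ _ => by decide) (fun τ _ _ => (hι τ).ne)
      (fun τ hτ => h τ hτ _ (hι τ)) fun τ _ => (hι (ι τ)).unique (hι τ).symm
  rw [Finset.sum_const, nsmul_one, ZMod.natCast_eq_zero_iff_even] at this
  exact this

/-- A set of small triangles which is not closed under crossing edges is not so for at least two
pairs of neighbours. -/
theorem iff_of_cross_of_unique (A : Tile k → Prop) (hA : ∀ d σ σ', Cross d σ σ' → A σ → ¬ A σ' →
    ∀ d' τ τ', Cross d' τ τ' → A τ → ¬ A τ' → d' = d ∧ τ = σ) {j : Fin 3} {τ τ' : Tile k}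
    (h : τ.Opposite j τ') : A τ ↔ A τ' := by
  classical
  have := Fintype.ofFinite (Tile k)
  have key : ∀ d σ σ', Cross d σ σ' → A σ → A σ' := by
    intro d σ σ' h h1
    by_contra h2
    have hu := hA d σ σ' h h1 h2
    -- If the only exit from `A` is from `σ` in direction `d`, then `A` is closed under crossing in
    -- direction `d'`, so its size is even; and `A` without `σ` is closed in direction `d`, so its
    -- size is odd.
    obtain ⟨d', hd⟩ : ∃ d', d' ≠ d := exists_ne d
    have e1 := even_card_of_cross d' (Finset.univ.filter A) (by
      intro τ hτ τ' hc
      simp only [Finset.mem_filter, Finset.mem_univ, true_and] at hτ ⊢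
      by_contra hn
      exact hd (hu d' τ τ' hc hτ hn).1)
    have e2 := even_card_of_cross d ((Finset.univ.filter A).erase σ) (by
      intro τ hτ τ' hc
      simp only [Finset.mem_erase, Finset.mem_filter, Finset.mem_univ, true_and] at hτ ⊢
      refine ⟨?_, ?_⟩
      · rintro rfl
        rw [hc.symm.unique h] at hτ
        exact h2 hτ.2
      · by_contra hn
        exact hτ.1 (hu d τ τ' hc hτ.2 hn).2)
    have hmem : σ ∈ Finset.univ.filter A := by simp [h1]
    rw [Finset.card_erase_of_mem hmem] at e2
    have hpos := Finset.card_pos.2 ⟨σ, hmem⟩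
    obtain ⟨a, ha⟩ := e1
    obtain ⟨b, hb⟩ := e2
    omega
  obtain ⟨d, -, hc⟩ := h.cross
  exact ⟨key d _ _ hc, key d _ _ hc.symm⟩

end Tile

/-! ### The graph is 3-connected -/

/-- Adjacent or equal vertices of a hat. -/
def HatVertex.Near (u v : HatVertex) : Prop := ∃ f : HatFace, u ∈ f.verts ∧ v ∈ f.verts

instance : DecidableRel HatVertex.Near := fun u v =>
  inferInstanceAs (Decidable (∃ f : HatFace, u ∈ f.verts ∧ v ∈ f.verts))

/-- After deleting any two other vertices of a hat, each remaining vertex still reaches a surviving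
corner in at most two steps. -/
theorem HatVertex.exists_near_corner : ∀ v s₁ s₂ : HatVertex, s₁ ≠ v → s₂ ≠ v → ∃ j u,
    (c j ≠ s₁ ∧ c j ≠ s₂) ∧ (u ≠ s₁ ∧ u ≠ s₂) ∧ v.Near u ∧ u.Near (c j) := by
  decide

theorem HatVertex.near_corner : ∀ i j, (c i).Near (c j) := by decide

namespace Tile

variable {k : ℕ} (hk : 1 ≤ k)

/-- The vertices of the polyhedron. -/
noncomputable def vert (τ : Tile k) (v : HatVertex) : (hatted k hk).vertices :=
  ⟨τ.pt v, τ.face v.exists_face.choose, τ.face_mem _, pt_mem_face v.exists_face.choose_spec⟩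

theorem vert_injective (τ : Tile k) : Function.Injective (τ.vert hk) := fun _ _ h =>
  τ.pt_injective hk (congrArg Subtype.val h)

theorem exists_vert_eq (p : (hatted k hk).vertices) : ∃ (τ : Tile k) (v : HatVertex),
    τ.vert hk v = p := by
  obtain ⟨p, t, ht, hp⟩ := p
  obtain ⟨τ, f, rfl⟩ := mem_hatted_faces.1 ht
  obtain ⟨v, -, rfl⟩ := mem_face.1 hp
  exact ⟨τ, v, rfl⟩

/-- Joined by a path avoiding a set of vertices. -/
def Joined (S : Set (hatted k hk).vertices) (p q : (hatted k hk).vertices) : Prop :=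
  ∃ (hp : p ∈ Sᶜ) (hq : q ∈ Sᶜ), ((hatted k hk).graph.induce Sᶜ).Reachable ⟨p, hp⟩ ⟨q, hq⟩

variable {hk} {S : Set (hatted k hk).vertices}

theorem Joined.symm {p q : (hatted k hk).vertices} (h : Joined hk S p q) : Joined hk S q p :=
  ⟨h.2.1, h.1, h.2.2.symm⟩

theorem Joined.trans {p q r : (hatted k hk).vertices} (h : Joined hk S p q)
    (h' : Joined hk S q r) : Joined hk S p r :=
  ⟨h.1, h'.2.1, h.2.2.trans h'.2.2⟩

theorem joined_of_near {τ : Tile k} {u v : HatVertex} (huv : u.Near v) (hu : τ.vert hk u ∉ S)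
    (hv : τ.vert hk v ∉ S) : Joined hk S (τ.vert hk u) (τ.vert hk v) := by
  refine ⟨hu, hv, ?_⟩
  by_cases h : u = v
  · subst h; rfl
  · refine SimpleGraph.Adj.reachable ?_
    obtain ⟨f, h1, h2⟩ := huv
    exact ⟨(τ.vert_injective hk).ne h, τ.face f, τ.face_mem f, pt_mem_face h1, pt_mem_face h2⟩

open Classical in
theorem card_filter_vert_le (hS : S.Finite) (hc : S.ncard < 3) (τ : Tile k) :
    (Finset.univ.filter fun v => τ.vert hk v ∈ S).card ≤ 2 := by
  have : (Finset.univ.filter fun v => τ.vert hk v ∈ S).card ≤ hS.toFinset.card :=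
    Finset.card_le_card_of_injOn (τ.vert hk) (fun v hv => by simpa using hv)
      (τ.vert_injective hk).injOn
  rw [← Set.ncard_eq_toFinset_card S hS] at this
  omega

/-- The deleted vertices of the hat are padded to exactly two, different from the given vertex. Both
endpoints then reach surviving corners, and corners are mutually adjacent. -/
theorem joined_hat (hS : S.Finite) (hc : S.ncard < 3) {τ : Tile k} {u v : HatVertex}
    (hu : τ.vert hk u ∉ S) (hv : τ.vert hk v ∉ S) : Joined hk S (τ.vert hk u) (τ.vert hk v) := by
  classical
  have key : ∀ v, τ.vert hk v ∉ S → ∃ j, τ.vert hk (c j) ∉ S ∧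
      Joined hk S (τ.vert hk v) (τ.vert hk (c j)) := by
    intro v hv
    obtain ⟨D, hD1, hD2, hD3⟩ := Finset.exists_subsuperset_card_eq
      (s := Finset.univ.filter fun v => τ.vert hk v ∈ S) (t := Finset.univ.erase v) (n := 2)
      (fun u hu => by
        rw [Finset.mem_filter] at hu
        exact Finset.mem_erase.2 ⟨by rintro rfl; exact hv hu.2, hu.1⟩)
      (card_filter_vert_le hS hc τ)
      (by rw [Finset.card_erase_of_mem (Finset.mem_univ v)]
          have : (Finset.univ : Finset HatVertex).card = 7 := by decide
          omega)
    obtain ⟨s₁, s₂, -, rfl⟩ := Finset.card_eq_two.1 hD3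
    have surv : ∀ u, u ≠ s₁ ∧ u ≠ s₂ → τ.vert hk u ∉ S := by
      intro u hu h
      have := hD1 (Finset.mem_filter.2 ⟨Finset.mem_univ u, h⟩)
      simp [hu.1, hu.2] at this
    have hs₁ := Finset.ne_of_mem_erase (hD2 (Finset.mem_insert_self _ _))
    have hs₂ := Finset.ne_of_mem_erase (hD2 (Finset.mem_insert_of_mem (Finset.mem_singleton_self _)))
    obtain ⟨j, u, h1, h2, h3, h4⟩ := HatVertex.exists_near_corner v s₁ s₂ hs₁ hs₂
    exact ⟨j, surv _ h1, (joined_of_near h3 hv (surv _ h2)).trans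
      (joined_of_near h4 (surv _ h2) (surv _ h1))⟩
  obtain ⟨i, hi, h1⟩ := key u hu
  obtain ⟨j, hj, h2⟩ := key v hv
  exact h1.trans ((joined_of_near (HatVertex.near_corner i j) hi hj).trans h2.symm)

theorem exists_vert_notMem (hS : S.Finite) (hc : S.ncard < 3) (τ : Tile k) :
    ∃ v, τ.vert hk v ∉ S := by
  classical
  by_contra h
  push Not at h
  have h1 := card_filter_vert_le hS hc τ
  rw [Finset.filter_true_of_mem fun v _ => h v] at h1
  have : (Finset.univ : Finset HatVertex).card = 7 := by decide
  omega

/-- Let `A` be the set of small triangles whose hats are reached. Leaving `A` needs a grid edge with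
both ends deleted. With at most two deletions there is only one such edge, so
`iff_of_cross_of_unique` shows that there is no exit at all. -/
theorem joined_all (hS : S.Finite) (hc : S.ncard < 3) {τ₀ : Tile k} {v₀ : HatVertex}
    (h₀ : τ₀.vert hk v₀ ∉ S) (τ : Tile k) {v : HatVertex} (hv : τ.vert hk v ∉ S) :
    Joined hk S (τ₀.vert hk v₀) (τ.vert hk v) := by
  obtain ⟨A, hA⟩ : ∃ A : Tile k → Prop, A = fun τ => ∃ v, Joined hk S (τ₀.vert hk v₀) (τ.vert hk v) :=
    ⟨_, rfl⟩
  have hA' : ∀ τ, A τ → ∀ v, τ.vert hk v ∉ S → Joined hk S (τ₀.vert hk v₀) (τ.vert hk v) := by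
    intro τ h v hv
    rw [hA] at h
    obtain ⟨u, hu⟩ := h
    exact hu.trans (joined_hat hS hc hu.2.1 hv)
  have third : ∀ j : Fin 3, ∃ m n, m ≠ n ∧ m ≠ j ∧ n ≠ j := by decide
  have hbad : ∀ {τ τ' : Tile k} {j : Fin 3}, τ.Opposite j τ' → A τ → ¬ A τ' →
      ∀ m, m ≠ j → τ.vert hk (c m) ∈ S := by
    intro τ τ' j h h1 h2 m hm
    by_contra hS'
    obtain ⟨j', hj', -⟩ := h.exists_corner
    obtain ⟨m', -, hm'⟩ := hj' m hm
    have := hA' τ h1 _ hS'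
    have e : τ.vert hk (c m) = τ'.vert hk (c m') := Subtype.ext (pt_corner_eq hm')
    rw [e] at this
    exact h2 (by rw [hA]; exact ⟨_, this⟩)
  have hclosed : ∀ τ j τ', τ.Opposite j τ' → (A τ ↔ A τ') := by
    intro τ j τ' h
    refine iff_of_cross_of_unique A ?_ h
    rintro d σ σ' ⟨i, hi, ho⟩ h1 h2 d' ρ ρ' ⟨i', hi', ho'⟩ h1' h2'
    obtain ⟨m, n, hmn, hm, hn⟩ := third i
    obtain ⟨m', n', hmn', hm', hn'⟩ := third i'
    have b := hbad ho h1 h2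
    have b' := hbad ho' h1' h2'
    obtain ⟨σ₁, l, hσ₁, -, hl⟩ := σ.exists_opposite_brim hk i
    -- An exit uses up all deletions, so two exits have the same grid edge. Its two sides are `σ` in
    -- `A` and `σ'` outside `A`, hence the second exit also starts from `σ`.
    have hSeq : S = {σ.vert hk (c m), σ.vert hk (c n)} := by
      refine (Set.eq_of_subset_of_ncard_le ?_ ?_ hS).symm
      · rintro _ (rfl | rfl)
        · exact b m hm
        · exact b n hn
      · rw [Set.ncard_pair ((σ.vert_injective hk).ne (by simpa using hmn))]
        omega
    have hSeq' : S = {ρ.vert hk (c m'), ρ.vert hk (c n')} := by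
      refine (Set.eq_of_subset_of_ncard_le ?_ ?_ hS).symm
      · rintro _ (rfl | rfl)
        · exact b' m' hm'
        · exact b' n' hn'
      · rw [Set.ncard_pair ((ρ.vert_injective hk).ne (by simpa using hmn'))]
        omega
    have mem : ∀ m j : Fin 3, m ≠ j → c m ∈ (brim j).verts := by decide
    have hface : ∀ p ∈ S, (p : E3) ∈ ρ.face (brim i') := by
      rw [hSeq']
      rintro _ (rfl | rfl)
      · exact pt_mem_face (mem _ _ hm')
      · exact pt_mem_face (mem _ _ hn')
    rcases (hl m n hmn hm hn ρ (brim i')).1 ⟨hface _ (b m hm), hface _ (b n hn)⟩ with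
      ⟨rfl, h⟩ | ⟨rfl, -⟩
    · rw [brim.injEq] at h
      subst h
      exact ⟨swap_injective d' d ρ.i (hi'.symm.trans hi), rfl⟩
    · rw [opposite_unique hσ₁ ho] at h1'
      exact absurd h1' h2
  refine hA' τ ?_ v hv
  rw [← iff_of_opposite hclosed hk τ₀ τ, hA]
  exact ⟨v₀, h₀, h₀, .refl _⟩

end Tile

theorem isVertexConn_hatted (k : ℕ) (hk : 1 ≤ k) : (hatted k hk).graph.IsVertexConn 3 := by
  have hne : Nonempty (Tile k) := ⟨Tile.base hk 0 1 (by decide)⟩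
  obtain ⟨τ⟩ := hne
  refine ⟨?_, fun S hS hc => ?_⟩
  · have hfin : Finite (hatted k hk).vertices := by
      have : Finite (Tile k × HatVertex) := inferInstance
      refine Finite.of_surjective (fun q : Tile k × HatVertex => q.1.vert hk q.2) fun p => ?_
      obtain ⟨τ, v, h⟩ := Tile.exists_vert_eq hk p
      exact ⟨(τ, v), h⟩
    have := Nat.card_le_card_of_injective _ (τ.vert_injective hk)
    have h7 : Nat.card HatVertex = 7 := by rw [Nat.card_eq_fintype_card]; decide
    omega
  · obtain ⟨v, hv⟩ := Tile.exists_vert_notMem hS hc τ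
    have : Nonempty (Sᶜ : Set (hatted k hk).vertices) := ⟨⟨_, hv⟩⟩
    refine SimpleGraph.Connected.mk ?_
    have key : ∀ p : (Sᶜ : Set (hatted k hk).vertices),
        ((hatted k hk).graph.induce Sᶜ).Reachable ⟨_, hv⟩ p := by
      rintro ⟨p, hp⟩
      obtain ⟨σ, u, rfl⟩ := Tile.exists_vert_eq hk p
      exact (Tile.joined_all hS hc hv σ hp).2.2
    exact fun p q => (key p).symm.trans (key q)

theorem mainTheorem3 (k : ℕ) (hk : 1 ≤ k) :
    ∃ P : TriPolyhedron,
      P.IsHattedTetrahedron k ∧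
      P.TopologicallyConvex ∧
      (∀ t ∈ P.faces, IsAcuteTriangle t ∧ IsIsoscelesTriangle t) ∧
      ∀ U : P.EdgeUnfolding, 2 * k ^ 2 ≤ U.numPieces := by
  refine ⟨hatted k hk, isHattedTetrahedron_hatted k hk, ⟨⟨surfaceHomeomorph k hk⟩,
    isVertexConn_hatted k hk, graphIsPlanar_hatted k hk⟩, fun t ht => ?_, le_numPieces_hatted⟩
  obtain ⟨τ, f, rfl⟩ := mem_hatted_faces.1 ht
  exact ⟨τ.isAcuteTriangle_face hk f, τ.isIsoscelesTriangle_face hk f⟩
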